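/- All graphs are finite and simple. For graphs $G_1,G_2$ with disjoint vertex sets, $G_1\cup G_2$ is their disjoint union, $G_1\vee G_2$ (the join) is obtained from $G_1\cup G_2$ by adding every edge between a vertex of $G_1$ and a vertex of $G_2$, and $tG$ is the disjoint union of $t$ copies of $G$; $K_m$ is the complete graph on $m$ vertices and $K_{a,b}$ the complete bipartite graph with parts of sizes $a$ and $b$. Theorem. Let $G$ be a graph of order $n$. If $G$ has at least $\lfloor n^2/4\rfloor$ edges, then $G$ has cycles of every length $3,4,\dots,\lfloor n/2\rfloor+2$, unless $G$ is isomorphic to $K_{\lceil n/2\rceil,\lfloor n/2\rfloor}$, $K_1\vee(K_{\lceil (n-1)/2\rceil}\cup K_{\lfloor (n-1)/2\rfloor})$ or $K_2\vee 4K_1$. Moreover, for $n\ge 2$ these graphs are genuine exceptions: if a graph $G$ of order $n$ is isomorphic to one of them, then $G$ has at least $\lfloor n^2/4\rfloor$ edges, but $G$ has no cycle of length $l$ for some $l$ with $3\le l\le\lfloor n/2\rfloor+2$. -/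

import Mathlib

/-- The join `G ∨ H`: the disjoint union of `G` and `H` together with all edges between a vertex
of `G` and a vertex of `H`. -/
def graphJoin {V W : Type*} (G : SimpleGraph V) (H : SimpleGraph W) : SimpleGraph (V ⊕ W) :=
  SimpleGraph.sum G H ⊔ completeBipartiteGraph V W

/-- `G` has a cycle of length `l`. -/
def HasCycleOfLength {V : Type*} (G : SimpleGraph V) (l : ℕ) : Prop :=
  ∃ (v : V) (p : G.Walk v v), p.IsCycle ∧ p.length = l

/-- The graph `K_{⌈n/2⌉,⌊n/2⌋}`. -/
abbrev balancedBipartite (n : ℕ) : SimpleGraph (Fin ((n + 1) / 2) ⊕ Fin (n / 2)) :=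
  completeBipartiteGraph (Fin ((n + 1) / 2)) (Fin (n / 2))

/-- The graph `K_1 ∨ (K_{⌈(n-1)/2⌉} ∪ K_{⌊(n-1)/2⌋})`; for `n ≥ 1` one has
`⌈(n-1)/2⌉ = ⌊n/2⌋`, which is `n / 2` in `ℕ`. -/
abbrev twoCliquesAtVertex (n : ℕ) :
    SimpleGraph (Fin 1 ⊕ (Fin (n / 2) ⊕ Fin ((n - 1) / 2))) :=
  graphJoin (⊤ : SimpleGraph (Fin 1))
    (SimpleGraph.sum (⊤ : SimpleGraph (Fin (n / 2))) (⊤ : SimpleGraph (Fin ((n - 1) / 2))))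

/-- The graph `K_2 ∨ 4K_1`; the edgeless graph on four vertices is `4K_1`. -/
abbrev K2JoinFourK1 : SimpleGraph (Fin 2 ⊕ Fin 4) :=
  graphJoin (⊤ : SimpleGraph (Fin 2)) (⊥ : SimpleGraph (Fin 4))

/-- `G` is isomorphic to one of the three exceptional graphs for order `n`. -/
def IsExceptional {V : Type*} (n : ℕ) (G : SimpleGraph V) : Prop :=
  Nonempty (G ≃g balancedBipartite n) ∨
  Nonempty (G ≃g twoCliquesAtVertex n) ∨
  Nonempty (G ≃g K2JoinFourK1)

/-! The argument splits on the circumference. Work first in even order n = 2m with at least m²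
edges.

Suppose some cycle has length at least m + 2, and take a longest cycle C. Deleting a vertex off C of
degree below half the order keeps the density and makes it strict, so such vertices can be removed
until every vertex off C has degree at least half the order. A path-and-gap count then forces C to
be Hamiltonian (`length_eq_card_of_longest`). Bondy's theorem (`IsCycleList.pancyclic_of_lt`) now
gives every length up to that of C; if nothing was deleted and the edge bound is tight, its equality
case (`IsCycleList.pancyclic_or_bipartite`) leaves only the balanced complete bipartite graph.

Suppose instead that all cycles have length at most m + 1. Peel off vertices of minimum degree.
Either a core of large minimum degree remains, or about half of the vertices remain and Pósa's
theorem (`exists_low_degrees_of_not_hamiltonian`) bounds the edges by less than m² when m ≥ 4. A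
core has a small end block behind a cut vertex (`exists_end_block`); the Erdős–Gallai bound on the
other side and the equality case of the count leave two cliques sharing a vertex
(`isTwoCliquesOn_of_core`). Orders 4 and 6 are done by hand, and the graph K₂ ∨ 4K₁ appears there.

For odd order 2m + 1, minimum degree at least m + 1 forces a long cycle and a strict edge bound, so
the longest-cycle argument applies. Otherwise a vertex of degree at most m is deleted and the even
case applies. Each exceptional graph has exactly ⌊n²/4⌋ edges, so when the remainder is exceptional
the degree of the deleted vertex is known well enough to decide what putting it back does.

All statements concern a finset `S` of vertices of one fixed graph, so that deletion is
`Finset.erase`, and cycles are duplicate-free lists, so that they can be cut and glued. -/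

/-- The number of neighbours of `v` inside `S`. -/
noncomputable def degIn {V : Type*} (G : SimpleGraph V) (S : Finset V) (v : V) : ℕ :=
  open Classical in (S.filter (G.Adj v)).card

/-- Twice the number of edges inside `S`. -/
noncomputable def degSum {V : Type*} (G : SimpleGraph V) (S : Finset V) : ℕ :=
  ∑ v ∈ S, degIn G S v

/-- `P` lists the vertices of a path inside `S` from `a` to `b`. -/
structure IsPathList {V : Type*} (G : SimpleGraph V) (S : Finset V) (P : List V) (a b : V) :
    Prop where
  nodup : P.Nodup
  chain : P.IsChain G.Adj
  mem : ∀ x ∈ P, x ∈ S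
  head : P.head? = some a
  last : P.getLast? = some b

/-- `P` lists the vertices of a cycle inside `S`. -/
structure IsCycleList {V : Type*} (G : SimpleGraph V) (S : Finset V) (P : List V) : Prop where
  nodup : P.Nodup
  chain : P.IsChain G.Adj
  mem : ∀ x ∈ P, x ∈ S
  close : ∀ b ∈ P.getLast?, ∀ a ∈ P.head?, G.Adj b a
  three_le : 3 ≤ P.length

/-- There is a cycle of length `l` inside `S`. -/
def CycleIn {V : Type*} (G : SimpleGraph V) (S : Finset V) (l : ℕ) : Prop :=
  ∃ P, IsCycleList G S P ∧ P.length = l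

/-! ### Paths and cycles as lists: cutting, gluing, rotating -/

section Basic

variable {V : Type*} {G : SimpleGraph V} {S T : Finset V} {P Q : List V} {a b c d : V}

theorem IsPathList.pos (h : IsPathList G S P a b) : 0 < P.length := by
  rcases P with _ | ⟨x, P⟩
  · simpa using h.head
  · simp

theorem IsPathList.ne_nil (h : IsPathList G S P a b) : P ≠ [] :=
  List.ne_nil_of_length_pos h.pos

theorem IsPathList.getElem_zero (h : IsPathList G S P a b) : P[0]'h.pos = a := by
  have := h.head
  rw [List.head?_eq_getElem?, List.getElem?_eq_getElem h.pos] at this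
  simpa using this

theorem IsPathList.getElem_last (h : IsPathList G S P a b) :
    P[P.length - 1]'(by have := h.pos; omega) = b := by
  have := h.last
  rw [List.getLast?_eq_getElem?, List.getElem?_eq_getElem (by have := h.pos; omega)] at this
  simpa using this

theorem IsPathList.head_mem (h : IsPathList G S P a b) : a ∈ P :=
  List.mem_of_mem_head? h.head

theorem IsPathList.last_mem (h : IsPathList G S P a b) : b ∈ P :=
  List.mem_of_getLast? h.last

theorem IsPathList.mono (h : IsPathList G S P a b) (hST : ∀ x ∈ P, x ∈ T) :
    IsPathList G T P a b :=
  ⟨h.nodup, h.chain, hST, h.head, h.last⟩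

theorem IsPathList.reverse (h : IsPathList G S P a b) : IsPathList G S P.reverse b a := by
  refine ⟨List.nodup_reverse.2 h.nodup, List.isChain_reverse.2 ?_, ?_, ?_, ?_⟩
  · exact h.chain.imp fun _ _ h => h.symm
  · simpa using h.mem
  · simpa using h.last
  · simpa using h.head

theorem IsPathList.append (h : IsPathList G S P a b) (h' : IsPathList G S Q c d)
    (hbc : G.Adj b c) (hd : ∀ x ∈ P, x ∉ Q) : IsPathList G S (P ++ Q) a d := by
  refine ⟨?_, ?_, ?_, ?_, ?_⟩
  · exact h.nodup.append h'.nodup hd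
  · rw [List.isChain_append]
    refine ⟨h.chain, h'.chain, ?_⟩
    rw [h.last, h'.head]
    simpa using hbc
  · intro x hx
    rcases List.mem_append.1 hx with hx | hx
    exacts [h.mem x hx, h'.mem x hx]
  · rw [List.head?_append_of_ne_nil _ h.ne_nil, h.head]
  · rw [List.getLast?_append_of_ne_nil _ h'.ne_nil, h'.last]

theorem isPathList_singleton (ha : a ∈ S) : IsPathList G S [a] a a :=
  ⟨by simp, by simp, by simpa using ha, by simp, by simp⟩

theorem IsPathList.take (h : IsPathList G S P a b) {i : ℕ} (hi : i < P.length) :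
    IsPathList G S (P.take (i + 1)) a P[i] := by
  refine ⟨h.nodup.sublist (List.take_sublist _ _), h.chain.take _, ?_, ?_, ?_⟩
  · exact fun x hx => h.mem x (List.mem_of_mem_take hx)
  · rw [List.head?_take]; simpa using h.head
  · rw [List.getLast?_take]; simp [hi]

theorem IsPathList.drop (h : IsPathList G S P a b) {i : ℕ} (hi : i < P.length) :
    IsPathList G S (P.drop i) P[i] b := by
  refine ⟨h.nodup.sublist (List.drop_sublist _ _), h.chain.drop _, ?_, ?_, ?_⟩
  · exact fun x hx => h.mem x (List.mem_of_mem_drop hx)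
  · simp [hi]
  · rw [List.getLast?_drop]; simpa [hi] using h.last

theorem disjoint_take_drop (h : P.Nodup) (i j : ℕ) (hij : i ≤ j) :
    ∀ x ∈ P.take i, x ∉ P.drop j := by
  intro x hx hx'
  exact List.disjoint_take_drop h hij hx hx'

theorem IsPathList.isCycleList (h : IsPathList G S P a b) (hab : G.Adj b a)
    (h3 : 3 ≤ P.length) : IsCycleList G S P :=
  ⟨h.nodup, h.chain, h.mem, by rw [h.last, h.head]; simpa using hab, h3⟩

theorem IsCycleList.exists_isPathList (h : IsCycleList G S P) :
    ∃ a b, IsPathList G S P a b ∧ G.Adj b a := by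
  have h3 := h.three_le
  have hne : P ≠ [] := by rintro rfl; simp at h3
  refine ⟨P.head hne, P.getLast hne, ⟨h.nodup, h.chain, h.mem, ?_, ?_⟩, ?_⟩
  · exact List.head?_eq_some_head hne
  · exact List.getLast?_eq_some_getLast hne
  · exact h.close _ (by simp [List.getLast?_eq_some_getLast hne]) _
      (by simp [List.head?_eq_some_head hne])

theorem IsCycleList.mono (h : IsCycleList G S P) (hST : ∀ x ∈ P, x ∈ T) : IsCycleList G T P :=
  ⟨h.nodup, h.chain, hST, h.close, h.three_le⟩

theorem CycleIn.mono {l : ℕ} (h : CycleIn G S l) (hST : S ⊆ T) : CycleIn G T l := by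
  obtain ⟨P, hP, hl⟩ := h
  exact ⟨P, hP.mono fun x hx => hST (hP.mem x hx), hl⟩

theorem CycleIn.le_card {l : ℕ} (h : CycleIn G S l) : l ≤ S.card := by
  classical
  obtain ⟨P, hP, rfl⟩ := h
  rw [← List.toFinset_card_of_nodup hP.nodup]
  exact Finset.card_le_card fun x hx => hP.mem x (by simpa using hx)

theorem IsPathList.cycleIn (h : IsPathList G S P a b) (hab : G.Adj b a)
    (h3 : 3 ≤ P.length) : CycleIn G S P.length :=
  ⟨P, h.isCycleList hab h3, rfl⟩

/-- Moving an initial segment of a cycle to the end gives a cycle. -/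
theorem IsCycleList.rotate (h : IsCycleList G S P) (k : ℕ) : IsCycleList G S (P.rotate k) := by
  have h3 := h.three_le
  have key : ∀ k < P.length, IsCycleList G S (P.rotate k) := by
    intro k hk
    obtain ⟨a, b, hP, hab⟩ := h.exists_isPathList
    rcases k with _ | k
    · simpa using h
    rw [List.rotate_eq_drop_append_take hk.le]
    have h1 := hP.drop hk
    have h2 := hP.take (i := k) (by omega)
    have := h1.append h2 hab (fun x hx hx' =>
      disjoint_take_drop h.nodup _ _ le_rfl x hx' hx)
    refine this.isCycleList ?_ (by simp; omega)
    exact (List.isChain_iff_getElem.1 h.chain) k (by omega)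
  rw [← List.rotate_mod]
  exact key _ (Nat.mod_lt _ (by omega))

theorem List.toFinset_rotate [DecidableEq V] (k : ℕ) :
    (P.rotate k).toFinset = P.toFinset := by
  ext x; simp

end Basic

/-! ### Degrees and edge counts inside a vertex set -/

section Degrees

variable {V : Type*} {G : SimpleGraph V} {S T : Finset V}

theorem degIn_mono (h : S ⊆ T) (v : V) : degIn G S v ≤ degIn G T v := by
  classical
  exact Finset.card_le_card (Finset.filter_subset_filter _ h)

theorem degIn_congr {v : V} (h : ∀ w, G.Adj v w → (w ∈ S ↔ w ∈ T)) :
    degIn G S v = degIn G T v := by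
  classical
  unfold degIn
  congr 1
  ext w
  simp only [Finset.mem_filter]
  constructor
  · rintro ⟨h1, h2⟩; exact ⟨(h w h2).1 h1, h2⟩
  · rintro ⟨h1, h2⟩; exact ⟨(h w h2).2 h1, h2⟩

theorem degIn_lt_card {v : V} (hv : v ∈ S) : degIn G S v < S.card := by
  classical
  refine Finset.card_lt_card ?_
  rw [Finset.filter_ssubset]
  exact ⟨v, hv, by simp⟩

theorem degIn_union [DecidableEq V] (h : Disjoint S T) (v : V) :
    degIn G (S ∪ T) v = degIn G S v + degIn G T v := by
  classical
  unfold degIn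
  rw [Finset.filter_union, Finset.card_union_of_disjoint]
  exact Finset.disjoint_filter_filter h

theorem degIn_pos_iff {v : V} : 0 < degIn G S v ↔ ∃ w ∈ S, G.Adj v w := by
  classical
  unfold degIn
  rw [Finset.card_pos]
  simp [Finset.Nonempty]

theorem degIn_eq_card_iff {v : V} : degIn G S v = S.card ↔ ∀ w ∈ S, G.Adj v w := by
  classical
  unfold degIn
  rw [Finset.card_filter_eq_iff]

theorem degIn_le_card (v : V) : degIn G S v ≤ S.card := by
  classical
  exact Finset.card_filter_le _ _

theorem degIn_erase_self [DecidableEq V] (v : V) : degIn G (S.erase v) v = degIn G S v := by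
  classical
  refine degIn_congr fun w hw => ?_
  simp [hw.ne']

theorem degIn_insert [DecidableEq V] {v : V} (hv : v ∉ S) (w : V) :
    degIn G (insert v S) w = degIn G S w + (open Classical in if G.Adj w v then 1 else 0) := by
  classical
  unfold degIn
  rw [Finset.filter_insert]
  split_ifs with h
  · rw [Finset.card_insert_of_notMem (by simp [hv])]
  · rfl

theorem degIn_le_degIn_erase_add_one [DecidableEq V] (v w : V) :
    degIn G S w ≤ degIn G (S.erase v) w + 1 := by
  classical
  by_cases hv : v ∈ S
  · conv_lhs => rw [← Finset.insert_erase hv]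
    rw [degIn_insert (by simp)]
    split_ifs <;> omega
  · rw [Finset.erase_eq_of_notMem hv]; omega

theorem sum_ite_adj_eq_degIn (v : V) :
    (∑ w ∈ S, (open Classical in if G.Adj w v then 1 else 0)) = degIn G S v := by
  classical
  unfold degIn
  rw [Finset.card_filter]
  refine Finset.sum_congr rfl fun w _ => ?_
  simp [G.adj_comm]

theorem degSum_insert [DecidableEq V] {v : V} (hv : v ∉ S) :
    degSum G (insert v S) = degSum G S + 2 * degIn G S v := by
  classical
  unfold degSum
  rw [Finset.sum_insert hv]
  have h1 : degIn G (insert v S) v = degIn G S v := by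
    rw [degIn_insert hv]; simp
  rw [h1, Finset.sum_congr rfl (fun w _ => degIn_insert hv w), Finset.sum_add_distrib,
    sum_ite_adj_eq_degIn]
  omega

theorem degSum_eq_erase [DecidableEq V] {v : V} (hv : v ∈ S) :
    degSum G S = degSum G (S.erase v) + 2 * degIn G S v := by
  conv_lhs => rw [← Finset.insert_erase hv]
  rw [degSum_insert (by simp), degIn_erase_self]

theorem degSum_le : degSum G S ≤ S.card * (S.card - 1) := by
  unfold degSum
  rw [← smul_eq_mul]
  exact Finset.sum_le_card_nsmul _ _ _ fun v hv => by
    have := degIn_lt_card (G := G) hv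
    omega

theorem adj_of_degIn_eq {v : V} (hv : v ∈ S) (h : S.card ≤ degIn G S v + 1) :
    ∀ w ∈ S, v ≠ w → G.Adj v w := by
  classical
  intro w hw hvw
  by_contra hn
  have h2 : (S.filter (G.Adj v)).card ≤ ((S.erase v).erase w).card := by
    refine Finset.card_le_card fun x hx => ?_
    simp only [Finset.mem_filter] at hx
    simp only [Finset.mem_erase]
    refine ⟨?_, hx.2.ne', hx.1⟩
    rintro rfl
    exact hn hx.2
  rw [Finset.card_erase_of_mem (by simp [hw, hvw.symm]), Finset.card_erase_of_mem hv] at h2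
  have h3 : 2 ≤ S.card := Finset.one_lt_card.2 ⟨v, hv, w, hw, hvw⟩
  unfold degIn at h
  omega

/-- The equality case of the trivial edge bound. The extremal arguments use it to turn a tight count
into a clique. -/
theorem adj_of_degSum_eq (h : S.card * (S.card - 1) ≤ degSum G S) :
    ∀ v ∈ S, ∀ w ∈ S, v ≠ w → G.Adj v w := by
  intro v hv
  refine adj_of_degIn_eq hv ?_
  by_contra hlt
  have : degSum G S < ∑ _v ∈ S, (S.card - 1) := by
    unfold degSum
    refine Finset.sum_lt_sum (fun u hu => ?_) ⟨v, hv, by omega⟩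
    have := degIn_lt_card (G := G) hu
    omega
  rw [Finset.sum_const, smul_eq_mul] at this
  omega

theorem degSum_univ [Fintype V] [DecidableEq V] [DecidableRel G.Adj] :
    degSum G Finset.univ = 2 * G.edgeFinset.card := by
  rw [← G.sum_degrees_eq_twice_card_edges]
  unfold degSum
  refine Finset.sum_congr rfl fun v _ => ?_
  unfold degIn
  rw [← G.card_neighborFinset_eq_degree]
  congr 1
  ext w
  simp

/-- If no vertex of `A \ {z}` has a neighbour in `K \ A`, the edges inside `K` split. -/
theorem degSum_separation [DecidableEq V] {K A : Finset V} {z : V} (hA : A ⊆ K) (hz : z ∈ A)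
    (hsep : ∀ a ∈ A, a ≠ z → ∀ w ∈ K, G.Adj a w → w ∈ A) :
    degSum G K = degSum G A + degSum G (insert z (K \ A)) := by
  have hzB : z ∉ K \ A := by simp [hz]
  have hK : K = A.erase z ∪ insert z (K \ A) := by
    ext x
    have := @hA x
    simp only [Finset.mem_union, Finset.mem_erase, Finset.mem_insert, Finset.mem_sdiff]
    by_cases hx : x = z
    · subst hx; simp [hA hz]
    · tauto
  have hdisj : Disjoint (A.erase z) (insert z (K \ A)) := by
    rw [Finset.disjoint_left]
    intro x hx
    simp only [Finset.mem_erase] at hx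
    simp [hx.1, hx.2]
  have hK2 : K = A ∪ (K \ A) := by
    rw [Finset.union_sdiff_of_subset hA]
  have h1 : ∀ a ∈ A.erase z, degIn G K a = degIn G A a := by
    intro a ha
    simp only [Finset.mem_erase] at ha
    exact degIn_congr fun w hw => ⟨fun hwK => hsep a ha.2 ha.1 w hwK hw, fun h => hA h⟩
  have h2 : ∀ b ∈ K \ A, degIn G K b = degIn G (insert z (K \ A)) b := by
    intro b hb
    simp only [Finset.mem_sdiff] at hb
    refine degIn_congr fun w hw => ?_
    simp only [Finset.mem_insert, Finset.mem_sdiff]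
    constructor
    · intro hwK
      by_cases hwA : w ∈ A
      · left
        by_contra hwz
        exact hb.2 (hsep w hwA hwz b hb.1 hw.symm)
      · exact Or.inr ⟨hwK, hwA⟩
    · rintro (rfl | h)
      exacts [hA hz, h.1]
  have h3 : degIn G K z = degIn G A z + degIn G (insert z (K \ A)) z := by
    conv_lhs => rw [hK2]
    rw [degIn_union Finset.disjoint_sdiff, degIn_insert hzB]
    simp
  have e1 : degSum G K = ∑ v ∈ A.erase z, degIn G K v +
      (degIn G K z + ∑ v ∈ K \ A, degIn G K v) := by
    unfold degSum
    conv_lhs => rw [hK]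
    rw [Finset.sum_union hdisj, Finset.sum_insert hzB, ← hK]
  rw [e1, Finset.sum_congr rfl h1, Finset.sum_congr rfl h2, h3]
  unfold degSum
  rw [Finset.sum_insert hzB, ← Finset.add_sum_erase A _ hz]
  ring

/-- The indices of the neighbours of `v` in the list `P`. -/
noncomputable def nbrIdx (G : SimpleGraph V) (P : List V) (v : V) : Finset ℕ :=
  open Classical in
  (Finset.range P.length).filter fun i => ∃ h : i < P.length, G.Adj v P[i]

theorem mem_nbrIdx {P : List V} {v : V} {i : ℕ} :
    i ∈ nbrIdx G P v ↔ ∃ h : i < P.length, G.Adj v P[i] := by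
  classical
  simp only [nbrIdx, Finset.mem_filter, Finset.mem_range, and_iff_right_iff_imp]
  exact fun ⟨h, _⟩ => h

/-- Passing to positions on a path or cycle turns every degree count below into counting subsets of
an interval of integers. -/
theorem card_nbrIdx {P : List V} (hP : P.Nodup) {v : V}
    (hmem : ∀ w, G.Adj v w → (w ∈ S ↔ w ∈ P)) : (nbrIdx G P v).card = degIn G S v := by
  classical
  unfold degIn
  refine Finset.card_bij (fun i hi => P[i]'(mem_nbrIdx.1 hi).1) ?_ ?_ ?_
  · intro i hi
    obtain ⟨h, h'⟩ := mem_nbrIdx.1 hi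
    simp only [Finset.mem_filter]
    exact ⟨(hmem _ h').2 (List.getElem_mem h), h'⟩
  · intro i hi j hj hij
    exact (hP.getElem_inj_iff).1 hij
  · intro w hw
    simp only [Finset.mem_filter] at hw
    obtain ⟨i, hi, rfl⟩ := List.mem_iff_getElem.1 ((hmem w hw.2).1 hw.1)
    exact ⟨i, mem_nbrIdx.2 ⟨hi, hw.2⟩, rfl⟩

theorem card_nbrIdx_toFinset [DecidableEq V] {P : List V} (hP : P.Nodup) (v : V) :
    (nbrIdx G P v).card = degIn G P.toFinset v :=
  card_nbrIdx hP fun w _ => by simp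

end Degrees

/-! ### Pósa's degree condition for Hamiltonian cycles -/

section Posa

variable {V : Type*} {G : SimpleGraph V} {S : Finset V}

theorem exists_isPathList_of_complete (hS : ∀ v ∈ S, ∀ w ∈ S, v ≠ w → G.Adj v w) {a b : V}
    (ha : a ∈ S) (hb : b ∈ S) (hab : a ≠ b) {j : ℕ} (h2 : 2 ≤ j) (hj : j ≤ S.card) :
    ∃ P, IsPathList G S P a b ∧ P.length = j := by
  classical
  have hc : ((S.erase a).erase b).card = S.card - 2 := by
    rw [Finset.card_erase_of_mem (by simp [hb, hab.symm]), Finset.card_erase_of_mem ha]; omega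
  obtain ⟨T, hT, hTc⟩ := Finset.exists_subset_card_eq (s := (S.erase a).erase b) (n := j - 2)
    (by omega)
  have hT' : ∀ x ∈ T, x ≠ b ∧ x ≠ a ∧ x ∈ S := fun x hx => by simpa using hT hx
  have hnd : (a :: (T.toList ++ [b])).Nodup := by
    rw [List.nodup_cons, List.nodup_append]
    refine ⟨?_, T.nodup_toList, by simp, ?_⟩
    · simp only [List.mem_append, Finset.mem_toList, List.mem_singleton, not_or]
      exact ⟨fun h => (hT' a h).2.1 rfl, hab⟩
    · intro x hx y hy
      simp only [Finset.mem_toList, List.mem_singleton] at hx hy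
      subst hy
      exact (hT' x hx).1
  have hmem : ∀ x ∈ a :: (T.toList ++ [b]), x ∈ S := by
    intro x hx
    simp only [List.mem_cons, List.mem_append, Finset.mem_toList, List.not_mem_nil, or_false] at hx
    rcases hx with rfl | hx | rfl
    exacts [ha, (hT' x hx).2.2, hb]
  refine ⟨a :: (T.toList ++ [b]), ⟨hnd, ?_, hmem, by simp, by rw [← List.cons_append, List.getLast?_concat]⟩, ?_⟩
  · refine List.Pairwise.isChain ?_
    exact List.Pairwise.imp_of_mem (fun hx hy hne => hS _ (hmem _ hx) _ (hmem _ hy) hne) hnd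
  · simp [hTc]; omega

theorem cycleIn_of_complete (hS : ∀ v ∈ S, ∀ w ∈ S, v ≠ w → G.Adj v w) {l : ℕ} (h3 : 3 ≤ l)
    (hl : l ≤ S.card) : CycleIn G S l := by
  obtain ⟨a, ha, b, hb, hab⟩ := Finset.one_lt_card.1 (show 1 < S.card by omega)
  obtain ⟨P, hP, rfl⟩ := exists_isPathList_of_complete hS ha hb hab (j := l) (by omega) hl
  exact hP.cycleIn (hS _ hb _ ha hab.symm) h3

/-- A cycle using the added edge `uv` yields a path from `u` to `v` on the same vertices. -/
theorem cycleIn_or_path_of_sup_edge {u v : V} {l : ℕ}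
    (h : CycleIn (G ⊔ SimpleGraph.edge u v) S l) :
    CycleIn G S l ∨ ∃ P, IsPathList G S P u v ∧ P.length = l := by
  obtain ⟨P, hP, rfl⟩ := h
  have h3 := hP.three_le
  -- Once the cycle is rotated so that the new edge closes it, that edge cannot occur again between
  -- consecutive entries: the list has no repetitions and at least three entries.
  have key : ∀ (Q : List V) (a b : V), IsPathList (G ⊔ SimpleGraph.edge u v) S Q a b →
      Q.length = P.length → (G ⊔ SimpleGraph.edge u v).Adj b a → ¬ G.Adj b a →
      ∃ P', IsPathList G S P' u v ∧ P'.length = P.length := by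
    intro Q a b hQ hlen hab hnab
    have hs : (b = u ∧ a = v) ∨ (b = v ∧ a = u) := by
      rw [SimpleGraph.sup_adj, SimpleGraph.edge_adj] at hab
      tauto
    have hch : Q.IsChain G.Adj := by
      rw [List.isChain_iff_getElem]
      intro i hi
      have hadj := List.isChain_iff_getElem.1 hQ.chain i hi
      rw [SimpleGraph.sup_adj, SimpleGraph.edge_adj] at hadj
      rcases hadj with hadj | ⟨hadj, -⟩
      · exact hadj
      exfalso
      have e0 := hQ.getElem_zero
      have e1 := hQ.getElem_last
      have inj : ∀ (x y : ℕ) (hx : x < Q.length) (hy : y < Q.length), Q[x] = Q[y] → x = y :=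
        fun x y hx hy h => (hQ.nodup.getElem_inj_iff).1 h
      have c1 := inj i 0 (by omega) (by omega)
      have c2 := inj (i + 1) 0 (by omega) (by omega)
      have c3 := inj i (Q.length - 1) (by omega) (by omega)
      have c4 := inj (i + 1) (Q.length - 1) (by omega) (by omega)
      rw [e0] at c1 c2
      rw [e1] at c3 c4
      rcases hs with ⟨rfl, rfl⟩ | ⟨rfl, rfl⟩ <;> rcases hadj with ⟨h1, h2⟩ | ⟨h1, h2⟩
      · have := c3 h1; omega
      · have := c1 h1; have := c4 h2; omega
      · have := c1 h1; have := c4 h2; omega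
      · have := c3 h1; omega
    have hQ' : IsPathList G S Q a b := ⟨hQ.nodup, hch, hQ.mem, hQ.head, hQ.last⟩
    rcases hs with ⟨rfl, rfl⟩ | ⟨rfl, rfl⟩
    · exact ⟨Q.reverse, hQ'.reverse, by simpa using hlen⟩
    · exact ⟨Q, hQ', hlen⟩
  obtain ⟨a, b, hPp, hab⟩ := hP.exists_isPathList
  by_cases hc : G.Adj b a
  · by_cases hch : P.IsChain G.Adj
    · left
      have hP' : IsPathList G S P a b := ⟨hP.nodup, hch, hP.mem, hPp.head, hPp.last⟩
      exact hP'.cycleIn hc h3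
    · right
      obtain ⟨i, hi, hni⟩ := List.exists_not_getElem_of_not_isChain hch
      have h1 := hPp.drop hi
      have h2 := hPp.take (i := i) (by omega)
      have := h1.append h2 hab (fun x hx hx' =>
        disjoint_take_drop hP.nodup _ _ le_rfl x hx' hx)
      exact key _ _ _ this (by simp; omega) (List.isChain_iff_getElem.1 hP.chain i hi) hni
  · exact Or.inr (key P a b hPp rfl hab hc)

/-- The crossing argument: a spanning path whose ends have consecutive neighbours closes up. -/
theorem IsPathList.cycleIn_of_crossing {P : List V} {u v : V} (hP : IsPathList G S P u v)
    (h3 : 3 ≤ P.length) {i : ℕ} (hi : i + 1 < P.length) (hu : G.Adj u P[i + 1])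
    (hv : G.Adj v P[i]) : CycleIn G S P.length := by
  have h1 := hP.take (i := i) (by omega)
  have h2 := (hP.drop hi).reverse
  have := h1.append h2 hv.symm (fun x hx hx' =>
    disjoint_take_drop hP.nodup _ _ le_rfl x hx (by simpa using hx'))
  have hl : (P.take (i + 1) ++ (P.drop (i + 1)).reverse).length = P.length := by simp; omega
  rw [← hl]
  exact this.cycleIn hu.symm (by omega)

theorem List.toFinset_eq_of_card [DecidableEq V] {P : List V} (hP : P.Nodup)
    (hmem : ∀ x ∈ P, x ∈ S) (hc : S.card ≤ P.length) : P.toFinset = S := by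
  refine Finset.eq_of_subset_of_card_le (fun x hx => hmem x (by simpa using hx)) ?_
  rwa [List.toFinset_card_of_nodup hP]

/-- Pósa's theorem: a graph without a Hamiltonian cycle has, for some `i` less than half its
order, at least `i` vertices of degree at most `i`. -/
theorem exists_low_degrees_of_not_hamiltonian [Finite V] (h3 : 3 ≤ S.card)
    (hno : ¬ CycleIn G S S.card) :
    ∃ i, 1 ≤ i ∧ 2 * i < S.card ∧ ∃ L ⊆ S, L.card = i ∧ ∀ x ∈ L, degIn G S x ≤ i := by
  classical
  -- Induction from dense graphs to sparse ones, so a counterexample may be taken edge-maximal.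
  induction G using WellFoundedGT.induction with
  | ind G ih =>
  by_contra hcon
  push Not at hcon
  by_cases hcomp : ∀ v ∈ S, ∀ w ∈ S, v ≠ w → G.Adj v w
  · exact hno (cycleIn_of_complete hcomp h3 le_rfl)
  push Not at hcomp
  obtain ⟨v0, hv0, w0, hw0, hne0, hn0⟩ := hcomp
  -- A nonadjacent pair of largest degree sum. The maximality bounds the degree of every
  -- non-neighbour of `v` by that of `u`.
  obtain ⟨⟨u, v⟩, huv, hmax⟩ := Finset.exists_max_image
    ((S ×ˢ S).filter fun p => p.1 ≠ p.2 ∧ ¬ G.Adj p.1 p.2)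
    (fun p => degIn G S p.1 + degIn G S p.2) ⟨(v0, w0), by simp [*]⟩
  simp only [Finset.mem_filter, Finset.mem_product] at huv hmax
  obtain ⟨⟨huS, hvS⟩, hne, hnadj⟩ := huv
  clear hv0 hw0 hne0 hn0 v0 w0
  wlog hle : degIn G S u ≤ degIn G S v generalizing u v
  · refine this v u (fun p hp => ?_) hvS huS hne.symm (fun h => hnadj h.symm) (by omega)
    have := hmax p hp
    omega
  have hlt : G < G ⊔ SimpleGraph.edge u v := SimpleGraph.lt_sup_edge G u v hne hnadj
  have hcyc : CycleIn (G ⊔ SimpleGraph.edge u v) S S.card := by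
    by_contra hno'
    obtain ⟨i, h1, h2, L, hLS, hLc, hL⟩ := ih _ hlt hno'
    obtain ⟨x, hx, hxi⟩ := hcon i h1 h2 L hLS hLc
    have := hL x hx
    have hle : degIn G S x ≤ degIn (G ⊔ SimpleGraph.edge u v) S x := by
      refine Finset.card_le_card fun w hw => ?_
      simp only [Finset.mem_filter] at hw ⊢
      exact ⟨hw.1, Or.inl hw.2⟩
    omega
  rcases cycleIn_or_path_of_sup_edge hcyc with h | ⟨P, hP, hPl⟩
  · exact hno h
  have hPS : P.toFinset = S := List.toFinset_eq_of_card hP.nodup hP.mem hPl.ge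
  have hIc := card_nbrIdx_toFinset (G := G) hP.nodup u
  have hJc := card_nbrIdx_toFinset (G := G) hP.nodup v
  rw [hPS] at hIc hJc
  have e0 := hP.getElem_zero
  have e1 := hP.getElem_last
  have hI : ∀ i ∈ nbrIdx G P u, 1 ≤ i := by
    intro i hi
    obtain ⟨h, h'⟩ := mem_nbrIdx.1 hi
    by_contra h0
    have : i = 0 := by omega
    subst this
    rw [e0] at h'
    exact G.loopless.irrefl _ h'
  have hJ : ∀ i ∈ nbrIdx G P v, i + 1 < P.length := by
    intro i hi
    obtain ⟨h, h'⟩ := mem_nbrIdx.1 hi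
    by_contra h0
    have : i = P.length - 1 := by omega
    subst this
    rw [e1] at h'
    exact G.loopless.irrefl _ h'
  have hinj : Set.InjOn (fun i => i - 1) (nbrIdx G P u : Set ℕ) := by
    intro i hi j hj hij
    have := hI i hi
    have := hI j hj
    simp only at hij
    omega
  have hcardI : ((nbrIdx G P u).image fun i => i - 1).card = degIn G S u := by
    rw [Finset.card_image_of_injOn hinj, hIc]
  have hno2 : ∀ i (h : i + 1 < P.length), G.Adj u P[i + 1] → ¬ G.Adj v P[i] := by
    intro i h hu hv
    exact hno (hPl ▸ hP.cycleIn_of_crossing (by omega) h hu hv)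
  -- Predecessors on the path of neighbours of `u` are not adjacent to `v`, by the crossing
  -- argument; hence the degree of `u` is below half the order.
  have hdisj : Disjoint ((nbrIdx G P u).image fun i => i - 1) (nbrIdx G P v) := by
    rw [Finset.disjoint_left]
    intro j hj hj'
    obtain ⟨i, hi, rfl⟩ := Finset.mem_image.1 hj
    obtain ⟨k, rfl⟩ : ∃ k, i = k + 1 := ⟨i - 1, by have := hI i hi; omega⟩
    obtain ⟨h, h'⟩ := mem_nbrIdx.1 hi
    obtain ⟨g, g'⟩ := mem_nbrIdx.1 hj'
    exact hno2 k h h' g'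
  have hsub : ((nbrIdx G P u).image fun i => i - 1) ∪ nbrIdx G P v ⊆
      Finset.range (P.length - 1) := by
    intro j hj
    rw [Finset.mem_range]
    rcases Finset.mem_union.1 hj with hj | hj
    · obtain ⟨i, hi, rfl⟩ := Finset.mem_image.1 hj
      have := hI i hi
      have := (mem_nbrIdx.1 hi).1
      omega
    · have := hJ j hj
      omega
  have hcard := Finset.card_le_card hsub
  rw [Finset.card_union_of_disjoint hdisj, hcardI, hJc, Finset.card_range] at hcard
  have hpos : 1 ≤ degIn G S u := by
    refine degIn_pos_iff.2 ⟨P[1]'(by omega), hP.mem _ (List.getElem_mem _), ?_⟩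
    have := List.isChain_iff_getElem.1 hP.chain 0 (by omega)
    rwa [e0] at this
  -- The forbidden set of low degrees consists of these predecessors: there are as many of them as
  -- the degree of `u`, and none is adjacent to `v`.
  obtain ⟨x, hx, hxi⟩ := hcon (degIn G S u) hpos (by omega)
    (((nbrIdx G P u).image fun i => i - 1).image fun i => P.getD i u) (by
      intro x hx
      obtain ⟨j, hj, rfl⟩ := Finset.mem_image.1 hx
      have := Finset.mem_range.1 (hsub (Finset.mem_union_left _ hj))
      rw [List.getD_eq_getElem _ _ (by omega)]
      exact hP.mem _ (List.getElem_mem _)) (by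
      rw [Finset.card_image_of_injOn, hcardI]
      intro j hj k hk hjk
      have h1 := Finset.mem_range.1 (hsub (Finset.mem_union_left _ hj))
      have h2 := Finset.mem_range.1 (hsub (Finset.mem_union_left _ hk))
      simp only at hjk
      rw [List.getD_eq_getElem _ _ (by omega), List.getD_eq_getElem _ _ (by omega)] at hjk
      exact hP.nodup.getElem_inj_iff.1 hjk)
  obtain ⟨j, hj, rfl⟩ := Finset.mem_image.1 hx
  have hjr := Finset.mem_range.1 (hsub (Finset.mem_union_left _ hj))
  rw [List.getD_eq_getElem _ _ (by omega)] at hxi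
  obtain ⟨i, hi, hij⟩ := Finset.mem_image.1 hj
  have hi1 := hI i hi
  obtain rfl : i = j + 1 := by omega
  obtain ⟨h, h'⟩ := mem_nbrIdx.1 hi
  have hnv := hno2 j h h'
  have hnev : P[j] ≠ v := by
    intro h0
    have : j = P.length - 1 := (hP.nodup.getElem_inj_iff).1 (h0.trans e1.symm)
    omega
  have := hmax (P[j], v) ⟨⟨hP.mem _ (List.getElem_mem _), hvS⟩, hnev, fun h => hnv h.symm⟩
  simp only at this
  omega

end Posa

/-! ### Long paths and end blocks -/

section EndBlock

variable {V : Type*} {G : SimpleGraph V} {S : Finset V}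

/-- Extremal choices below range over lists, an infinite type, so only a bound on the measured
quantity is available. -/
theorem exists_max_of_bounded {α : Type*} {p : α → Prop} (f : α → ℕ) (B : ℕ) (hne : ∃ x, p x)
    (hB : ∀ x, p x → f x ≤ B) : ∃ x, p x ∧ ∀ y, p y → f y ≤ f x := by
  by_contra hcon
  push Not at hcon
  have : ∀ n, ∃ x, p x ∧ n ≤ f x := by
    intro n
    induction n with
    | zero => obtain ⟨x, hx⟩ := hne; exact ⟨x, hx, Nat.zero_le _⟩
    | succ n ih =>
      obtain ⟨x, hx, hn⟩ := ih
      obtain ⟨y, hy, hlt⟩ := hcon x hx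
      exact ⟨y, hy, by omega⟩
  obtain ⟨x, hx, hlt⟩ := this (B + 1)
  have := hB x hx
  omega

theorem IsPathList.length_le_card {P : List V} {a b : V} (h : IsPathList G S P a b) :
    P.length ≤ S.card := by
  classical
  rw [← List.toFinset_card_of_nodup h.nodup]
  exact Finset.card_le_card fun x hx => h.mem x (by simpa using hx)

/-- The segment of a path between two indices. -/
theorem IsPathList.slice {P : List V} {a b : V} (h : IsPathList G S P a b) {i j : ℕ}
    (hij : i ≤ j) (hj : j < P.length) :
    IsPathList G S ((P.take (j + 1)).drop i) P[i] P[j] := by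
  have := (h.take hj).drop (i := i) (by simp; omega)
  simpa using this

theorem disjoint_take_slice {P : List V} (h : P.Nodup) (i j k : ℕ) (hij : i ≤ j) :
    ∀ x ∈ P.take i, x ∉ (P.take k).drop j := by
  intro x hx hx'
  rw [List.drop_take] at hx'
  exact disjoint_take_drop h i j hij x hx (List.mem_of_mem_take hx')

theorem disjoint_slice_drop {P : List V} (h : P.Nodup) (i j k : ℕ) (hij : i ≤ j) :
    ∀ x ∈ (P.take i).drop k, x ∉ P.drop j :=
  fun x hx => disjoint_take_drop h i j hij x (List.mem_of_mem_drop hx)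

/-- If all ends of spanning paths of `A` with fixed end `z` have large degree, and some spanning
path closes to a cycle, then every vertex other than `z` is the end of such a path. -/
theorem exists_spanning_path_to {A : Finset V} {X : List V} {a z : V}
    (hX : IsPathList G A X a z) (hl : X.length = A.card) (hza : G.Adj z a)
    (hdeg : ∀ w X', IsPathList G A X' w z → X'.length = A.card → A.card + 1 ≤ 2 * degIn G A w) :
    ∀ x ∈ A, x ≠ z → ∃ X', IsPathList G A X' x z ∧ X'.length = A.card := by
  classical
  have hXA : X.toFinset = A := List.toFinset_eq_of_card hX.nodup hX.mem hl.ge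
  have e0 := hX.getElem_zero
  have e1 := hX.getElem_last
  -- Induction along the path from `z` back to `a`: `k` is the distance of `X[j]` from the last
  -- position before `z`, so the successor of `X[j]` is already known to be an end.
  have main : ∀ k j : ℕ, ∀ hj : j + 2 + k = X.length,
      ∃ X', IsPathList G A X' (X[j]'(by omega)) z ∧ X'.length = A.card := by
    intro k
    induction k with
    | zero =>
      intro j hj
      have hlast : G.Adj a (X[j + 1]'(by omega)) := by
        have h1 : X[j + 1]'(by omega) = X[X.length - 1]'(by omega) := by congr 1; omega
        rw [h1, e1]; exact hza.symm
      refine ⟨_, ((hX.take (i := j) (by omega)).reverse).append (hX.drop (i := j + 1) (by omega))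
        hlast ?_, by simp; omega⟩
      intro x hx
      exact disjoint_take_drop hX.nodup _ _ le_rfl x (by simpa using hx)
    | succ k ih =>
      intro j hj
      by_cases hay : G.Adj a (X[j + 1]'(by omega))
      · refine ⟨_, ((hX.take (i := j) (by omega)).reverse).append
          (hX.drop (i := j + 1) (by omega)) hay ?_, by simp; omega⟩
        intro x hx
        exact disjoint_take_drop hX.nodup _ _ le_rfl x (by simpa using hx)
      obtain ⟨Y, hY, hYl⟩ := ih (j + 1) (by omega)
      have d1 := hdeg _ _ hX hl
      have d2 := hdeg _ _ hY hYl
      have hcA : ∀ v, degIn G A v = (nbrIdx G X v).card := fun v => by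
        rw [card_nbrIdx_toFinset hX.nodup, hXA]
      rw [hcA] at d1 d2
      by_contra hcon
      -- With y = `X[j + 1]`, the forbidden path is X[j] … X[i + 1], then X[0] … X[i], then y … z.
      have hcon1 : ∀ i (hi : i < j), G.Adj a (X[i + 1]'(by omega)) →
          ¬ G.Adj (X[j + 1]'(by omega)) (X[i]'(by omega)) := by
        intro i hi h1 h2
        refine hcon ⟨_, ((hX.slice (i := i + 1) (j := j) (by omega) (by omega)).reverse.append
          (hX.take (i := i) (by omega)) h1.symm ?_).append (hX.drop (i := j + 1) (by omega))
          h2.symm ?_, by simp; omega⟩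
        · intro x hx hx'
          exact disjoint_take_slice hX.nodup _ _ _ le_rfl x hx' (by simpa using hx)
        · intro x hx
          rcases List.mem_append.1 hx with hx | hx
          · exact disjoint_slice_drop hX.nodup _ _ _ le_rfl x (List.mem_reverse.1 hx)
          · exact disjoint_take_drop hX.nodup _ _ (by omega) x hx
      -- The forbidden path is X[j] … X[0], then X[i] back to X[j + 1], then X[i + 1] … z.
      have hcon2 : ∀ i (hi : j + 2 ≤ i) (hi' : i + 1 < X.length), G.Adj a (X[i]'(by omega)) →
          ¬ G.Adj (X[j + 1]'(by omega)) (X[i + 1]'(by omega)) := by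
        intro i hi hi' h1 h2
        refine hcon ⟨_, ((hX.take (i := j) (by omega)).reverse.append
          (hX.slice (i := j + 1) (j := i) (by omega) (by omega)).reverse h1 ?_).append
          (hX.drop (i := i + 1) (by omega)) h2 ?_, by simp; omega⟩
        · intro x hx hx'
          exact disjoint_take_slice hX.nodup _ _ _ le_rfl x (List.mem_reverse.1 hx)
            (List.mem_reverse.1 hx')
        · intro x hx
          rcases List.mem_append.1 hx with hx | hx
          · exact disjoint_take_drop hX.nodup _ _ (by omega) x (List.mem_reverse.1 hx)
          · exact disjoint_slice_drop hX.nodup _ _ _ le_rfl x (List.mem_reverse.1 hx)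
      have hI : ∀ i ∈ nbrIdx G X a, 1 ≤ i ∧ i ≠ j + 1 ∧ i < X.length := by
        intro i hi
        obtain ⟨h, h'⟩ := mem_nbrIdx.1 hi
        refine ⟨?_, ?_, h⟩
        · by_contra h0
          have : i = 0 := by omega
          subst this
          rw [e0] at h'
          exact G.loopless.irrefl _ h'
        · rintro rfl
          exact hay h'
      have hJ : ∀ i ∈ nbrIdx G X (X[j + 1]'(by omega)), 1 ≤ i ∧ i ≠ j + 1 ∧ i < X.length := by
        intro i hi
        obtain ⟨h, h'⟩ := mem_nbrIdx.1 hi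
        refine ⟨?_, ?_, h⟩
        · by_contra h0
          have : i = 0 := by omega
          subst this
          rw [e0] at h'
          exact hay h'.symm
        · rintro rfl
          exact G.loopless.irrefl _ h'
      set I := (nbrIdx G X a).erase (X.length - 1) with hIdef
      set J := ((nbrIdx G X (X[j + 1]'(by omega))).erase j).erase (j + 2) with hJdef
      have hIc := Finset.pred_card_le_card_erase (s := nbrIdx G X a) (a := X.length - 1)
      have hJc := Finset.pred_card_le_card_erase
        (s := nbrIdx G X (X[j + 1]'(by omega))) (a := j)
      have hJc' := Finset.pred_card_le_card_erase
        (s := (nbrIdx G X (X[j + 1]'(by omega))).erase j) (a := j + 2)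
      rw [← hIdef] at hIc
      rw [← hJdef] at hJc'
      -- Neighbours of `a` before the gap shift down and those after it shift up. Both ranges avoid
      -- the three positions `j`, `j + 1`, `j + 2`. Three neighbours are dropped in all, so a degree
      -- sum of at least n + 1 puts n - 2 elements in n - 3 positions, where n is the length of `X`.
      let g : ℕ → ℕ := fun i => if i ≤ j then i - 1 else i + 1
      have hI' : ∀ i ∈ I, 1 ≤ i ∧ i ≠ j + 1 ∧ i + 1 < X.length := by
        intro i hi
        rw [hIdef, Finset.mem_erase] at hi
        have := hI i hi.2
        omega
      have hginj : Set.InjOn g (I : Set ℕ) := by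
        intro i hi i' hi' hii
        have := hI' i hi
        have := hI' i' hi'
        simp only [g] at hii
        split_ifs at hii <;> omega
      have hgc := Finset.card_image_of_injOn hginj
      have hdisj : Disjoint (I.image g) J := by
        rw [Finset.disjoint_left]
        intro x hx hx'
        obtain ⟨i, hi, rfl⟩ := Finset.mem_image.1 hx
        have hi2 := hI' i hi
        rw [hIdef, Finset.mem_erase] at hi
        rw [hJdef, Finset.mem_erase, Finset.mem_erase] at hx'
        obtain ⟨h, h'⟩ := mem_nbrIdx.1 hi.2
        obtain ⟨q, q'⟩ := mem_nbrIdx.1 hx'.2.2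
        by_cases hij : i ≤ j
        · simp only [g, if_pos hij] at q q'
          obtain ⟨i, rfl⟩ : ∃ i', i = i' + 1 := ⟨i - 1, by omega⟩
          exact hcon1 i (by omega) h' q'
        · simp only [g, if_neg hij] at q q'
          exact hcon2 i (by omega) (by omega) h' q'
      have hsub : I.image g ∪ J ⊆
          (((Finset.range X.length).erase j).erase (j + 1)).erase (j + 2) := by
        intro x hx
        simp only [Finset.mem_erase, Finset.mem_range]
        rcases Finset.mem_union.1 hx with hx | hx
        · obtain ⟨i, hi, rfl⟩ := Finset.mem_image.1 hx
          have := hI' i hi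
          simp only [g]
          split_ifs <;> omega
        · rw [hJdef, Finset.mem_erase, Finset.mem_erase] at hx
          have := hJ x hx.2.2
          exact ⟨hx.1, this.2.1, hx.2.1, this.2.2⟩
      have hcard := Finset.card_le_card hsub
      have hR : ((((Finset.range X.length).erase j).erase (j + 1)).erase (j + 2)).card =
          X.length - 3 := by
        rw [Finset.card_erase_of_mem (by simp; omega), Finset.card_erase_of_mem (by simp; omega),
          Finset.card_erase_of_mem (by simp; omega), Finset.card_range]
        omega
      rw [Finset.card_union_of_disjoint hdisj, hgc, hR] at hcard
      omega
  intro x hx hxz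
  rw [← hXA, List.mem_toFinset] at hx
  obtain ⟨j, hj, rfl⟩ := List.mem_iff_getElem.1 hx
  have : j ≠ X.length - 1 := by
    rintro rfl
    exact hxz e1
  exact main (X.length - 2 - j) j (by omega)

/-- Rerouting the start of a longest path inside its own vertex set keeps the length, so the
maximality of the path applies to the new first vertex as well. -/
theorem IsPathList.replace_prefix {X X' Y : List V} {a b w z : V}
    (h : IsPathList G S (X ++ Y) a b) (hX : IsPathList G S X a z) (hX' : IsPathList G S X' w z)
    (hmem : ∀ x ∈ X', x ∈ X) : IsPathList G S (X' ++ Y) w b := by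
  have hnd := List.nodup_append.1 h.nodup
  refine ⟨?_, ?_, ?_, ?_, ?_⟩
  · exact hX'.nodup.append hnd.2.1 fun x hx hx' => hnd.2.2 x (hmem x hx) x hx' rfl
  · have := h.chain
    rw [List.isChain_append] at this ⊢
    refine ⟨hX'.chain, this.2.1, ?_⟩
    rw [hX'.last, ← hX.last]
    exact this.2.2
  · intro x hx
    rcases List.mem_append.1 hx with hx | hx
    · exact hX'.mem x hx
    · exact h.mem x (List.mem_append_right _ hx)
  · rw [List.head?_append_of_ne_nil _ hX'.ne_nil, hX'.head]
  · have := h.last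
    rw [List.getLast?_append] at this ⊢
    rw [hX'.last, ← hX.last]
    exact this

/-- If all degrees in `K` are at least `δ`, `r ≤ 2 * δ`, and `K` has no cycle of length at least
`r`, then `K` has a small end block `A` attached at a single vertex `z`. -/
theorem exists_end_block {K : Finset V} {r δ : ℕ} (hK : K.Nonempty) (hr : 3 ≤ r) (hrδ : r ≤ 2 * δ)
    (hδ : ∀ v ∈ K, δ ≤ degIn G K v) (hno : ∀ l, r ≤ l → ¬ CycleIn G K l) :
    ∃ A ⊆ K, ∃ z ∈ A, δ + 1 ≤ A.card ∧ A.card < r ∧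
      ∀ a ∈ A, a ≠ z → ∀ w ∈ K, G.Adj a w → w ∈ A := by
  classical
  obtain ⟨v0, hv0⟩ := hK
  obtain ⟨w0, hw0, hvw0⟩ := degIn_pos_iff.1 (show 0 < degIn G K v0 by have := hδ v0 hv0; omega)
  -- The weight `K.card + 1` makes the choice lexicographic: a longest path first, then the farthest
  -- neighbour of its first vertex.
  obtain ⟨⟨P, i⟩, ⟨a, b, hP, hi, hai⟩, hmax⟩ := exists_max_of_bounded
    (p := fun q : List V × ℕ => ∃ a b, IsPathList G K q.1 a b ∧
      ∃ hi : q.2 < q.1.length, G.Adj a (q.1[q.2]))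
    (fun q => q.1.length * (K.card + 1) + q.2) (K.card * (K.card + 1) + K.card)
    ⟨([v0, w0], 1), v0, w0, ⟨by simp [hvw0.ne], by simp [hvw0], by simp [hv0, hw0], by simp,
      by simp⟩, by simp, by simpa using hvw0⟩
    (by
      rintro ⟨P, i⟩ ⟨a, b, hP, hi, -⟩
      have := hP.length_le_card
      simp only at hi this ⊢
      gcongr
      omega)
  simp only at hP hi hai hmax
  have hPK := hP.length_le_card
  have hX := hP.take hi
  set X := P.take (i + 1) with hXdef
  set z := P[i] with hz
  set Y := P.drop (i + 1) with hYdef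
  have hXY : X ++ Y = P := List.take_append_drop _ _
  have hXl : X.length = i + 1 := by rw [hXdef, List.length_take]; omega
  set A := X.toFinset with hA
  have hAc : A.card = i + 1 := by rw [hA, List.toFinset_card_of_nodup hX.nodup, hXl]
  have hAK : A ⊆ K := fun x hx => hX.mem x (by simpa [hA] using hx)
  have hXA : IsPathList G A X a z := hX.mono fun x hx => by simpa [hA] using hx
  -- A neighbour of `w` off the rerouted path would lengthen it, and one beyond position `i` would
  -- contradict the choice of `i`.
  have claim1 : ∀ w X', IsPathList G A X' w z → X'.length = A.card →
      ∀ y ∈ K, G.Adj w y → y ∈ A := by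
    intro w X' hX' hl' y hyK hwy
    have hX'K : IsPathList G K X' w z := hX'.mono fun x hx => hAK (hX'.mem x hx)
    have hP' : IsPathList G K (X' ++ Y) w b :=
      IsPathList.replace_prefix (hXY ▸ hP) hX hX'K fun x hx => by
        have := hX'.mem x hx
        simpa [hA] using this
    have hlP : (X' ++ Y).length = P.length := by
      rw [← hXY, List.length_append, List.length_append]; omega
    by_cases hy : y ∈ X' ++ Y
    · obtain ⟨k, hk, hky⟩ := List.mem_iff_getElem.1 hy
      have := hmax (X' ++ Y, k) ⟨w, b, hP', hk, by simpa [hky] using hwy⟩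
      simp only [hlP] at this
      have hki : k < X'.length := by omega
      rw [List.getElem_append_left hki] at hky
      rw [← hky]
      exact hX'.mem _ (List.getElem_mem _)
    · exfalso
      have hP'' := (isPathList_singleton (G := G) hyK).append hP' hwy.symm (by simpa using hy)
      have := hmax ([y] ++ (X' ++ Y), 1) ⟨y, b, hP'', by
        simp only [List.length_append, List.length_singleton] at hlP ⊢; omega, by
        have h0 := hP'.getElem_zero
        simp only [List.singleton_append, List.getElem_cons_succ]
        rw [h0]; exact hwy.symm⟩
      simp only [List.length_append (as := [y]), List.length_singleton, hlP] at this
      nlinarith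
  have hdeg : ∀ w X', IsPathList G A X' w z → X'.length = A.card → δ ≤ degIn G A w := by
    intro w X' hX' hl'
    have hwA := hX'.mem _ hX'.head_mem
    rw [← degIn_congr (G := G) (S := K) (T := A) fun y hy =>
      ⟨fun hyK => claim1 w X' hX' hl' y hyK hy, fun h => hAK h⟩]
    exact hδ w (hAK hwA)
  have hda := hdeg a X hXA (by omega)
  have haA := hXA.mem _ hXA.head_mem
  have hlt := degIn_lt_card (G := G) haA
  have hAr : A.card < r := by
    by_contra hge
    have := hX.cycleIn hai.symm (by omega)
    exact hno _ (by omega) this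
  -- The neighbourhood of `a` lies in `A`, which gives the lower bound on its size; `X` closes to a
  -- cycle, which gives the upper one.
  refine ⟨A, hAK, z, hXA.mem _ hXA.last_mem, by omega, hAr, ?_⟩
  intro x hx hxz w hw hxw
  obtain ⟨X', hX', hl'⟩ := exists_spanning_path_to hXA (by omega) hai.symm
    (fun w X' hX' hl' => by have := hdeg w X' hX' hl'; omega) x hx hxz
  exact claim1 x X' hX' hl' w hw hxw

end EndBlock

/-! ### The Erdős–Gallai bound and longest cycles -/

section LongCycles

variable {V : Type*} {G : SimpleGraph V} {S : Finset V}

/-- The Erdős–Gallai bound: without cycles of length at least `r`, a set of `n` vertices spans at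
most `(r - 1) * (n - 1) / 2` edges. -/
theorem degSum_le_of_no_long_cycle {r : ℕ} (hr : 3 ≤ r) (hS : S.Nonempty)
    (hno : ∀ l, r ≤ l → ¬ CycleIn G S l) : degSum G S ≤ (r - 1) * (S.card - 1) := by
  classical
  induction S using Finset.strongInduction with
  | H S ih =>
  have hpos := hS.card_pos
  obtain ⟨r, rfl⟩ : ∃ r', r = r' + 1 := ⟨r - 1, by omega⟩
  by_cases h1 : S.card = 1
  · have := degSum_le (G := G) (S := S)
    rw [h1] at this
    omega
  by_cases hlow : ∃ v ∈ S, 2 * degIn G S v ≤ r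
  · obtain ⟨v, hv, hd⟩ := hlow
    have hc := Finset.card_erase_of_mem hv
    have := ih (S.erase v) (Finset.erase_ssubset hv) (Finset.card_pos.1 (by omega))
      (fun l hl h => hno l hl (h.mono (Finset.erase_subset _ _)))
    rw [degSum_eq_erase hv]
    obtain ⟨c, hc'⟩ : ∃ c, S.card = c + 2 := ⟨S.card - 2, by omega⟩
    rw [hc, hc'] at this
    rw [hc']
    simp only [Nat.add_sub_cancel, show c + 2 - 1 = c + 1 by omega] at this ⊢
    nlinarith
  · push Not at hlow
    -- All degrees exceed `r / 2`, so an end block splits off. It has at most `r` vertices and meets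
    -- the bound trivially, while induction handles the rest together with `z`.
    obtain ⟨A, hAS, z, hz, hA1, hA2, hsep⟩ := exists_end_block (δ := (r + 2) / 2) hS hr (by omega)
      (fun v hv => by have := hlow v hv; omega) hno
    have hzB : z ∉ S \ A := by simp [hz]
    have hBc : (insert z (S \ A)).card = S.card - A.card + 1 := by
      rw [Finset.card_insert_of_notMem hzB, Finset.card_sdiff_of_subset hAS]
    have hAle := Finset.card_le_card hAS
    have hBsub : insert z (S \ A) ⊆ S := by
      intro x hx
      rcases Finset.mem_insert.1 hx with rfl | hx
      exacts [hAS hz, (Finset.mem_sdiff.1 hx).1]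
    have hB := ih (insert z (S \ A)) (hBsub.ssubset_of_ne
      (fun h => by rw [h] at hBc; omega)) ⟨z, by simp⟩
      (fun l hl h => hno l hl (h.mono hBsub))
    have hAle' := degSum_le (G := G) (S := A)
    rw [degSum_separation hAS hz hsep]
    rw [hBc] at hB
    obtain ⟨α, hα⟩ : ∃ α, A.card = α + 1 := ⟨A.card - 1, by omega⟩
    obtain ⟨β, hβ⟩ : ∃ β, S.card = β + A.card := ⟨S.card - A.card, by omega⟩
    rw [hβ, hα] at hB ⊢
    rw [hα] at hAle' hA2
    simp only [Nat.add_sub_cancel, show β + (α + 1) - 1 = β + α by omega] at *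
    have : (α + 1) * α ≤ r * α := Nat.mul_le_mul_right _ (by omega)
    nlinarith

/-- A path outside a longest cycle whose ends see the cycle forces large gaps. -/
theorem card_nbrIdx_add_le {C P : List V} {u w : V} (hC : IsCycleList G S C)
    (hP : IsPathList G S P u w) (hCP : ∀ x ∈ C, x ∉ P)
    (hmax : ∀ l, CycleIn G S l → l ≤ C.length) (h0 : 0 ∈ nbrIdx G C u)
    (h2 : 2 ≤ (nbrIdx G C w).card) :
    (nbrIdx G C u).card + (nbrIdx G C w).card + 2 * (P.length - 1) ≤ C.length := by
  classical
  obtain ⟨a, b, hQ, hba⟩ := hC.exists_isPathList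
  have e0 := hQ.getElem_zero
  have e1 := hQ.getElem_last
  have hq := hP.pos
  have h3 := hC.three_le
  have F1 : ∀ i ∈ nbrIdx G C u, ∀ j ∈ nbrIdx G C w, i < j → i + P.length < j := by
    intro i hi j hj hij
    obtain ⟨hi1, hi2⟩ := mem_nbrIdx.1 hi
    obtain ⟨hj1, hj2⟩ := mem_nbrIdx.1 hj
    have h := ((hQ.take hi1).append hP hi2.symm
      (fun x hx => hCP x (List.mem_of_mem_take hx))).append (hQ.drop hj1) hj2 (by
        intro x hx hx'
        rcases List.mem_append.1 hx with hx | hx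
        · exact disjoint_take_drop hC.nodup (i + 1) j (by omega) x hx hx'
        · exact hCP x (List.mem_of_mem_drop hx') hx)
    have := hmax _ (h.cycleIn hba (by simp; omega))
    simp at this
    omega
  have F2 : ∀ i ∈ nbrIdx G C u, ∀ j ∈ nbrIdx G C w, j < i → j + P.length < i := by
    intro i hi j hj hij
    obtain ⟨hi1, hi2⟩ := mem_nbrIdx.1 hi
    obtain ⟨hj1, hj2⟩ := mem_nbrIdx.1 hj
    have h := ((hQ.take hj1).append hP.reverse hj2.symm
      (fun x hx hx' => hCP x (List.mem_of_mem_take hx) (List.mem_reverse.1 hx'))).append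
      (hQ.drop hi1) hi2 (by
        intro x hx hx'
        rcases List.mem_append.1 hx with hx | hx
        · exact disjoint_take_drop hC.nodup (j + 1) i (by omega) x hx hx'
        · exact hCP x (List.mem_of_mem_drop hx') (List.mem_reverse.1 hx))
    have := hmax _ (h.cycleIn hba (by simp; omega))
    simp at this
    omega
  have hu0 : G.Adj u a := by
    have := (mem_nbrIdx.1 h0).2
    rwa [e0] at this
  have F3 : ∀ j ∈ nbrIdx G C w, j ≠ 0 → j + P.length < C.length := by
    intro j hj hj0
    obtain ⟨hj1, hj2⟩ := mem_nbrIdx.1 hj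
    have h := (hQ.take hj1).append hP.reverse hj2.symm
      (fun x hx hx' => hCP x (List.mem_of_mem_take hx) (List.mem_reverse.1 hx'))
    have := hmax _ (h.cycleIn hu0 (by simp; omega))
    simp at this
    omega
  have F4 : C.length - 1 ∈ nbrIdx G C u → 0 ∉ nbrIdx G C w := by
    intro hi hj
    have hi2 := (mem_nbrIdx.1 hi).2
    have hj2 := (mem_nbrIdx.1 hj).2
    rw [e1] at hi2
    rw [e0] at hj2
    have := hmax _ ((hQ.append hP hi2.symm hCP).cycleIn hj2 (by simp; omega))
    rw [List.length_append] at this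
    omega
  have hIlt : ∀ i ∈ nbrIdx G C u, i < C.length := fun i hi => (mem_nbrIdx.1 hi).1
  have hJlt : ∀ i ∈ nbrIdx G C w, i < C.length := fun i hi => (mem_nbrIdx.1 hi).1
  clear e0 e1 hmax hQ hC hP hCP hba hu0
  generalize nbrIdx G C u = I at *
  generalize nbrIdx G C w = J at *
  generalize P.length = q at *
  generalize C.length = L at *
  have hJne : (J.erase 0).Nonempty := by
    rw [← Finset.card_pos]
    have := Finset.pred_card_le_card_erase (s := J) (a := 0)
    omega
  -- Two long gaps are located: one after the last nonzero neighbour of `w`, the other after the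
  -- last neighbour of `u` preceding the first nonzero neighbour of `w`.
  obtain ⟨m, hm, hmmax⟩ := Finset.exists_max_image (J.erase 0) id hJne
  obtain ⟨m', hm', hmmin⟩ := Finset.exists_min_image (J.erase 0) id hJne
  simp only [Finset.mem_erase, id] at hm hm' hmmax hmmin
  obtain ⟨k, hk, hkmax⟩ := Finset.exists_max_image (I.filter (· < m')) id
    ⟨0, by simp [h0]; omega⟩
  simp only [Finset.mem_filter, id] at hk hkmax
  have f3 := F3 m hm.2 hm.1
  have f1 := F1 k hk.1 m' hm'.2 hk.2
  have hmm := hmmax m' hm'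
  have hinj1 : Set.InjOn (fun i => i + 1) (I : Set ℕ) := fun i _ j _ h => by simpa using h
  -- Position 0 is moved to `L`, so that the shifted neighbours of `u`, the neighbours of `w` and
  -- the two gaps of `q - 1` positions are disjoint parts of `[1, L]`.
  let g : ℕ → ℕ := fun j => if j = 0 then L else j
  have hinj2 : Set.InjOn g (J : Set ℕ) := by
    intro i hi j hj h
    have := hJlt i hi
    have := hJlt j hj
    simp only [g] at h
    split_ifs at h <;> omega
  have d1 : Disjoint (I.image fun i => i + 1) (J.image g) := by
    rw [Finset.disjoint_left]
    intro x hx hx'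
    obtain ⟨i, hi, rfl⟩ := Finset.mem_image.1 hx
    obtain ⟨j, hj, hij⟩ := Finset.mem_image.1 hx'
    simp only [g] at hij
    split_ifs at hij with hj0
    · subst hj0
      refine F4 ?_ hj
      rwa [show L - 1 = i by omega]
    · have := F1 i hi j hj (by omega)
      omega
  have d2 : Disjoint ((I.image fun i => i + 1) ∪ J.image g) (Finset.Icc (m + 2) (m + q)) := by
    rw [Finset.disjoint_left]
    intro x hx hx'
    rw [Finset.mem_Icc] at hx'
    rcases Finset.mem_union.1 hx with hx | hx
    · obtain ⟨i, hi, rfl⟩ := Finset.mem_image.1 hx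
      have := F2 i hi m hm.2 (by omega)
      omega
    · obtain ⟨j, hj, hij⟩ := Finset.mem_image.1 hx
      simp only [g] at hij
      split_ifs at hij with hj0
      · omega
      · have := hmmax j ⟨hj0, hj⟩
        omega
  have d3 : Disjoint (((I.image fun i => i + 1) ∪ J.image g) ∪ Finset.Icc (m + 2) (m + q))
      (Finset.Icc (k + 2) (k + q)) := by
    rw [Finset.disjoint_left]
    intro x hx hx'
    rw [Finset.mem_Icc] at hx'
    rcases Finset.mem_union.1 hx with hx | hx
    · rcases Finset.mem_union.1 hx with hx | hx
      · obtain ⟨i, hi, rfl⟩ := Finset.mem_image.1 hx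
        have := hkmax i ⟨hi, by omega⟩
        omega
      · obtain ⟨j, hj, hij⟩ := Finset.mem_image.1 hx
        simp only [g] at hij
        split_ifs at hij with hj0
        · omega
        · have := hmmin j ⟨hj0, hj⟩
          omega
    · rw [Finset.mem_Icc] at hx
      omega
  have hsub : (((I.image fun i => i + 1) ∪ J.image g) ∪ Finset.Icc (m + 2) (m + q)) ∪
      Finset.Icc (k + 2) (k + q) ⊆ Finset.Icc 1 L := by
    intro x hx
    rw [Finset.mem_Icc]
    rcases Finset.mem_union.1 hx with hx | hx
    · rcases Finset.mem_union.1 hx with hx | hx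
      · rcases Finset.mem_union.1 hx with hx | hx
        · obtain ⟨i, hi, rfl⟩ := Finset.mem_image.1 hx
          have := hIlt i hi
          omega
        · obtain ⟨j, hj, rfl⟩ := Finset.mem_image.1 hx
          have := hJlt j hj
          simp only [g]
          split_ifs <;> omega
      · rw [Finset.mem_Icc] at hx
        omega
    · rw [Finset.mem_Icc] at hx
      omega
  have hcard := Finset.card_le_card hsub
  rw [Finset.card_union_of_disjoint d3, Finset.card_union_of_disjoint d2,
    Finset.card_union_of_disjoint d1, Finset.card_image_of_injOn hinj1,
    Finset.card_image_of_injOn hinj2, Nat.card_Icc, Nat.card_Icc, Nat.card_Icc] at hcard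
  omega

/-- A longest cycle is Hamiltonian if it covers more than half of the vertices and all vertices
outside it have degree at least half the order. -/
theorem length_eq_card_of_longest [DecidableEq V] {C : List V} (hC : IsCycleList G S C)
    (hmax : ∀ l, CycleIn G S l → l ≤ C.length) (hL : S.card + 2 ≤ 2 * C.length)
    (hdeg : ∀ v ∈ S, v ∉ C → S.card ≤ 2 * degIn G S v) : C.length = S.card := by
  have hCS : C.toFinset ⊆ S := fun x hx => hC.mem x (by simpa using hx)
  have hCc := List.toFinset_card_of_nodup hC.nodup
  by_contra hne
  have hRc := Finset.card_sdiff_of_subset hCS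
  have hle := Finset.card_le_card hCS
  obtain ⟨v0, hv0⟩ : (S \ C.toFinset).Nonempty := by
    rw [← Finset.card_pos]; omega
  -- Ends of a longest path off the cycle have no neighbours off the cycle except on that path, so
  -- the remaining neighbours lie on the cycle.
  obtain ⟨P, ⟨u, w, hP⟩, hPmax⟩ := exists_max_of_bounded
    (p := fun P : List V => ∃ u w, IsPathList G (S \ C.toFinset) P u w)
    (fun P => P.length) (S \ C.toFinset).card ⟨[v0], v0, v0, isPathList_singleton hv0⟩
    (fun P ⟨u, w, hP⟩ => hP.length_le_card)
  have hPc := hP.length_le_card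
  have hq := hP.pos
  have key : ∀ (Q : List V) (x y : V), IsPathList G (S \ C.toFinset) Q x y →
      Q.length = P.length → S.card ≤ 2 * (degIn G C.toFinset x + (P.length - 1)) := by
    intro Q x y hQ hl
    have hxR := hQ.mem _ hQ.head_mem
    have hx := Finset.mem_sdiff.1 hxR
    have hnb : ∀ t, G.Adj x t → t ∈ S \ C.toFinset → t ∈ Q := by
      intro t hxt htR
      by_contra htQ
      have := hPmax _ ⟨t, y, (isPathList_singleton (G := G) htR).append hQ hxt.symm
        (by simpa using htQ)⟩
      simp at this
      omega
    have hdR : degIn G (S \ C.toFinset) x = degIn G Q.toFinset x :=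
      degIn_congr fun t ht => ⟨fun h => by simpa using hnb t ht h,
        fun h => hQ.mem t (by simpa using h)⟩
    have hlt := degIn_lt_card (G := G) (S := Q.toFinset) (v := x) (by simpa using hQ.head_mem)
    rw [List.toFinset_card_of_nodup hQ.nodup] at hlt
    have hsum : degIn G S x = degIn G C.toFinset x + degIn G (S \ C.toFinset) x := by
      rw [← degIn_union Finset.disjoint_sdiff, Finset.union_sdiff_of_subset hCS]
    have := hdeg x hx.1 (by simpa using hx.2)
    omega
  have ku := key P u w hP rfl
  have kw := key P.reverse w u hP.reverse (by simp)
  obtain ⟨c, hc, huc⟩ := degIn_pos_iff.1 (show 0 < degIn G C.toFinset u by omega)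
  obtain ⟨i, hi, rfl⟩ := List.mem_iff_getElem.1 (List.mem_toFinset.1 hc)
  -- Rotation puts a neighbour of `u` at position 0. The gap count then makes the cycle at least as
  -- long as the order.
  have hC' := hC.rotate i
  have hu' := card_nbrIdx_toFinset (G := G) hC'.nodup u
  have hw' := card_nbrIdx_toFinset (G := G) hC'.nodup w
  rw [List.toFinset_rotate] at hu' hw'
  have := card_nbrIdx_add_le hC' (hP.mono fun x hx => (Finset.mem_sdiff.1 (hP.mem x hx)).1)
    (by
      intro x hx hxP
      have := (Finset.mem_sdiff.1 (hP.mem x hxP)).2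
      simp only [List.mem_rotate, List.mem_toFinset] at hx this
      exact this hx)
    (by simpa using hmax)
    (by
      refine mem_nbrIdx.2 ⟨by simp; omega, ?_⟩
      rw [List.getElem_rotate]
      simpa [Nat.mod_eq_of_lt hi] using huc)
    (by omega)
  rw [List.length_rotate] at this
  omega

end LongCycles

/-! ### Bondy's theorem on pancyclic graphs and its equality case -/

section Pancyclic

variable {V : Type*} {G : SimpleGraph V} {S : Finset V}

/-- The vertices of `S` span a complete bipartite graph with balanced parts. -/
def IsBalancedBipartiteOn (G : SimpleGraph V) (S : Finset V) : Prop :=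
  ∃ A ⊆ S, A.card = (S.card + 1) / 2 ∧ ∀ u ∈ S, ∀ v ∈ S, G.Adj u v ↔ ¬(u ∈ A ↔ v ∈ A)

/-- The index paired with `j` in the search for a cycle of length `l` through the edge joining the
ends of a spanning path on `L` vertices. -/
def chordPartner (L l j : ℕ) : ℕ := if j + l ≤ L + 1 then j + l - 3 else j + l - 1 - L

/-- In the first case of `chordPartner` the cycle is u, P[j] … P[k], v, closed by the edge vu; in
the second it is u … P[k], then v back to P[j], and that cycle does not use the edge vu. Both have
exactly `l` vertices. -/
theorem IsPathList.not_adj_chordPartner {P : List V} {u v : V} (hP : IsPathList G S P u v)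
    (hvu : G.Adj v u) {l : ℕ} (h3 : 3 ≤ l) (hl : l ≤ P.length) (hno : ¬ CycleIn G S l) {j k : ℕ}
    (h1 : 1 ≤ j) (h2 : j + 2 ≤ P.length) (hk : k = chordPartner P.length l j)
    (hk' : k < P.length) (huj : G.Adj u (P[j]'(by omega))) : ¬ G.Adj v P[k] := by
  intro hvk
  have e0 := hP.getElem_zero
  have e1 := hP.getElem_last
  unfold chordPartner at hk
  split_ifs at hk with h
  · have h := ((hP.take (i := 0) (by omega)).append (hP.slice (i := j) (j := k) (by omega) hk')
      (by rw [e0]; exact huj) (disjoint_take_slice hP.nodup _ _ _ (by omega))).append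
      (hP.drop (i := P.length - 1) (by omega)) (by rw [e1]; exact hvk.symm) (by
        intro x hx
        rcases List.mem_append.1 hx with hx | hx
        · exact disjoint_take_drop hP.nodup _ _ (by omega) x hx
        · exact disjoint_slice_drop hP.nodup _ _ _ (by omega) x hx)
    have h' := h.cycleIn hvu (by simp; omega)
    refine hno ?_
    convert h' using 1
    simp
    omega
  · have h := (hP.take hk').append (hP.drop (i := j) (by omega)).reverse hvk.symm (by
        intro x hx hx'
        exact disjoint_take_drop hP.nodup _ _ (by omega) x hx (List.mem_reverse.1 hx'))
    have h' := h.cycleIn huj.symm (by simp; omega)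
    refine hno ?_
    convert h' using 1
    simp
    omega

/-- `chordPartner` permutes the inner positions and sends inner neighbours of `u` to non-neighbours
of `v`. With equality in the degree sum the two sets are complementary, which is the second half. -/
theorem IsPathList.degIn_add_le {P : List V} {u v : V} (hP : IsPathList G S P u v)
    (hvu : G.Adj v u) (hS : P.length = S.card) {l : ℕ} (h3 : 3 ≤ l) (hl : l ≤ P.length)
    (hno : ¬ CycleIn G S l) :
    degIn G S u + degIn G S v ≤ P.length ∧
    (P.length ≤ degIn G S u + degIn G S v → ∀ j k (_ : 1 ≤ j) (_ : j + 2 ≤ P.length)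
      (hk' : k < P.length), k = chordPartner P.length l j → ¬ G.Adj v P[k] →
      G.Adj u (P[j]'(by omega))) := by
  classical
  have hPS : P.toFinset = S := List.toFinset_eq_of_card hP.nodup hP.mem hS.ge
  have hIc := card_nbrIdx_toFinset (G := G) hP.nodup u
  have hJc := card_nbrIdx_toFinset (G := G) hP.nodup v
  rw [hPS] at hIc hJc
  have e0 := hP.getElem_zero
  have e1 := hP.getElem_last
  have hI : ∀ i ∈ nbrIdx G P u, 1 ≤ i ∧ i < P.length := by
    intro i hi
    obtain ⟨h, h'⟩ := mem_nbrIdx.1 hi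
    refine ⟨?_, h⟩
    by_contra h0
    have : i = 0 := by omega
    subst this
    rw [e0] at h'
    exact G.loopless.irrefl _ h'
  have hJ : ∀ i ∈ nbrIdx G P v, i + 2 ≤ P.length := by
    intro i hi
    obtain ⟨h, h'⟩ := mem_nbrIdx.1 hi
    by_contra h0
    have : i = P.length - 1 := by omega
    subst this
    rw [e1] at h'
    exact G.loopless.irrefl _ h'
  have hIe := Finset.pred_card_le_card_erase (s := nbrIdx G P u) (a := P.length - 1)
  have hJe := Finset.pred_card_le_card_erase (s := nbrIdx G P v) (a := 0)
  have hinj : Set.InjOn (chordPartner P.length l) (Finset.Icc 1 (P.length - 2) : Set ℕ) := by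
    intro i hi j hj hij
    simp only [Finset.coe_Icc, Set.mem_Icc] at hi hj
    unfold chordPartner at hij
    split_ifs at hij <;> omega
  have hmaps : ∀ i ∈ Finset.Icc 1 (P.length - 2),
      chordPartner P.length l i ∈ Finset.Icc 1 (P.length - 2) := by
    intro i hi
    rw [Finset.mem_Icc] at hi ⊢
    unfold chordPartner
    split_ifs <;> omega
  have hI0 : (nbrIdx G P u).erase (P.length - 1) ⊆ Finset.Icc 1 (P.length - 2) := by
    intro i hi
    rw [Finset.mem_erase] at hi
    have := hI i hi.2
    rw [Finset.mem_Icc]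
    omega
  have hJ0 : (nbrIdx G P v).erase 0 ⊆ Finset.Icc 1 (P.length - 2) := by
    intro i hi
    rw [Finset.mem_erase] at hi
    have := hJ i hi.2
    rw [Finset.mem_Icc]
    omega
  have hdisj : Disjoint (((nbrIdx G P u).erase (P.length - 1)).image (chordPartner P.length l))
      ((nbrIdx G P v).erase 0) := by
    rw [Finset.disjoint_left]
    intro x hx hx'
    obtain ⟨i, hi, rfl⟩ := Finset.mem_image.1 hx
    have hi2 := Finset.mem_Icc.1 (hI0 hi)
    have hx2 := mem_nbrIdx.1 (Finset.mem_erase.1 hx').2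
    obtain ⟨h, h'⟩ := hx2
    obtain ⟨q, q'⟩ := mem_nbrIdx.1 (Finset.mem_erase.1 hi).2
    exact hP.not_adj_chordPartner hvu h3 hl hno hi2.1 (by omega) rfl h q' h'
  have hc1 : (((nbrIdx G P u).erase (P.length - 1)).image (chordPartner P.length l)).card =
      ((nbrIdx G P u).erase (P.length - 1)).card :=
    Finset.card_image_of_injOn (hinj.mono (by exact_mod_cast hI0))
  have hsub : ((nbrIdx G P u).erase (P.length - 1)).image (chordPartner P.length l) ∪
      (nbrIdx G P v).erase 0 ⊆ Finset.Icc 1 (P.length - 2) := by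
    refine Finset.union_subset ?_ hJ0
    intro x hx
    obtain ⟨i, hi, rfl⟩ := Finset.mem_image.1 hx
    exact hmaps i (hI0 hi)
  have hcard := Finset.card_le_card hsub
  rw [Finset.card_union_of_disjoint hdisj, hc1, Nat.card_Icc] at hcard
  refine ⟨by omega, ?_⟩
  intro hge j k hj1 hj2 hk' hk hvk
  have heq := Finset.eq_of_subset_of_card_le hsub (by
    rw [Finset.card_union_of_disjoint hdisj, hc1, Nat.card_Icc]; omega)
  have hjm : j ∈ Finset.Icc 1 (P.length - 2) := by rw [Finset.mem_Icc]; omega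
  have hkm := hmaps j hjm
  rw [← hk, ← heq] at hkm
  rcases Finset.mem_union.1 hkm with h | h
  · obtain ⟨i, hi, hik⟩ := Finset.mem_image.1 h
    rw [hk] at hik
    have : i = j := hinj (by exact_mod_cast hI0 hi) (by exact_mod_cast hjm) hik
    subst this
    exact (mem_nbrIdx.1 (Finset.mem_erase.1 hi).2).2
  · exact absurd (mem_nbrIdx.1 (Finset.mem_erase.1 h).2).2 hvk

theorem IsCycleList.isPathList_rotate {C : List V} (hC : IsCycleList G S C) {i : ℕ}
    (hi : i < C.length) :
    IsPathList G S (C.rotate i) C[i]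
      (C[(C.length - 1 + i) % C.length]'(Nat.mod_lt _ (by omega))) ∧
    G.Adj (C[(C.length - 1 + i) % C.length]'(Nat.mod_lt _ (by omega))) C[i] := by
  obtain ⟨a, b, hP, hab⟩ := (hC.rotate i).exists_isPathList
  have e0 := hP.getElem_zero
  have e1 := hP.getElem_last
  simp only [List.getElem_rotate, List.length_rotate, Nat.zero_add, Nat.mod_eq_of_lt hi] at e0 e1
  rw [e0, e1]
  exact ⟨hP, hab⟩

theorem degSum_eq_sum_range {C : List V} (hC : C.Nodup) (hmem : ∀ x ∈ C, x ∈ S)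
    (hS : C.length = S.card) (a : V) :
    degSum G S = ∑ i ∈ Finset.range C.length, degIn G S (C.getD i a) := by
  classical
  have hCS := List.toFinset_eq_of_card hC hmem hS.ge
  unfold degSum
  symm
  refine Finset.sum_nbij (fun i => C.getD i a) ?_ ?_ ?_ (fun _ _ => rfl)
  · intro i hi
    rw [List.getD_eq_getElem _ _ (Finset.mem_range.1 hi)]
    exact hmem _ (List.getElem_mem _)
  · intro i hi j hj hij
    simp only [Finset.coe_range, Set.mem_Iio] at hi hj
    simp only at hij
    rw [List.getD_eq_getElem _ _ hi, List.getD_eq_getElem _ _ hj] at hij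
    exact hC.getElem_inj_iff.1 hij
  · intro x hx
    rw [Finset.mem_coe, ← hCS, List.mem_toFinset] at hx
    obtain ⟨i, hi, rfl⟩ := List.mem_iff_getElem.1 hx
    exact ⟨i, by simpa using hi, by simp [hi]⟩

/-- Summing a function over the consecutive pairs of a closed sequence counts each value twice. -/
theorem sum_add_pred_mod (f : ℕ → ℕ) (L : ℕ) :
    ∑ i ∈ Finset.range L, (f i + f ((L - 1 + i) % L)) = 2 * ∑ i ∈ Finset.range L, f i := by
  rcases L with _ | n
  · simp
  rw [Finset.sum_add_distrib, two_mul]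
  congr 1
  rw [Finset.sum_range_succ', Finset.sum_range_succ]
  congr 1
  · refine Finset.sum_congr rfl fun i hi => ?_
    have := Finset.mem_range.1 hi
    rw [show n + 1 - 1 + (i + 1) = i + (n + 1) by omega, Nat.add_mod_right,
      Nat.mod_eq_of_lt (by omega)]
  · simp

/-- Every vertex lies on two edges of a Hamiltonian cycle, so a bound on degree sums along cycle
edges is a bound on the number of edges. -/
theorem IsCycleList.sum_pairs {C : List V} (hC : IsCycleList G S C) (hS : C.length = S.card)
    (a : V) :
    ∑ i ∈ Finset.range C.length, (degIn G S (C.getD i a) +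
      degIn G S (C.getD ((C.length - 1 + i) % C.length) a)) = 2 * degSum G S := by
  rw [sum_add_pred_mod (fun i => degIn G S (C.getD i a)), degSum_eq_sum_range hC.nodup hC.mem hS a]

/-- Bondy: a Hamiltonian graph of order `n` with more than `n ^ 2 / 4` edges is pancyclic. -/
theorem IsCycleList.pancyclic_of_lt {C : List V} (hC : IsCycleList G S C) (hS : C.length = S.card)
    (hlt : S.card ^ 2 < 2 * degSum G S) {l : ℕ} (h3 : 3 ≤ l) (hl : l ≤ S.card) :
    CycleIn G S l := by
  by_contra hno
  have h3' := hC.three_le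
  have := Finset.sum_le_card_nsmul (Finset.range C.length)
    (fun i => degIn G S (C.getD i (C[0]'(by omega))) +
      degIn G S (C.getD ((C.length - 1 + i) % C.length) (C[0]'(by omega)))) C.length (by
    intro i hi
    have hi' := Finset.mem_range.1 hi
    obtain ⟨hP, hadj⟩ := hC.isPathList_rotate hi'
    have := (hP.degIn_add_le hadj (by simpa using hS) h3 (by simpa [hS] using hl) hno).1
    simp only [List.length_rotate] at this
    rwa [List.getD_eq_getElem _ _ hi', List.getD_eq_getElem _ _ (Nat.mod_lt _ (by omega))])
  rw [hC.sum_pairs hS, Finset.card_range, smul_eq_mul, hS] at this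
  nlinarith

theorem IsCycleList.isBalancedBipartiteOn {C : List V} (hC : IsCycleList G S C)
    (hS : C.length = S.card) (heven : Even S.card) (hge : S.card ^ 2 ≤ 2 * degSum G S)
    (hno : ¬ CycleIn G S (S.card - 1)) : IsBalancedBipartiteOn G S := by
  classical
  have h3 := hC.three_le
  obtain ⟨m, hm⟩ := heven
  rw [← hS] at hno
  set L := C.length with hL
  have hLpos : 0 < L := by omega
  have hL4 : 4 ≤ L := by omega
  let c : ℕ → V := fun k => C[k % L]'(Nat.mod_lt _ hLpos)
  have hcL : ∀ k, c (k + L) = c k := fun k => by simp [c]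
  have hget : ∀ i (hi : i < C.length), C[i] = c i := by
    intro i hi
    show C[i] = C[i % L]'_
    congr 1
    exact (Nat.mod_eq_of_lt hi).symm
  have hpair : ∀ i < L, degIn G S (c i) + degIn G S (c (L - 1 + i)) ≤ L := by
    intro i hi
    obtain ⟨hP, hadj⟩ := hC.isPathList_rotate hi
    have := (hP.degIn_add_le hadj (by simpa using hS) (l := L - 1) (by omega) (by simp [← hL])
      hno).1
    simp only [List.length_rotate] at this
    simpa only [c, Nat.mod_eq_of_lt hi] using this
  have hsum : ∑ i ∈ Finset.range L, (degIn G S (c i) + degIn G S (c (L - 1 + i))) =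
      2 * degSum G S := by
    rw [← hC.sum_pairs hS C[0]]
    refine Finset.sum_congr rfl fun i hi => ?_
    have hi' := Finset.mem_range.1 hi
    rw [List.getD_eq_getElem _ _ hi', List.getD_eq_getElem _ _ (Nat.mod_lt _ (by omega))]
    rw [hget i hi']
  -- The edge count leaves no slack, so each cycle edge attains the bound and the chord rule becomes
  -- an equivalence.
  have hpair_eq : ∀ i < L, L ≤ degIn G S (c i) + degIn G S (c (L - 1 + i)) := by
    intro i hi
    by_contra hlt
    have := Finset.sum_lt_sum (s := Finset.range L)
      (f := fun i => degIn G S (c i) + degIn G S (c (L - 1 + i))) (g := fun _ => L)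
      (fun i hi => hpair i (Finset.mem_range.1 hi)) ⟨i, Finset.mem_range.2 hi, by omega⟩
    rw [hsum, Finset.sum_const, Finset.card_range, smul_eq_mul] at this
    rw [hS] at this
    nlinarith
  have hrot : ∀ i < L, ∀ j < L, ∀ h : j < (C.rotate i).length, (C.rotate i)[j] = c (j + i) := by
    intro i hi j hj h
    rw [List.getElem_rotate]
  -- For `l = L - 1` and `j ≥ 3` the partner of `j` is `j - 2`. The index `L - 1 + i` stands for `i
  -- - 1`, so the chord on the right has span one less than the chord on the left.
  have step : ∀ i < L, ∀ j, 3 ≤ j → j + 2 ≤ L →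
      (G.Adj (c i) (c (j + i)) ↔ ¬ G.Adj (c (L - 1 + i)) (c (j - 2 + i))) := by
    intro i hi j hj1 hj2
    obtain ⟨hP, hadj⟩ := hC.isPathList_rotate hi
    have hpart : j - 2 = chordPartner (C.rotate i).length (L - 1) j := by
      rw [List.length_rotate, ← hL, chordPartner, if_neg (by omega)]
      omega
    have hci : C[i] = c i := hget i hi
    have h1 := hP.not_adj_chordPartner hadj (l := L - 1) (by omega) (by simp [← hL]) hno
      (j := j) (k := j - 2) (by omega) (by simpa [← hL] using hj2) hpart
      (by simp [← hL]; omega)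
    have h2 := (hP.degIn_add_le hadj (by simpa using hS) (l := L - 1) (by omega) (by simp [← hL])
      hno).2 (by
        have := hpair_eq i hi
        rw [← hci] at this
        rw [List.length_rotate]
        exact this) j (j - 2) (by omega)
      (by simpa [← hL] using hj2) (by simp [← hL]; omega) hpart
    rw [hrot i hi j (by omega), hrot i hi (j - 2) (by omega), hci] at h1
    rw [hrot i hi j (by omega), hrot i hi (j - 2) (by omega), hci] at h2
    exact ⟨h1, h2⟩
  -- A chord of span two skips one vertex and closes a cycle of length `L - 1`.
  have two : ∀ i < L, ¬ G.Adj (c i) (c (2 + i)) := by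
    intro i hi hadj2
    obtain ⟨hP, hadj⟩ := hC.isPathList_rotate hi
    have hlen : (C.rotate i).length = L := by simp [hL]
    have h := (hP.take (i := 0) (by omega)).append (hP.drop (i := 2) (by omega)) (by
      rw [hrot i hi 0 (by omega), hrot i hi 2 (by omega), Nat.zero_add]; exact hadj2)
      (disjoint_take_drop hP.nodup _ _ (by omega))
    refine hno ?_
    have h' := h.cycleIn hadj (by simp [← hL]; omega)
    convert h' using 1
    simp [← hL]
    omega
  have cmod : ∀ i, c i = c (i % L) := fun i => by simp [c]
  have cshift : ∀ i j, c (j + i) = c (j + i % L) := fun i j => by simp [c]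
  -- Chords of span two are absent and presence alternates with the span, so exactly the odd spans
  -- occur.
  have parity : ∀ j, 2 ≤ j → j + 2 ≤ L → ∀ i, (G.Adj (c i) (c (j + i)) ↔ Odd j) := by
    intro j hj
    induction j, hj using Nat.le_induction with
    | base =>
      intro _ i
      rw [cmod i, cshift i]
      have := two (i % L) (Nat.mod_lt _ hLpos)
      simp [this]
    | succ j hj ih =>
      intro hj2 i
      have h := step (i % L) (Nat.mod_lt _ hLpos) (j + 1) (by omega) hj2
      rw [← cmod, ← cshift, ← cshift, ← cshift] at h
      have h2 := ih (by omega) (L - 1 + i)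
      rw [show j + (L - 1 + i) = (j + 1 - 2 + i) + L by omega, hcL] at h2
      rw [h, h2, Nat.odd_add_one]
  have one : ∀ i, G.Adj (c i) (c (1 + i)) := by
    intro i
    have h := (hC.isPathList_rotate (Nat.mod_lt (1 + i) hLpos)).2
    have h1 : (L - 1 + (1 + i) % L) % L = i % L := by
      rw [Nat.add_mod_mod, show L - 1 + (1 + i) = i + L by omega, Nat.add_mod_right]
    simp only [← hL, h1] at h
    exact h
  have parity' : ∀ i j, i < j → j < L → (G.Adj (c i) (c j) ↔ Odd (j - i)) := by
    intro i j hij hj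
    by_cases h1 : j = 1 + i
    · subst h1
      simp [one i]
    by_cases h2 : j = L - 1 + i
    · have hi0 : i = 0 := by omega
      subst hi0
      have hodd : Odd (j - 0) := ⟨m - 1, by omega⟩
      have := one (L - 1)
      rw [show 1 + (L - 1) = 0 + L by omega, hcL] at this
      rw [h2]
      simp only [Nat.add_zero, Nat.sub_zero]
      exact ⟨fun _ => ⟨m - 1, by omega⟩, fun _ => this.symm⟩
    · have := parity (j - i) (by omega) (by omega) i
      rwa [Nat.sub_add_cancel hij.le] at this
  have cinj : ∀ i < L, ∀ j < L, c i = c j → i = j := by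
    intro i hi j hj h
    have := hC.nodup.getElem_inj_iff.1 h
    rwa [Nat.mod_eq_of_lt hi, Nat.mod_eq_of_lt hj] at this
  have hCS := List.toFinset_eq_of_card hC.nodup hC.mem hS.ge
  have csurj : ∀ x ∈ S, ∃ i < L, x = c i := by
    intro x hx
    rw [← hCS, List.mem_toFinset] at hx
    obtain ⟨i, hi, rfl⟩ := List.mem_iff_getElem.1 hx
    exact ⟨i, hi, hget i hi⟩
  have hmemA : ∀ i < L, (c i ∈ (Finset.range m).image (fun k => c (2 * k)) ↔ Even i) := by
    intro i hi
    rw [Finset.mem_image]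
    constructor
    · rintro ⟨k, hk, hki⟩
      have := cinj _ (by have := Finset.mem_range.1 hk; omega) _ hi hki
      exact ⟨k, by omega⟩
    · rintro ⟨k, hk⟩
      exact ⟨k, Finset.mem_range.2 (by omega), by congr 1; omega⟩
  refine ⟨(Finset.range m).image fun k => c (2 * k), ?_, ?_, ?_⟩
  · intro x hx
    obtain ⟨k, -, rfl⟩ := Finset.mem_image.1 hx
    exact hC.mem _ (List.getElem_mem _)
  · rw [Finset.card_image_of_injOn, Finset.card_range]
    · omega
    · intro i hi j hj hij
      simp only [Finset.coe_range, Set.mem_Iio] at hi hj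
      have := cinj _ (by omega) _ (by omega) hij
      omega
  · intro u hu v hv
    obtain ⟨i, hi, rfl⟩ := csurj u hu
    obtain ⟨j, hj, rfl⟩ := csurj v hv
    rw [hmemA i hi, hmemA j hj]
    rcases lt_trichotomy i j with h | rfl | h
    · rw [parity' i j h hj, Nat.odd_sub h.le, ← Nat.not_even_iff_odd]
      tauto
    · simp
    · rw [G.adj_comm, parity' j i h hi, Nat.odd_sub h.le, ← Nat.not_even_iff_odd]
      tauto

/-- A vertex adjacent to more than half of a cycle lies on cycles of all lengths up to the length
of that cycle. -/
theorem IsCycleList.cycleIn_of_many_nbrs {C : List V} {v : V} (hC : IsCycleList G S C)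
    (hvS : v ∈ S) (hv : v ∉ C) (hd : C.length < 2 * (nbrIdx G C v).card) {l : ℕ} (h3 : 3 ≤ l)
    (hl : l ≤ C.length) : CycleIn G S l := by
  classical
  have hpos : 0 < C.length := by have := hC.three_le; omega
  have hIlt : ∀ i ∈ nbrIdx G C v, i < C.length := fun i hi => (mem_nbrIdx.1 hi).1
  have hinj : Set.InjOn (fun i => (i + (l - 2)) % C.length) (nbrIdx G C v : Set ℕ) := by
    intro i hi j hj hij
    have h1 : i ≡ j [MOD C.length] := Nat.ModEq.add_right_cancel' (l - 2) hij
    rwa [Nat.ModEq, Nat.mod_eq_of_lt (hIlt i hi), Nat.mod_eq_of_lt (hIlt j hj)] at h1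
  -- The neighbour positions fill more than half of the cycle, so they meet their own shift by `l -
  -- 2`. The arc between two such neighbours has `l - 1` vertices, and `v` closes it.
  obtain ⟨i, hi, hi'⟩ : ∃ i ∈ nbrIdx G C v, (i + (l - 2)) % C.length ∈ nbrIdx G C v := by
    by_contra hcon
    push Not at hcon
    have hdisj : Disjoint ((nbrIdx G C v).image fun i => (i + (l - 2)) % C.length)
        (nbrIdx G C v) := by
      rw [Finset.disjoint_left]
      intro x hx
      obtain ⟨i, hi, rfl⟩ := Finset.mem_image.1 hx
      exact hcon i hi
    have hsub : ((nbrIdx G C v).image fun i => (i + (l - 2)) % C.length) ∪ nbrIdx G C v ⊆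
        Finset.range C.length := by
      intro x hx
      rw [Finset.mem_range]
      rcases Finset.mem_union.1 hx with hx | hx
      · obtain ⟨i, hi, rfl⟩ := Finset.mem_image.1 hx
        exact Nat.mod_lt _ hpos
      · exact hIlt x hx
    have := Finset.card_le_card hsub
    rw [Finset.card_union_of_disjoint hdisj, Finset.card_image_of_injOn hinj,
      Finset.card_range] at this
    omega
  obtain ⟨h1, h1'⟩ := mem_nbrIdx.1 hi
  obtain ⟨h2, h2'⟩ := mem_nbrIdx.1 hi'
  obtain ⟨hP, -⟩ := hC.isPathList_rotate h1
  have hlt : l - 2 < (C.rotate i).length := by simp; omega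
  have he : (C.rotate i)[l - 2] = C[(i + (l - 2)) % C.length] := by
    rw [List.getElem_rotate]
    congr 2
    omega
  have h := (hP.take hlt).append (isPathList_singleton hvS) (by rw [he]; exact h2'.symm) (by
    intro x hx hx'
    rw [List.mem_singleton] at hx'
    subst hx'
    exact hv (List.mem_rotate.1 (List.mem_of_mem_take hx)))
  have h' := h.cycleIn h1' (by simp; omega)
  convert h' using 1
  simp
  omega

/-- Bondy: a Hamiltonian graph of even order `n` with at least `n ^ 2 / 4` edges is pancyclic or
balanced complete bipartite. -/
theorem IsCycleList.pancyclic_or_bipartite {C : List V} (hC : IsCycleList G S C)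
    (hS : C.length = S.card) (heven : Even S.card) (hge : S.card ^ 2 ≤ 2 * degSum G S) :
    (∀ l, 3 ≤ l → l ≤ S.card → CycleIn G S l) ∨ IsBalancedBipartiteOn G S := by
  classical
  by_cases hno : CycleIn G S (S.card - 1)
  swap
  · exact Or.inr (hC.isBalancedBipartiteOn hS heven hge hno)
  left
  intro l h3 hl
  obtain ⟨C', hC', hl'⟩ := hno
  have h3' := hC'.three_le
  by_cases hlS : l = S.card
  · exact ⟨C, hC, by omega⟩
  have hsub : C'.toFinset ⊆ S := fun x hx => hC'.mem x (by simpa using hx)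
  have hc' := List.toFinset_card_of_nodup hC'.nodup
  obtain ⟨v, hvS, hv⟩ : ∃ v ∈ S, v ∉ C'.toFinset := by
    by_contra hcon
    push Not at hcon
    have := Finset.card_le_card (show S ⊆ C'.toFinset from hcon)
    omega
  have hE : C'.toFinset = S.erase v := by
    refine Finset.eq_of_subset_of_card_le (fun x hx => ?_) ?_
    · rw [Finset.mem_erase]
      refine ⟨?_, hsub hx⟩
      rintro rfl
      exact hv hx
    · rw [Finset.card_erase_of_mem hvS]; omega
  have hdv : (nbrIdx G C' v).card = degIn G S v := by
    rw [card_nbrIdx_toFinset hC'.nodup, hE, degIn_erase_self]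
  -- If the vertex missed by the shorter cycle has large degree, it supplies all lengths. If not,
  -- deleting it makes the edge bound strict on a Hamiltonian graph.
  by_cases hd : S.card ≤ 2 * degIn G S v
  · exact hC'.cycleIn_of_many_nbrs hvS (by simpa using hv) (by omega) h3 (by omega)
  · have hC'' : IsCycleList G (S.erase v) C' := hC'.mono fun x hx => by
      rw [← hE]; simpa using hx
    have hce := Finset.card_erase_of_mem hvS
    have := degSum_eq_erase (G := G) hvS
    refine (hC''.pancyclic_of_lt (by omega) ?_ h3 (by omega)).mono (Finset.erase_subset _ _)
    obtain ⟨n, hn⟩ : ∃ n, S.card = n + 1 := ⟨S.card - 1, by omega⟩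
    obtain ⟨m, hm⟩ := heven
    rw [hce]
    rw [hn] at hge hd ⊢
    simp only [Nat.add_sub_cancel]
    have : 4 * degIn G S v + 2 ≤ 2 * n + 2 := by omega
    nlinarith

end Pancyclic

/-! ### Dense graphs with and without a long cycle -/

section Circumference

variable {V : Type*} {G : SimpleGraph V} {S : Finset V}

/-- The vertices of `S` span two complete graphs sharing exactly the vertex `z`. -/
def IsTwoCliquesOn (G : SimpleGraph V) (S : Finset V) : Prop :=
  ∃ z ∈ S, ∃ A ⊆ S, z ∉ A ∧ A.card = S.card / 2 ∧
    ∀ u ∈ S, ∀ v ∈ S, u ≠ v → (G.Adj u v ↔ u = z ∨ v = z ∨ (u ∈ A ↔ v ∈ A))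

/-- A dense graph in which some longest cycle covers more than half of the vertices has cycles of
all smaller lengths, unless that cycle is Hamiltonian and the edge bound is tight. -/
theorem IsCycleList.cycleIn_of_longest {C : List V} (hC : IsCycleList G S C)
    (hmax : ∀ l, CycleIn G S l → l ≤ C.length) (hL : S.card + 2 ≤ 2 * C.length)
    (hge : S.card ^ 2 ≤ 2 * degSum G S) :
    (∀ l, 3 ≤ l → l ≤ C.length → CycleIn G S l) ∨
      (C.length = S.card ∧ 2 * degSum G S ≤ S.card ^ 2) := by
  classical
  induction S using Finset.strongInduction with
  | H S ih =>
  by_cases hlow : ∃ v ∈ S, v ∉ C ∧ 2 * degIn G S v < S.card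
  · obtain ⟨v, hv, hvC, hd⟩ := hlow
    have hce := Finset.card_erase_of_mem hv
    have hsub := Finset.erase_subset v S
    have hdeg := degSum_eq_erase (G := G) hv
    obtain ⟨n, hn⟩ : ∃ n, S.card = n + 1 := ⟨S.card - 1, by omega⟩
    -- On `n + 1` vertices the removed degree satisfies `2 * d ≤ n`, and `(n + 1) ^ 2 - 2 * n > n ^
    -- 2`: one deletion already makes the bound strict, which excludes the tight alternative in the
    -- induction hypothesis.
    have hlt : (S.erase v).card ^ 2 < 2 * degSum G (S.erase v) := by
      rw [hce]
      rw [hn] at hge hd ⊢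
      simp only [Nat.add_sub_cancel]
      nlinarith
    rcases ih (S.erase v) (Finset.erase_ssubset hv)
      (hC.mono fun x hx => Finset.mem_erase.2 ⟨fun h => hvC (h ▸ hx), hC.mem x hx⟩)
      (fun l hl => hmax l (hl.mono hsub)) (by omega) hlt.le with h | h
    · exact Or.inl fun l h3 hl => (h l h3 hl).mono hsub
    · omega
  · push Not at hlow
    have hS := length_eq_card_of_longest hC hmax hL hlow
    by_cases hlt : S.card ^ 2 < 2 * degSum G S
    · exact Or.inl fun l h3 hl => hC.pancyclic_of_lt hS hlt h3 (by omega)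
    · exact Or.inr ⟨hS, by omega⟩

theorem exists_longest_cycle {r : ℕ} (h : ∃ l, r ≤ l ∧ CycleIn G S l) :
    ∃ C, IsCycleList G S C ∧ r ≤ C.length ∧ ∀ l, CycleIn G S l → l ≤ C.length := by
  obtain ⟨l0, hl0, h0⟩ := h
  obtain ⟨l, hl, hmax⟩ := exists_max_of_bounded (p := CycleIn G S) id S.card ⟨l0, h0⟩
    (fun l hl => hl.le_card)
  obtain ⟨C, hC, rfl⟩ := hl
  exact ⟨C, hC, hl0.trans (hmax l0 h0), hmax⟩

theorem degSum_le_sdiff [DecidableEq V] {L : Finset V} (hL : L ⊆ S) :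
    degSum G S ≤ degSum G (S \ L) + 2 * ∑ x ∈ L, degIn G S x := by
  induction L using Finset.induction_on with
  | empty => simp
  | insert x L hx ih =>
    have hxS := hL (Finset.mem_insert_self x L)
    have := ih fun y hy => hL (Finset.mem_insert_of_mem hy)
    rw [Finset.sum_insert hx]
    have h1 : S \ insert x L = (S \ L).erase x := by
      ext y
      simp only [Finset.mem_sdiff, Finset.mem_insert, Finset.mem_erase]
      tauto
    have h2 := degSum_eq_erase (G := G) (S := S \ L) (v := x) (by simp [hxS, hx])
    have h3 := degIn_mono (G := G) (S := S \ L) (T := S) Finset.sdiff_subset x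
    rw [h1]
    omega

/-- Peeling off vertices of minimum degree down to `r` vertices either meets a core of large
minimum degree or bounds the number of edges. -/
theorem exists_core_or_degSum_le [Finite V] {t r : ℕ} (hr : 3 ≤ r) (k : ℕ)
    (hS : S.card = r + k) (hno : ¬ CycleIn G S r) :
    (∃ K ⊆ S, r < K.card ∧ (∀ v ∈ K, t + 1 ≤ degIn G K v) ∧
      degSum G S ≤ degSum G K + 2 * t * (S.card - K.card)) ∨
    ∃ i, 1 ≤ i ∧ 2 * i < r ∧
      degSum G S ≤ (r - i) * (r - i - 1) + 2 * i ^ 2 +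
        2 * ∑ x ∈ Finset.range k, min t (i + x + 1) ∧
      ∃ v ∈ S, degIn G S v ≤ i + k := by
  classical
  induction k generalizing S with
  | zero =>
    right
    have hS' : S.card = r := hS
    obtain ⟨i, h1, h2, L, hLS, hLc, hL⟩ := exists_low_degrees_of_not_hamiltonian (G := G) (S := S)
      (by omega) (by rwa [hS'])
    refine ⟨i, h1, by omega, ?_, ?_⟩
    · have h3 := degSum_le_sdiff (G := G) hLS
      have h4 := degSum_le (G := G) (S := S \ L)
      have h5 := Finset.sum_le_card_nsmul L (fun x => degIn G S x) i hL
      rw [Finset.card_sdiff_of_subset hLS, hLc, hS'] at h4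
      rw [hLc, smul_eq_mul] at h5
      simp only [Finset.range_zero, Finset.sum_empty]
      nlinarith
    · obtain ⟨v, hv⟩ := Finset.card_pos.1 (show 0 < L.card by omega)
      exact ⟨v, hLS hv, hL v hv⟩
  | succ k ih =>
    by_cases hcore : ∀ v ∈ S, t + 1 ≤ degIn G S v
    · exact Or.inl ⟨S, subset_rfl, by omega, hcore, by simp⟩
    push Not at hcore
    obtain ⟨v0, hv0, hd0⟩ := hcore
    obtain ⟨v, hv, hmin⟩ := Finset.exists_min_image S (degIn G S) ⟨v0, hv0⟩
    have hvt : degIn G S v ≤ t := by have := hmin v0 hv0; omega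
    have hce := Finset.card_erase_of_mem hv
    have hsub := Finset.erase_subset v S
    have hdeg := degSum_eq_erase (G := G) hv
    rcases ih (S := S.erase v) (by omega) (fun h => hno (h.mono hsub)) with
      ⟨K, hKS, hK1, hK2, hK3⟩ | ⟨i, hi1, hi2, hi3, u, hu, hui⟩
    · left
      refine ⟨K, hKS.trans hsub, hK1, hK2, ?_⟩
      have hle := Finset.card_le_card hKS
      obtain ⟨e, he⟩ : ∃ e, S.card - K.card = e + 1 := ⟨S.card - K.card - 1, by omega⟩
      rw [show (S.erase v).card - K.card = e by omega] at hK3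
      rw [he]
      nlinarith
    · right
      have hu2 := degIn_le_degIn_erase_add_one (G := G) (S := S) v u
      have hvu := hmin u (Finset.mem_of_mem_erase hu)
      -- The witness of degree at most `i + k` after deletion has degree at most `i + k + 1` before
      -- it, and `v` has minimum degree. This invariant is why a low-degree vertex is part of the
      -- conclusion.
      refine ⟨i, hi1, hi2, ?_, v, hv, by omega⟩
      rw [Finset.sum_range_succ]
      have : degIn G S v ≤ min t (i + k + 1) := le_min hvt (by omega)
      omega

/-- The last hypothesis leaves open which of the two blocks is named `A`; the definition asks for a
clique of `S.card / 2` vertices without `z`. -/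
theorem isTwoCliquesOn_of_blocks [DecidableEq V] {A : Finset V} {z : V} (hA : A ⊆ S) (hz : z ∈ A)
    (hsep : ∀ a ∈ A, a ≠ z → ∀ w ∈ S, G.Adj a w → w ∈ A)
    (hAc : ∀ v ∈ A, ∀ w ∈ A, v ≠ w → G.Adj v w)
    (hBc : ∀ v ∈ insert z (S \ A), ∀ w ∈ insert z (S \ A), v ≠ w → G.Adj v w)
    (hcard : A.card = S.card / 2 + 1 ∨ S.card = A.card + S.card / 2) : IsTwoCliquesOn G S := by
  have key : ∀ u ∈ S, ∀ v ∈ S, u ≠ v → (G.Adj u v ↔ u = z ∨ v = z ∨ (u ∈ A ↔ v ∈ A)) := by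
    intro u hu v hv huv
    have hB : ∀ x ∈ S, x = z ∨ x ∉ A → x ∈ insert z (S \ A) := by
      intro x hx h
      rw [Finset.mem_insert, Finset.mem_sdiff]
      tauto
    constructor
    · intro hadj
      by_contra hcon
      push Not at hcon
      obtain ⟨h1, h2, h3⟩ := hcon
      by_cases huA : u ∈ A
      · have := hsep u huA h1 v hv hadj
        tauto
      · have hvA : v ∈ A := by tauto
        exact huA (hsep v hvA h2 u hu hadj.symm)
    · intro h
      by_cases huA : u ∈ A <;> by_cases hvA : v ∈ A
      · exact hAc u huA v hvA huv
      · have : u = z ∨ v = z := by tauto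
        rcases this with rfl | rfl
        · exact hBc u (hB u hu (Or.inl rfl)) v (hB v hv (Or.inr hvA)) huv
        · exact absurd hz hvA
      · have : u = z ∨ v = z := by tauto
        rcases this with rfl | rfl
        · exact absurd hz huA
        · exact hBc u (hB u hu (Or.inr huA)) v (hB v hv (Or.inl rfl)) huv
      · exact hBc u (hB u hu (Or.inr huA)) v (hB v hv (Or.inr hvA)) huv
  rcases hcard with h | h
  · refine ⟨z, hA hz, A.erase z, (Finset.erase_subset _ _).trans hA, by simp, ?_, ?_⟩
    · rw [Finset.card_erase_of_mem hz, h]; omega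
    · intro u hu v hv huv
      rw [key u hu v hv huv, Finset.mem_erase, Finset.mem_erase]
      tauto
  · refine ⟨z, hA hz, S \ A, Finset.sdiff_subset, by simp [hz], ?_, ?_⟩
    · rw [Finset.card_sdiff_of_subset hA]; omega
    · intro u hu v hv huv
      rw [key u hu v hv huv, Finset.mem_sdiff, Finset.mem_sdiff]
      tauto

/-- The right-hand side falls short of `2 * m ^ 2` by `(a - 1) * (m - 1 - a)`, which is positive
here. -/
theorem block_bound_lt {a b e m : ℕ} (ha : 2 ≤ a) (ham : a + 1 < m) (hm : a + 1 + b + e = 2 * m)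
    (h : 2 * m ^ 2 ≤ (a + 1) * a + (m + 1) * b + (m + 1) * e) : False := by
  obtain ⟨c, rfl⟩ : ∃ c, a = c + 2 := ⟨a - 2, by omega⟩
  obtain ⟨d, rfl⟩ : ∃ d, m = c + d + 4 := ⟨m - (c + 4), by omega⟩
  obtain ⟨f, hf⟩ : ∃ f, f = b + e := ⟨_, rfl⟩
  rw [add_assoc ((c + 2 + 1) * (c + 2)), ← mul_add, ← hf] at h
  obtain rfl : f = c + 2 * d + 5 := by omega
  have := Nat.zero_le (c * d)
  linarith

/-- The shortfall of the right-hand side is `b * e`. -/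
theorem block_bound_eq_of_succ {b e m : ℕ} (hb : 1 ≤ b) (hm : m = b + e)
    (h : 2 * m ^ 2 + m ≤ m * m + (b + 1) * b + (m + 1) * e) : e = 0 := by
  subst hm
  have : b * e ≤ 0 := by linarith
  rcases Nat.mul_eq_zero.1 (Nat.le_zero.1 this) with h | h <;> omega

/-- The shortfall of the right-hand side is `(b - 1) * e`. -/
theorem block_bound_eq {b e m : ℕ} (hb : 2 ≤ b) (hm : m = b + 1 + e)
    (h : 2 * m ^ 2 ≤ (m + 1) * m + (b + 1) * b + (m + 1) * e) : e = 0 := by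
  subst hm
  obtain ⟨c, rfl⟩ : ∃ c, b = c + 2 := ⟨b - 2, by omega⟩
  have h0 := Nat.zero_le (c * e)
  linarith

/-- With `t` equal to half of `m` rounded up, the core has degrees large enough for an end block,
while each vertex outside it costs at most `m + 1` in the degree sum. Only a spanning core made of
two cliques, one of them of order `m` or `m + 1`, meets the bound. -/
theorem isTwoCliquesOn_of_core {m t : ℕ} (ht : 2 * t ≤ m + 1) (ht' : m ≤ 2 * t)
    (hm : 2 ≤ m) (hS : S.card = 2 * m) (hge : 2 * m ^ 2 ≤ degSum G S)
    (hno : ∀ l, m + 2 ≤ l → ¬ CycleIn G S l) {K : Finset V} (hKS : K ⊆ S) (hKc : m + 2 < K.card)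
    (hKd : ∀ v ∈ K, t + 1 ≤ degIn G K v)
    (hle : degSum G S ≤ degSum G K + 2 * t * (S.card - K.card)) : IsTwoCliquesOn G S := by
  classical
  have hnoK : ∀ l, m + 2 ≤ l → ¬ CycleIn G K l := fun l hl h => hno l hl (h.mono hKS)
  obtain ⟨A, hAK, z, hz, hA1, hA2, hsep⟩ := exists_end_block (Finset.card_pos.1 (by omega))
    (by omega) (show m + 2 ≤ 2 * (t + 1) by omega) hKd hnoK
  have hzB : z ∉ K \ A := by simp [hz]
  have hBc : (insert z (K \ A)).card = K.card - A.card + 1 := by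
    rw [Finset.card_insert_of_notMem hzB, Finset.card_sdiff_of_subset hAK]
  have hBK : insert z (K \ A) ⊆ K := by
    intro x hx
    rcases Finset.mem_insert.1 hx with rfl | hx
    exacts [hAK hz, (Finset.mem_sdiff.1 hx).1]
  have hAle := Finset.card_le_card hAK
  have hKle := Finset.card_le_card hKS
  have hsplit := degSum_separation hAK hz hsep
  have hEA := degSum_le (G := G) (S := A)
  have hEB := degSum_le (G := G) (S := insert z (K \ A))
  have hEB' := degSum_le_of_no_long_cycle (G := G) (S := insert z (K \ A)) (r := m + 2) (by omega)
    ⟨z, by simp⟩ (fun l hl h => hnoK l hl (h.mono hBK))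
  have hAcomp := adj_of_degSum_eq (G := G) (S := A)
  have hBcomp := adj_of_degSum_eq (G := G) (S := insert z (K \ A))
  obtain ⟨a, ha⟩ : ∃ a, A.card = a + 1 := ⟨A.card - 1, by omega⟩
  obtain ⟨b, hb⟩ : ∃ b, K.card = a + 1 + b := ⟨K.card - A.card, by omega⟩
  obtain ⟨e, he⟩ : ∃ e, S.card = a + 1 + b + e := ⟨S.card - K.card, by omega⟩
  have hBc' : (insert z (K \ A)).card = b + 1 := by omega
  rw [ha] at hEA hA1 hA2 hAcomp
  rw [hBc'] at hEB hEB' hBcomp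
  rw [show S.card - K.card = e by omega] at hle
  simp only [Nat.add_sub_cancel, show m + 2 - 1 = m + 1 by omega] at hEA hEB hEB' hAcomp hBcomp
  have hte : 2 * t * e ≤ (m + 1) * e := Nat.mul_le_mul_right _ ht
  have hfin : K = S → (a + 1) * a ≤ degSum G A → (b + 1) * b ≤ degSum G (insert z (K \ A)) →
      (a = m ∨ a + 1 = m) → IsTwoCliquesOn G S := by
    intro hK h1 h2 h3
    subst hK
    exact isTwoCliquesOn_of_blocks hAK hz hsep (hAcomp h1) (hBcomp h2) (by omega)
  -- For a small end block the other side is bounded by Erdős–Gallai; for orders `m` and `m + 1` the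
  -- trivial clique bound is used instead, and its tightness yields the cliques.
  rcases lt_trichotomy (a + 1) m with h | h | h
  · exfalso
    exact block_bound_lt (by omega) h (by omega)
      (show 2 * m ^ 2 ≤ (a + 1) * a + (m + 1) * b + (m + 1) * e by linarith)
  · have hbe : a + 1 = b + e := by omega
    have hb3 : 3 ≤ b := by omega
    have he0 : e = 0 := by
      refine block_bound_eq_of_succ (b := b) (m := m) (by omega) (by omega) ?_
      have : (a + 1) * a + m = m * m := by rw [← h]; ring
      linarith
    subst he0
    have hK : K = S := Finset.eq_of_subset_of_card_le hKS (by omega)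
    obtain rfl : b = a + 1 := by omega
    subst h
    refine hfin hK ?_ ?_ (Or.inr rfl) <;> linarith
  · have ham : a = m := by omega
    have hbe : a = b + 1 + e := by omega
    have hb2 : 2 ≤ b := by omega
    have he0 : e = 0 := by
      refine block_bound_eq (b := b) (m := m) hb2 (by omega) ?_
      rw [ham] at hEA
      linarith
    subst he0
    have hK : K = S := Finset.eq_of_subset_of_card_le hKS (by omega)
    subst ham
    subst hbe
    refine hfin hK ?_ ?_ (Or.inl rfl) <;> linarith

theorem isTwoCliquesOn_of_no_long_cycle [Finite V] {m : ℕ} (hm : 4 ≤ m) (hS : S.card = 2 * m)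
    (hge : 2 * m ^ 2 ≤ degSum G S) (hno : ∀ l, m + 2 ≤ l → ¬ CycleIn G S l) :
    IsTwoCliquesOn G S := by
  have ht : 2 * ((m + 1) / 2) ≤ m + 1 := by omega
  have ht' : m ≤ 2 * ((m + 1) / 2) := by omega
  generalize (m + 1) / 2 = t at ht ht'
  rcases exists_core_or_degSum_le (t := t) (r := m + 2) (by omega) (m - 2) (by omega)
    (hno _ le_rfl) with ⟨K, hKS, hK1, hK2, hK3⟩ | ⟨i, hi1, hi2, hi3, -⟩
  · exact isTwoCliquesOn_of_core ht ht' (by omega) hS hge hno hKS hK1 hK2 hK3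
  exfalso
  obtain ⟨n, rfl⟩ : ∃ n, m = n + 3 := ⟨m - 3, by omega⟩
  -- The first restored vertex is counted apart from the others: for `i = 1` it contributes at most
  -- 2 rather than `t`, and the estimate needs this saving.
  rw [show n + 3 - 2 = n + 1 by omega, Finset.sum_range_succ'] at hi3
  have hsum : ∑ k ∈ Finset.range n, min t (i + (k + 1) + 1) ≤ n * t := by
    have := Finset.sum_le_card_nsmul (Finset.range n) (fun k => min t (i + (k + 1) + 1)) t
      (fun _ _ => min_le_left _ _)
    simpa using this
  have hnt : 2 * (n * t) ≤ n * (n + 4) := by nlinarith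
  by_cases h1 : i = 1
  · subst h1
    have : min t (1 + 0 + 1) ≤ 2 := min_le_right _ _
    simp only [show n + 3 + 2 - 1 = n + 4 by omega, show n + 4 - 1 = n + 3 by omega] at hi3
    nlinarith
  · have : min t (i + 0 + 1) ≤ t := min_le_left _ _
    obtain ⟨j, rfl⟩ : ∃ j, i = j + 2 := ⟨i - 2, by omega⟩
    obtain ⟨d, rfl⟩ : ∃ d, n = j + d := ⟨n - j, by omega⟩
    simp only [show j + d + 3 + 2 - (j + 2) = d + 3 by omega,
      show d + 3 - 1 = d + 2 by omega] at hi3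
    have hjd : j ≤ d + 1 := by omega
    nlinarith

end Circumference

/-! ### Orders four and six -/

section SmallOrders

variable {V : Type*} {G : SimpleGraph V} {S : Finset V}

/-- The vertices of `S` span the join of an edge and four independent vertices. -/
def IsBookOn (G : SimpleGraph V) (S : Finset V) : Prop :=
  S.card = 6 ∧ ∃ a ∈ S, ∃ b ∈ S, a ≠ b ∧
    ∀ u ∈ S, ∀ v ∈ S, u ≠ v → (G.Adj u v ↔ u = a ∨ u = b ∨ v = a ∨ v = b)

theorem cycleIn_five {a b c d e : V} (hmem : ∀ x ∈ [a, b, c, d, e], x ∈ S)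
    (hnd : [a, b, c, d, e].Nodup) (hab : G.Adj a b) (hbc : G.Adj b c) (hcd : G.Adj c d)
    (hde : G.Adj d e) (hea : G.Adj e a) : CycleIn G S 5 :=
  ⟨[a, b, c, d, e], ⟨hnd, by simp [*], hmem, by simpa using hea, by simp⟩, rfl⟩

theorem exists_two_nbrs {v : V} (h : 2 ≤ degIn G S v) :
    ∃ x ∈ S, ∃ y ∈ S, x ≠ y ∧ G.Adj v x ∧ G.Adj v y := by
  classical
  obtain ⟨x, hx, y, hy, hxy⟩ := Finset.one_lt_card.1 (show 1 < _ from h)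
  simp only [Finset.mem_filter] at hx hy
  exact ⟨x, hx.1, y, hy.1, hxy, hx.2, hy.2⟩

theorem two_le_degIn {v x y : V} (hx : x ∈ S) (hy : y ∈ S) (hxy : x ≠ y) (hvx : G.Adj v x)
    (hvy : G.Adj v y) : 2 ≤ degIn G S v := by
  classical
  exact Finset.one_lt_card.2 ⟨x, by simp [*], y, by simp [*], hxy⟩

/-- Pósa's theorem gives a vertex of degree at most one; the edge count then makes the other three a
triangle and the vertex pendant to it. -/
theorem isTwoCliquesOn_of_card_four [Finite V] (hS : S.card = 4) (hge : 8 ≤ degSum G S)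
    (hno : ¬ CycleIn G S 4) : IsTwoCliquesOn G S := by
  classical
  obtain ⟨i, hi1, hi2, L, hLS, hLc, hL⟩ := exists_low_degrees_of_not_hamiltonian (G := G) (S := S)
    (by omega) (by rwa [hS])
  obtain rfl : i = 1 := by omega
  obtain ⟨x, rfl⟩ := Finset.card_eq_one.1 hLc
  have hxS : x ∈ S := hLS (by simp)
  have hx1 := hL x (by simp)
  have hdeg := degSum_eq_erase (G := G) hxS
  have hTc : (S.erase x).card = 3 := by rw [Finset.card_erase_of_mem hxS, hS]
  have hT := degSum_le (G := G) (S := S.erase x)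
  rw [hTc] at hT
  obtain ⟨z, hzS, hxz⟩ := degIn_pos_iff.1 (show 0 < degIn G S x by omega)
  have hT' := adj_of_degSum_eq (G := G) (S := S.erase x) (by rw [hTc]; omega)
  have hz : z ∈ S.erase x := by simp [hzS, hxz.ne']
  refine isTwoCliquesOn_of_blocks (Finset.erase_subset x S) hz ?_ hT' ?_ (Or.inl (by omega))
  · intro a ha haz w hw haw
    rw [Finset.mem_erase]
    refine ⟨?_, hw⟩
    rintro rfl
    have := two_le_degIn (Finset.mem_of_mem_erase ha) hzS haz haw.symm hxz
    omega
  · have hB : S \ S.erase x = {x} := by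
      rw [Finset.sdiff_erase hxS, Finset.sdiff_self]; rfl
    rw [hB]
    intro u hu w hw huw
    simp only [Finset.mem_insert, Finset.mem_singleton] at hu hw
    rcases hu with rfl | rfl <;> rcases hw with rfl | rfl
    exacts [absurd rfl huw, hxz.symm, hxz, absurd rfl huw]

/-- A vertex of degree at least two attached to `K_2 ∨ 3 K_1` gives a five-cycle or
`K_2 ∨ 4 K_1`. -/
theorem isBookOn_of_insert [DecidableEq V] {I : Finset V} {p q v : V}
    (hS : S = insert v (insert p (insert q I))) (hI : I.card = 3) (hpq : G.Adj p q)
    (hp : p ∉ I) (hq : q ∉ I) (hv : v ∉ insert p (insert q I)) (hIp : ∀ s ∈ I, G.Adj s p)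
    (hIq : ∀ s ∈ I, G.Adj s q) (hII : ∀ s ∈ I, ∀ s' ∈ I, ¬ G.Adj s s')
    (hd : 2 ≤ degIn G S v) (hno : ¬ CycleIn G S 5) : IsBookOn G S := by
  have hvp : v ≠ p := by rintro rfl; simp at hv
  have hvq : v ≠ q := by rintro rfl; simp at hv
  have hvI : v ∉ I := fun h => hv (by simp [h])
  have hnp : ∀ s ∈ I, s ≠ p := fun s hs h => hp (h ▸ hs)
  have hnq : ∀ s ∈ I, s ≠ q := fun s hs h => hq (h ▸ hs)
  have hnv : ∀ s ∈ I, s ≠ v := fun s hs h => hvI (h ▸ hs)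
  have other : ∀ s ∈ I, ∃ s' ∈ I, s' ≠ s := by
    intro s hs
    exact Finset.exists_mem_ne (by omega) s
  have c1 : ∀ s ∈ I, ∀ s' ∈ I, s ≠ s' → G.Adj v s → ¬ G.Adj v s' := by
    intro s hs s' hs' hne h h'
    refine hno (cycleIn_five (a := v) (b := s) (c := p) (d := q) (e := s') ?_ ?_ h (hIp s hs) hpq
      (hIq s' hs').symm h'.symm)
    · simp [hS, hs, hs']
    · simp [hne, hvp, hvq, (hnv s hs).symm, (hnv s' hs').symm, hnp s hs, hnq s hs, hpq.ne,
        (hnp s' hs').symm, (hnq s' hs').symm]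
  have c2 : ∀ s ∈ I, G.Adj v s → ¬ G.Adj v p := by
    intro s hs h h'
    obtain ⟨s', hs', hne⟩ := other s hs
    refine hno (cycleIn_five (a := v) (b := s) (c := q) (d := s') (e := p) ?_ ?_ h (hIq s hs)
      (hIq s' hs').symm (hIp s' hs') h'.symm)
    · simp [hS, hs, hs']
    · simp [hne.symm, hvp, hvq, (hnv s hs).symm, (hnv s' hs').symm, hnp s hs, hnq s hs, hpq.ne',
        hnp s' hs', (hnq s' hs').symm]
  have c3 : ∀ s ∈ I, G.Adj v s → ¬ G.Adj v q := by
    intro s hs h h'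
    obtain ⟨s', hs', hne⟩ := other s hs
    refine hno (cycleIn_five (a := v) (b := s) (c := p) (d := s') (e := q) ?_ ?_ h (hIp s hs)
      (hIp s' hs').symm (hIq s' hs') h'.symm)
    · simp [hS, hs, hs']
    · simp [hne.symm, hvp, hvq, (hnv s hs).symm, (hnv s' hs').symm, hnp s hs, hnq s hs, hpq.ne,
        (hnp s' hs').symm, hnq s' hs']
  have hvpq : G.Adj v p ∧ G.Adj v q := by
    obtain ⟨x, hx, y, hy, hxy, hvx, hvy⟩ := exists_two_nbrs hd
    simp only [hS, Finset.mem_insert] at hx hy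
    rcases hx with rfl | rfl | rfl | hx
    · exact absurd hvx (G.loopless.irrefl _)
    · rcases hy with rfl | rfl | rfl | hy
      · exact absurd hvy (G.loopless.irrefl _)
      · exact absurd rfl hxy
      · exact ⟨hvx, hvy⟩
      · exact absurd hvx (c2 y hy hvy)
    · rcases hy with rfl | rfl | rfl | hy
      · exact absurd hvy (G.loopless.irrefl _)
      · exact ⟨hvy, hvx⟩
      · exact absurd rfl hxy
      · exact absurd hvx (c3 y hy hvy)
    · rcases hy with rfl | rfl | rfl | hy
      · exact absurd hvy (G.loopless.irrefl _)
      · exact absurd hvy (c2 x hx hvx)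
      · exact absurd hvy (c3 x hx hvx)
      · exact absurd hvy (c1 x hx y hy hxy hvx)
  have hvs : ∀ s ∈ I, ¬ G.Adj v s := fun s hs h => c2 s hs h hvpq.1
  refine ⟨?_, p, by simp [hS], q, by simp [hS], hpq.ne, ?_⟩
  · rw [hS, Finset.card_insert_of_notMem hv, Finset.card_insert_of_notMem (by simp [hp, hpq.ne]),
      Finset.card_insert_of_notMem hq, hI]
  · have hcase : ∀ u ∈ S, u = p ∨ u = q ∨ (u ≠ p ∧ u ≠ q ∧ G.Adj u p ∧ G.Adj u q ∧
        (u = v ∨ u ∈ I)) := by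
      intro u hu
      rw [hS] at hu
      simp only [Finset.mem_insert] at hu
      rcases hu with rfl | rfl | rfl | hu
      · exact Or.inr (Or.inr ⟨hvp, hvq, hvpq.1, hvpq.2, Or.inl rfl⟩)
      · exact Or.inl rfl
      · exact Or.inr (Or.inl rfl)
      · exact Or.inr (Or.inr ⟨hnp u hu, hnq u hu, hIp u hu, hIq u hu, Or.inr hu⟩)
    intro u hu w hw huw
    rcases hcase u hu with rfl | rfl | ⟨u1, u2, u3, u4, u5⟩
    · rcases hcase w hw with rfl | rfl | ⟨w1, w2, w3, w4, w5⟩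
      · exact absurd rfl huw
      · simp [hpq]
      · simp [w3.symm]
    · rcases hcase w hw with rfl | rfl | ⟨w1, w2, w3, w4, w5⟩
      · simp [hpq.symm]
      · exact absurd rfl huw
      · simp [w4.symm]
    · rcases hcase w hw with rfl | rfl | ⟨w1, w2, w3, w4, w5⟩
      · simp [u3]
      · simp [u4]
      · simp only [u1, u2, w1, w2, or_self, iff_false]
        rcases u5 with rfl | u5 <;> rcases w5 with rfl | w5
        · exact absurd rfl huw
        · exact hvs w w5
        · exact fun h => hvs u u5 h.symm
        · exact hII u u5 w w5

/-- Without `v` the graph is a K₄ with a pendant vertex `x` at `z`. Two neighbours of `v` in the K₄,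
or `x` together with one other than `z`, would close a 5-cycle, so `v` completes the triangle on `x`
and `z`. -/
theorem isTwoCliquesOn_of_pendant [DecidableEq V] {v x : V} (hS : S.card = 6) (hv : v ∈ S)
    (hx : x ∈ S.erase v) (hd : 2 ≤ degIn G S v) (hxd : degIn G (S.erase v) x = 1)
    (hT : ∀ a ∈ (S.erase v).erase x, ∀ b ∈ (S.erase v).erase x, a ≠ b → G.Adj a b)
    (hno : ¬ CycleIn G S 5) : IsTwoCliquesOn G S := by
  set T := (S.erase v).erase x with hTdef
  have hTS : T ⊆ S := (Finset.erase_subset _ _).trans (Finset.erase_subset _ _)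
  have hTc : T.card = 4 := by
    rw [hTdef, Finset.card_erase_of_mem hx, Finset.card_erase_of_mem hv, hS]
  have hvT : v ∉ T := by simp [hTdef]
  have hxT : x ∉ T := by simp [hTdef]
  have hxv : x ≠ v := (Finset.mem_erase.1 hx).1
  have hxS : x ∈ S := (Finset.mem_erase.1 hx).2
  have hcase : ∀ w ∈ S, w = v ∨ w = x ∨ w ∈ T := by
    intro w hw
    simp only [hTdef, Finset.mem_erase]
    tauto
  rw [← degIn_erase_self, ← hTdef] at hxd
  obtain ⟨z, hz, hxz⟩ := degIn_pos_iff.1 (show 0 < degIn G T x by omega)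
  have hxu : ∀ w ∈ T, G.Adj x w → w = z := by
    intro w hw hxw
    by_contra hne
    have := two_le_degIn hw hz hne hxw hxz
    omega
  have c1 : ∀ a ∈ T, ∀ b ∈ T, a ≠ b → G.Adj v a → ¬ G.Adj v b := by
    intro a ha b hb hab hva hvb
    obtain ⟨P, hP, hl⟩ := exists_isPathList_of_complete hT ha hb hab (j := 4) (by omega) (by omega)
    have h := (isPathList_singleton (G := G) hv).append (hP.mono fun y hy => hTS (hP.mem y hy)) hva
      (by
        intro y hy hy'
        rw [List.mem_singleton] at hy
        subst hy
        exact hvT (hP.mem y hy'))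
    have h' := h.cycleIn hvb.symm (by simp [hl])
    rw [List.length_append, hl] at h'
    exact hno h'
  have c2 : G.Adj v x → ∀ b ∈ T, b ≠ z → ¬ G.Adj v b := by
    intro hvx b hb hbz hvb
    obtain ⟨P, hP, hl⟩ := exists_isPathList_of_complete hT hz hb hbz.symm (j := 3) (by omega)
      (by omega)
    have h := (isPathList_singleton (G := G) hxS).append
      (hP.mono fun y hy => hTS (hP.mem y hy)) hxz
      (by
        intro y hy hy'
        rw [List.mem_singleton] at hy
        subst hy
        exact hxT (hP.mem y hy'))
    have h2 := h.append (isPathList_singleton hv) hvb.symm (by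
      intro y hy hy'
      rw [List.mem_singleton] at hy'
      subst hy'
      rcases List.mem_append.1 hy with hy | hy
      · exact hxv (List.mem_singleton.1 hy).symm
      · exact hvT (hP.mem y hy))
    have h' := h2.cycleIn hvx (by simp [hl])
    rw [List.length_append, List.length_append, hl] at h'
    exact hno h'
  have hv2 : G.Adj v x ∧ G.Adj v z := by
    obtain ⟨a, ha, b, hb, hab, hva, hvb⟩ := exists_two_nbrs hd
    rcases hcase a ha with rfl | rfl | ha
    · exact absurd hva (G.loopless.irrefl _)
    · rcases hcase b hb with rfl | rfl | hb
      · exact absurd hvb (G.loopless.irrefl _)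
      · exact absurd rfl hab
      · by_cases hbz : b = z
        · exact ⟨hva, hbz ▸ hvb⟩
        · exact absurd hvb (c2 hva b hb hbz)
    · rcases hcase b hb with rfl | rfl | hb
      · exact absurd hvb (G.loopless.irrefl _)
      · by_cases haz : a = z
        · exact ⟨hvb, haz ▸ hva⟩
        · exact absurd hva (c2 hvb a ha haz)
      · exact absurd hvb (c1 a ha b hb hab hva)
  refine isTwoCliquesOn_of_blocks hTS hz ?_ hT ?_ (Or.inl (by omega))
  · intro a ha haz w hw haw
    rcases hcase w hw with rfl | rfl | hw
    · exact absurd haw.symm (c2 hv2.1 a ha haz)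
    · exact absurd (hxu a ha haw.symm) haz
    · exact hw
  · have hB : ∀ u ∈ insert z (S \ T), u = z ∨ u = x ∨ u = v := by
      intro u hu
      rw [Finset.mem_insert, Finset.mem_sdiff] at hu
      rcases hu with rfl | ⟨hu, huT⟩
      · exact Or.inl rfl
      · have := hcase u hu
        tauto
    intro u hu w hw huw
    rcases hB u hu with rfl | rfl | rfl <;> rcases hB w hw with rfl | rfl | rfl
    exacts [absurd rfl huw, hxz.symm, hv2.2.symm, hxz, absurd rfl huw, hv2.1.symm, hv2.2, hv2.1,
      absurd rfl huw]

/-- The count is tight: removing `v`, `x`, `y` leaves a triangle, and `x`, `y` are nonadjacent with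
two neighbours each in it. Different neighbour pairs would give a 5-cycle, so without `v` the graph
is K₂ ∨ 3K₁. -/
theorem isBookOn_of_two_low [DecidableEq V] {v x y : V} (hS : S.card = 6) (hv : v ∈ S)
    (hx : x ∈ S.erase v) (hy : y ∈ (S.erase v).erase x) (hd : 2 ≤ degIn G S v)
    (hxd : degIn G (S.erase v) x ≤ 2) (hyd : degIn G (S.erase v) y ≤ 2)
    (hge : 14 ≤ degSum G (S.erase v)) (hno : ¬ CycleIn G S 5) : IsBookOn G S := by
  set H := S.erase v with hHdef
  have hHc : H.card = 5 := by rw [hHdef, Finset.card_erase_of_mem hv, hS]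
  set T := (H.erase x).erase y with hTdef
  have hTc : T.card = 3 := by
    rw [hTdef, Finset.card_erase_of_mem hy, Finset.card_erase_of_mem hx, hHc]
  have hyH : y ∈ H := Finset.mem_of_mem_erase hy
  have hxy : x ≠ y := (Finset.mem_erase.1 hy).1.symm
  have hT := degSum_le (G := G) (S := T)
  have e1 := degSum_eq_erase (G := G) hx
  have e2 := degSum_eq_erase (G := G) hy
  rw [← hTdef] at e2
  rw [hTc] at hT
  have hyx := degIn_mono (G := G) (Finset.erase_subset x H) y
  have hTcomp := adj_of_degSum_eq (G := G) (S := T) (by rw [hTc]; omega)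
  have hyT : degIn G T y = 2 := by
    rw [hTdef, degIn_erase_self]; omega
  have hnxy : ¬ G.Adj x y := by
    intro hadj
    have : degIn G H y = degIn G (H.erase x) y + 1 := by
      conv_lhs => rw [← Finset.insert_erase hx, degIn_insert (by simp), if_pos hadj.symm]
    omega
  have hxT : degIn G T x = 2 := by
    have h1 : degIn G T x = degIn G H x := by
      refine degIn_congr fun w hw => ?_
      simp only [hTdef, Finset.mem_erase]
      have : w ≠ y := by rintro rfl; exact hnxy hw
      have := hw.ne'
      tauto
    rw [h1]; omega
  have hvH : v ∉ H := by simp [hHdef]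
  have hHS : H ⊆ S := Finset.erase_subset _ _
  have hTH : T ⊆ H := (Finset.erase_subset _ _).trans (Finset.erase_subset _ _)
  have hxT' : x ∉ T := by simp [hTdef]
  have hyT' : y ∉ T := by simp [hTdef]
  obtain ⟨p, hp, q, hq, hpq, hxp, hxq⟩ := exists_two_nbrs hxT.ge
  obtain ⟨c, hc⟩ : ∃ c, (T.erase p).erase q = {c} := by
    rw [← Finset.card_eq_one, Finset.card_erase_of_mem (by simp [hq, hpq.symm]),
      Finset.card_erase_of_mem hp, hTc]
  have hcm : c ∈ (T.erase p).erase q := by rw [hc]; simp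
  simp only [Finset.mem_erase] at hcm
  obtain ⟨hcq, hcp, hcT⟩ := hcm
  have hTcase : ∀ w ∈ T, w = p ∨ w = q ∨ w = c := by
    intro w hw
    by_contra hcon
    push Not at hcon
    have : w ∈ (T.erase p).erase q := by simp [hw, hcon]
    rw [hc, Finset.mem_singleton] at this
    exact hcon.2.2 this
  have hne : ∀ w ∈ T, w ≠ x ∧ w ≠ y := fun w hw =>
    ⟨fun h => hxT' (h ▸ hw), fun h => hyT' (h ▸ hw)⟩
  have hxc : ¬ G.Adj x c := by
    intro hxc
    have := (degIn_eq_card_iff (G := G) (S := T) (v := x)).2 (by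
      intro w hw
      rcases hTcase w hw with rfl | rfl | rfl
      exacts [hxp, hxq, hxc])
    omega
  have hyc : ¬ G.Adj y c := by
    intro hyc
    obtain ⟨a, ha, b, hb, hab, hya, hyb⟩ := exists_two_nbrs hyT.ge
    -- If `y` sees `c`, its other neighbour in the triangle is `s`, one of `p`, `q`. With `s'` the
    -- other one, x, s', c, y, s is a 5-cycle.
    obtain ⟨s, hs, hys, s', hs', hss', hss⟩ : ∃ s, (s = p ∨ s = q) ∧ G.Adj y s ∧ ∃ s',
        (s' = p ∨ s' = q) ∧ s ≠ s' ∧ s' ≠ s := by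
      rcases hTcase a ha with rfl | rfl | rfl
      · exact ⟨a, Or.inl rfl, hya, q, Or.inr rfl, hpq, hpq.symm⟩
      · exact ⟨a, Or.inr rfl, hya, p, Or.inl rfl, hpq.symm, hpq⟩
      · rcases hTcase b hb with rfl | rfl | rfl
        · exact ⟨b, Or.inl rfl, hyb, q, Or.inr rfl, hpq, hpq.symm⟩
        · exact ⟨b, Or.inr rfl, hyb, p, Or.inl rfl, hpq.symm, hpq⟩
        · exact absurd rfl hab
    have hsT : s ∈ T := by rcases hs with rfl | rfl <;> assumption
    have hsT' : s' ∈ T := by rcases hs' with rfl | rfl <;> assumption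
    have hxs : G.Adj x s := by rcases hs with rfl | rfl <;> assumption
    have hxs' : G.Adj x s' := by rcases hs' with rfl | rfl <;> assumption
    have hcs : c ≠ s := by rcases hs with rfl | rfl <;> assumption
    have hcs' : c ≠ s' := by rcases hs' with rfl | rfl <;> assumption
    refine hno (cycleIn_five (a := x) (b := s') (c := c) (d := y) (e := s) ?_ ?_ hxs'
      (hTcomp s' hsT' c hcT hcs'.symm) hyc.symm hys hxs.symm)
    · simp [hHS hx, hHS hyH, hHS (hTH hsT), hHS (hTH hsT'), hHS (hTH hcT)]
    · simp [hxs.ne, hxs'.ne, (hne c hcT).1.symm, (hne c hcT).2, hxy, hcs'.symm, hcs, hss,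
        (hne s' hsT').2, hys.ne]
  have hypq : G.Adj y p ∧ G.Adj y q := by
    obtain ⟨a, ha, b, hb, hab, hya, hyb⟩ := exists_two_nbrs hyT.ge
    rcases hTcase a ha with rfl | rfl | rfl <;> rcases hTcase b hb with rfl | rfl | rfl
    all_goals first | exact ⟨hya, hyb⟩ | exact ⟨hyb, hya⟩ | exact absurd rfl hab |
      exact absurd hya hyc | exact absurd hyb hyc
  have hp' := hne p hp
  have hq' := hne q hq
  have hc' := hne c hcT
  refine isBookOn_of_insert (I := {x, y, c}) (p := p) (q := q) (v := v) ?_ ?_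
    (hTcomp p hp q hq hpq) ?_ ?_ ?_ ?_ ?_ ?_ hd hno
  · rw [← Finset.insert_erase hv, ← hHdef]
    congr 1
    ext w
    simp only [Finset.mem_insert, Finset.mem_singleton]
    constructor
    · intro hw
      by_cases hwT : w ∈ T
      · have := hTcase w hwT
        tauto
      · simp only [hTdef, Finset.mem_erase] at hwT
        tauto
    · rintro (rfl | rfl | rfl | rfl | rfl)
      exacts [hTH hp, hTH hq, hx, hyH, hTH hcT]
  · rw [Finset.card_insert_of_notMem (by simp [hxy, hc'.1.symm]),
      Finset.card_insert_of_notMem (by simp [hc'.2.symm]), Finset.card_singleton]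
  · simp [hp'.1, hp'.2, hcp.symm]
  · simp [hq'.1, hq'.2, hcq.symm]
  · have h := fun w (hw : w ∈ H) => (show v ≠ w from fun h => hvH (h ▸ hw))
    simp [h p (hTH hp), h q (hTH hq), h x hx, h y hyH, h c (hTH hcT)]
  · simp [hxp, hypq.1, hTcomp c hcT p hp hcp]
  · simp [hxq, hypq.2, hTcomp c hcT q hq hcq]
  · have h1 : ¬ G.Adj c x := fun h => hxc h.symm
    have h2 : ¬ G.Adj c y := fun h => hyc h.symm
    have h3 : ¬ G.Adj y x := fun h => hnxy h.symm
    simp [hxc, hyc, hnxy, h1, h2, h3]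

theorem exceptional_of_card_six [Finite V] (hS : S.card = 6) (hge : 18 ≤ degSum G S)
    (hno : ∀ l, 5 ≤ l → ¬ CycleIn G S l) : IsTwoCliquesOn G S ∨ IsBookOn G S := by
  classical
  by_cases hcore : ∀ v ∈ S, 3 ≤ degIn G S v
  · exact Or.inl (isTwoCliquesOn_of_core (m := 3) (t := 2) (by omega) (by omega) (by omega)
      (by omega) (by omega) hno subset_rfl (by omega) hcore (by omega))
  push Not at hcore
  obtain ⟨v, hv, hvd⟩ := hcore
  have hHc : (S.erase v).card = 5 := by rw [Finset.card_erase_of_mem hv, hS]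
  have hdeg := degSum_eq_erase (G := G) hv
  obtain ⟨i, hi1, hi2, L, hLS, hLc, hL⟩ := exists_low_degrees_of_not_hamiltonian (G := G)
    (S := S.erase v) (by omega) (by
      rw [hHc]; exact fun h => hno 5 le_rfl (h.mono (Finset.erase_subset _ _)))
  have hno5 := hno 5 le_rfl
  obtain rfl | rfl : i = 1 ∨ i = 2 := by omega
  · left
    obtain ⟨x, rfl⟩ := Finset.card_eq_one.1 hLc
    have hx : x ∈ S.erase v := hLS (by simp)
    have hxd := hL x (by simp)
    have hdx := degSum_eq_erase (G := G) hx
    have hTc : ((S.erase v).erase x).card = 4 := by rw [Finset.card_erase_of_mem hx, hHc]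
    have hT := degSum_le (G := G) (S := (S.erase v).erase x)
    rw [hTc] at hT
    exact isTwoCliquesOn_of_pendant hS hv hx (by omega) (by omega)
      (adj_of_degSum_eq (by rw [hTc]; omega)) hno5
  · right
    obtain ⟨x, y, hxy, rfl⟩ := Finset.card_eq_two.1 hLc
    have hx : x ∈ S.erase v := hLS (by simp)
    have hy : y ∈ (S.erase v).erase x := Finset.mem_erase.2 ⟨hxy.symm, hLS (by simp)⟩
    have hxd := hL x (by simp)
    have hyd := hL y (by simp)
    have hdx := degSum_eq_erase (G := G) hx
    have hdy := degSum_eq_erase (G := G) hy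
    have hyx := degIn_mono (G := G) (Finset.erase_subset x (S.erase v)) y
    have hTc : (((S.erase v).erase x).erase y).card = 3 := by
      rw [Finset.card_erase_of_mem hy, Finset.card_erase_of_mem hx, hHc]
    have hT := degSum_le (G := G) (S := ((S.erase v).erase x).erase y)
    rw [hTc] at hT
    exact isBookOn_of_two_low hS hv hx hy (by omega) hxd hyd (by omega) hno5

end SmallOrders

/-! ### Edge counts of the exceptions and the two parities -/

section AllOrders

variable {V : Type*} {G : SimpleGraph V} {S : Finset V}

theorem degSum_of_complete (h : ∀ v ∈ S, ∀ w ∈ S, v ≠ w → G.Adj v w) :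
    degSum G S = S.card * (S.card - 1) := by
  classical
  refine le_antisymm degSum_le ?_
  unfold degSum
  rw [← smul_eq_mul]
  refine Finset.card_nsmul_le_sum _ _ _ fun v hv => ?_
  rw [← degIn_erase_self, ← Finset.card_erase_of_mem hv]
  refine (degIn_eq_card_iff.2 fun w hw => ?_).ge
  rw [Finset.mem_erase] at hw
  exact h v hv w hw.2 hw.1.symm

theorem IsBalancedBipartiteOn.degSum_eq (h : IsBalancedBipartiteOn G S) :
    degSum G S = 2 * (S.card ^ 2 / 4) := by
  classical
  obtain ⟨A, hAS, hAc, hadj⟩ := h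
  have hBc := Finset.card_sdiff_of_subset hAS
  have h1 : ∀ v ∈ A, degIn G S v = (S \ A).card := by
    intro v hv
    rw [← degIn_eq_card_iff.2 (show ∀ w ∈ S \ A, G.Adj v w from fun w hw => by
      rw [Finset.mem_sdiff] at hw
      rw [hadj v (hAS hv) w hw.1]; tauto)]
    refine degIn_congr fun w hw => ?_
    rw [Finset.mem_sdiff]
    refine ⟨fun hwS => ⟨hwS, fun hwA => ?_⟩, fun h => h.1⟩
    exact (hadj v (hAS hv) w hwS).1 hw (by tauto)
  have h2 : ∀ v ∈ S \ A, degIn G S v = A.card := by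
    intro v hv
    rw [Finset.mem_sdiff] at hv
    rw [← degIn_eq_card_iff.2 (show ∀ w ∈ A, G.Adj v w from fun w hw => by
      rw [hadj v hv.1 w (hAS hw)]; tauto)]
    refine degIn_congr fun w hw => ⟨fun hwS => ?_, fun h => hAS h⟩
    by_contra hwA
    exact (hadj v hv.1 w hwS).1 hw (by tauto)
  have h3 : degSum G S = 2 * (A.card * (S \ A).card) := by
    unfold degSum
    rw [← Finset.sum_sdiff hAS, Finset.sum_congr rfl h1, Finset.sum_congr rfl h2,
      Finset.sum_const, Finset.sum_const, smul_eq_mul, smul_eq_mul]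
    ring
  rw [h3, hBc, hAc]
  congr 1
  generalize S.card = n
  obtain ⟨k, rfl | rfl⟩ := Nat.even_or_odd' n
  · rw [show (2 * k + 1) / 2 = k by omega, show 2 * k - k = k by omega,
      show (2 * k) ^ 2 = k * k * 4 by ring, Nat.mul_div_cancel _ (by norm_num)]
  · rw [show (2 * k + 1 + 1) / 2 = k + 1 by omega, show 2 * k + 1 - (k + 1) = k by omega,
      show (2 * k + 1) ^ 2 = 1 + 4 * ((k + 1) * k) by ring,
      Nat.add_mul_div_left _ _ (by norm_num)]
    omega

/-- The two cliques as blocks. -/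
theorem IsTwoCliquesOn.exists_blocks [DecidableEq V] (h : IsTwoCliquesOn G S) :
    ∃ A ⊆ S, ∃ z ∈ A, A.card = S.card / 2 + 1 ∧ (insert z (S \ A)).card = (S.card + 1) / 2 ∧
      (∀ a ∈ A, a ≠ z → ∀ w ∈ S, G.Adj a w → w ∈ A) ∧
      (∀ v ∈ A, ∀ w ∈ A, v ≠ w → G.Adj v w) ∧
      (∀ v ∈ insert z (S \ A), ∀ w ∈ insert z (S \ A), v ≠ w → G.Adj v w) := by
  obtain ⟨z, hz, A, hAS, hzA, hAc, hadj⟩ := h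
  have hsub : insert z A ⊆ S := Finset.insert_subset hz hAS
  have hc : (insert z A).card = S.card / 2 + 1 := by
    rw [Finset.card_insert_of_notMem hzA, hAc]
  have hle := Finset.card_le_card hsub
  refine ⟨insert z A, hsub, z, by simp, hc, ?_, ?_, ?_, ?_⟩
  · rw [Finset.card_insert_of_notMem (by simp), Finset.card_sdiff_of_subset hsub, hc]
    omega
  · intro a ha haz w hw haw
    have := (hadj a (hsub ha) w hw haw.ne).1 haw
    rw [Finset.mem_insert] at ha ⊢
    tauto
  · intro v hv w hw hvw
    rw [hadj v (hsub hv) w (hsub hw) hvw]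
    rw [Finset.mem_insert] at hv hw
    tauto
  · intro v hv w hw hvw
    simp only [Finset.mem_insert, Finset.mem_sdiff] at hv hw
    have hvS : v ∈ S := by
      rcases hv with rfl | hv
      exacts [hz, hv.1]
    have hwS : w ∈ S := by
      rcases hw with rfl | hw
      exacts [hz, hw.1]
    rw [hadj v hvS w hwS hvw]
    tauto

theorem IsTwoCliquesOn.degSum_eq (h : IsTwoCliquesOn G S) :
    degSum G S = 2 * (S.card ^ 2 / 4) := by
  classical
  have hpos : 0 < S.card := by
    obtain ⟨z, hz, -⟩ := h
    exact Finset.card_pos.2 ⟨z, hz⟩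
  obtain ⟨A, hAS, z, hz, hAc, hBc, hsep, hA, hB⟩ := h.exists_blocks
  rw [degSum_separation hAS hz hsep, degSum_of_complete hA, degSum_of_complete hB, hAc, hBc]
  generalize S.card = n at hpos ⊢
  obtain ⟨k, rfl | rfl⟩ := Nat.even_or_odd' n
  · obtain ⟨j, rfl⟩ : ∃ j, k = j + 1 := ⟨k - 1, by omega⟩
    rw [show (2 * (j + 1) + 1) / 2 = j + 1 by omega, show 2 * (j + 1) / 2 = j + 1 by omega,
      show (2 * (j + 1)) ^ 2 = (j + 1) * (j + 1) * 4 by ring,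
      Nat.mul_div_cancel _ (by norm_num)]
    simp only [Nat.add_sub_cancel]
    ring
  · rw [show (2 * k + 1 + 1) / 2 = k + 1 by omega, show (2 * k + 1) / 2 = k by omega,
      show (2 * k + 1) ^ 2 = 1 + 4 * ((k + 1) * k) by ring,
      Nat.add_mul_div_left _ _ (by norm_num)]
    simp only [Nat.add_sub_cancel]
    ring

theorem IsBookOn.degSum_eq (h : IsBookOn G S) : degSum G S = 18 := by
  classical
  obtain ⟨hS, a, ha, b, hb, hab, hadj⟩ := h
  have hb' : b ∈ S.erase a := by simp [hb, hab.symm]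
  have c1 : (S.erase a).card = 5 := by rw [Finset.card_erase_of_mem ha, hS]
  have c2 : ((S.erase a).erase b).card = 4 := by rw [Finset.card_erase_of_mem hb', c1]
  have d1 : degIn G S a = 5 := by
    rw [← degIn_erase_self, ← c1]
    refine degIn_eq_card_iff.2 fun w hw => ?_
    rw [Finset.mem_erase] at hw
    rw [hadj a ha w hw.2 hw.1.symm]
    tauto
  have d2 : degIn G (S.erase a) b = 4 := by
    rw [← degIn_erase_self, ← c2]
    refine degIn_eq_card_iff.2 fun w hw => ?_
    simp only [Finset.mem_erase] at hw
    rw [hadj b hb w hw.2.2 hw.1.symm]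
    tauto
  have d3 : degSum G ((S.erase a).erase b) = 0 := by
    unfold degSum
    refine Finset.sum_eq_zero fun v hv => ?_
    by_contra hne
    obtain ⟨w, hw, hvw⟩ := degIn_pos_iff.1 (Nat.pos_of_ne_zero hne)
    simp only [Finset.mem_erase] at hv hw
    have := (hadj v hv.2.2 w hw.2.2 hvw.ne).1 hvw
    tauto
  rw [degSum_eq_erase ha, degSum_eq_erase hb', d1, d2, d3]

theorem isBalancedBipartiteOn_of_card_two (hS : S.card = 2) (hge : 2 ≤ degSum G S) :
    IsBalancedBipartiteOn G S := by
  classical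
  have hc := adj_of_degSum_eq (G := G) (S := S) (by rw [hS]; omega)
  obtain ⟨x, y, hxy, rfl⟩ := Finset.card_eq_two.1 hS
  have h := hc x (by simp) y (by simp) hxy
  refine ⟨{x}, by simp, by rw [hS]; simp, ?_⟩
  simp [h, h.symm, hxy.symm]

theorem even_order_cycles [Finite V] {m : ℕ} (hm : 2 ≤ m) (hS : S.card = 2 * m)
    (hge : 2 * m ^ 2 ≤ degSum G S) :
    (∀ l, 3 ≤ l → l ≤ m + 2 → CycleIn G S l) ∨
      IsBalancedBipartiteOn G S ∨ IsTwoCliquesOn G S ∨ IsBookOn G S := by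
  by_cases hex : ∃ l, m + 2 ≤ l ∧ CycleIn G S l
  · obtain ⟨C, hC, hCl, hmax⟩ := exists_longest_cycle hex
    have hge' : S.card ^ 2 ≤ 2 * degSum G S := by rw [hS]; nlinarith
    rcases hC.cycleIn_of_longest hmax (by omega) hge' with h | ⟨h, -⟩
    · exact Or.inl fun l h3 hl => h l h3 (by omega)
    · rcases hC.pancyclic_or_bipartite h ⟨m, by omega⟩ hge' with h' | h'
      · exact Or.inl fun l h3 hl => h' l h3 (by omega)
      · exact Or.inr (Or.inl h')
  · push Not at hex
    right; right
    by_cases h4 : 4 ≤ m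
    · exact Or.inl (isTwoCliquesOn_of_no_long_cycle h4 hS hge hex)
    obtain rfl | rfl : m = 2 ∨ m = 3 := by omega
    · exact Or.inl (isTwoCliquesOn_of_card_four hS hge (hex 4 le_rfl))
    · exact exceptional_of_card_six hS hge hex

/-- Alternating paths of every even order between the sides, built by adding one vertex at each end.
Each step reverses the inner path so that its ends face the opposite sides. -/
theorem exists_isPathList_of_bipartite [DecidableEq V] {A B : Finset V} (hdisj : Disjoint A B)
    (hAB : ∀ a ∈ A, ∀ b ∈ B, G.Adj a b) {a b : V} (ha : a ∈ A) (hb : b ∈ B) {j : ℕ} (hj : 1 ≤ j)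
    (hjA : j ≤ A.card) (hjB : j ≤ B.card) :
    ∃ P, IsPathList G (A ∪ B) P a b ∧ P.length = 2 * j := by
  induction j, hj using Nat.le_induction generalizing A B a b with
  | base =>
    have h := (isPathList_singleton (G := G) (S := A ∪ B) (Finset.mem_union_left _ ha)).append
      (isPathList_singleton (Finset.mem_union_right _ hb)) (hAB a ha b hb) (by
        intro x hx
        rw [List.mem_singleton] at hx ⊢
        subst hx
        exact (hAB x ha b hb).ne)
    exact ⟨_, h, rfl⟩
  | succ j hj ih =>
    obtain ⟨a', ha', haa⟩ := Finset.exists_mem_ne (show 1 < A.card by omega) a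
    obtain ⟨b', hb', hbb⟩ := Finset.exists_mem_ne (show 1 < B.card by omega) b
    obtain ⟨P, hP, hl⟩ := ih (A := A.erase a) (B := B.erase b)
      (hdisj.mono (Finset.erase_subset _ _) (Finset.erase_subset _ _))
      (fun x hx y hy => hAB x (Finset.mem_of_mem_erase hx) y (Finset.mem_of_mem_erase hy))
      (a := a') (b := b') (by simp [ha', haa]) (by simp [hb', hbb])
      (by rw [Finset.card_erase_of_mem ha]; omega) (by rw [Finset.card_erase_of_mem hb]; omega)
    have haP : a ∉ P := by
      intro h
      have := hP.mem a h
      simp only [Finset.mem_union, Finset.mem_erase] at this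
      rcases this with h | h
      · exact h.1 rfl
      · exact Finset.disjoint_left.1 hdisj ha h.2
    have hbP : b ∉ P := by
      intro h
      have := hP.mem b h
      simp only [Finset.mem_union, Finset.mem_erase] at this
      rcases this with h | h
      · exact Finset.disjoint_left.1 hdisj h.2 hb
      · exact h.1 rfl
    have hab : a ≠ b := (hAB a ha b hb).ne
    have hP' : IsPathList G (A ∪ B) P a' b' := hP.mono fun x hx =>
      Finset.union_subset_union (Finset.erase_subset _ _) (Finset.erase_subset _ _) (hP.mem x hx)
    have h := ((isPathList_singleton (G := G) (S := A ∪ B)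
      (Finset.mem_union_left _ ha)).append hP'.reverse (hAB a ha b' hb') (by
        intro x hx hx'
        rw [List.mem_singleton] at hx
        subst hx
        exact haP (List.mem_reverse.1 hx'))).append
      (isPathList_singleton (Finset.mem_union_right _ hb)) (hAB a' ha' b hb) (by
        intro x hx hx'
        rw [List.mem_singleton] at hx'
        subst hx'
        rcases List.mem_append.1 hx with hx | hx
        · exact hab (List.mem_singleton.1 hx).symm
        · exact hbP (List.mem_reverse.1 hx))
    exact ⟨_, h, by simp [hl]; omega⟩

/-- If `v` sees only one side, its degree makes it see all of it, and the result is again complete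
bipartite. If it sees both, alternating paths between two of its neighbours give the even lengths
directly and the odd ones through `v`. -/
theorem insert_bipartite [DecidableEq V] {m : ℕ} {v : V} (hm : 1 ≤ m) (hS : S.card = 2 * m + 1)
    (hv : v ∈ S) (hd : degIn G S v = m) (h : IsBalancedBipartiteOn G (S.erase v)) :
    (∀ l, 3 ≤ l → l ≤ m + 2 → CycleIn G S l) ∨ IsBalancedBipartiteOn G S := by
  obtain ⟨A, hA, hAc, hadj⟩ := h
  have hHc : (S.erase v).card = 2 * m := by rw [Finset.card_erase_of_mem hv, hS]; omega
  set B := S.erase v \ A with hB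
  have hBc : B.card = m := by rw [hB, Finset.card_sdiff_of_subset hA, hHc, hAc, hHc]; omega
  have hAc' : A.card = m := by omega
  have hAS : A ⊆ S := hA.trans (Finset.erase_subset _ _)
  have hBS : B ⊆ S := Finset.sdiff_subset.trans (Finset.erase_subset _ _)
  have hvA : v ∉ A := fun h => by simpa using hA h
  have hvB : v ∉ B := fun h => by simpa using (Finset.sdiff_subset h : v ∈ S.erase v)
  have hdisj : Disjoint A B := Finset.disjoint_sdiff
  have hAB : ∀ a ∈ A, ∀ b ∈ B, G.Adj a b := by
    intro a ha b hb
    rw [hB, Finset.mem_sdiff] at hb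
    rw [hadj a (hA ha) b hb.1]
    tauto
  have hcase : ∀ u ∈ S, u = v ∨ (u ∈ A ∧ u ∉ B) ∨ (u ∉ A ∧ u ∈ B) := by
    intro u hu
    simp only [hB, Finset.mem_sdiff, Finset.mem_erase]
    tauto
  have hHS : S.erase v = A ∪ B := by rw [hB, Finset.union_sdiff_of_subset hA]
  have hsum : degIn G S v = degIn G A v + degIn G B v := by
    rw [← degIn_erase_self, hHS, degIn_union hdisj]
  have hAA : ∀ a ∈ A, ∀ b ∈ A, ¬ G.Adj a b := by
    intro a ha b hb h
    exact (hadj a (hA ha) b (hA hb)).1 h (by tauto)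
  have hBB : ∀ a ∈ B, ∀ b ∈ B, ¬ G.Adj a b := by
    intro a ha b hb h
    rw [hB, Finset.mem_sdiff] at ha hb
    exact (hadj a ha.1 b hb.1).1 h (by tauto)
  have noNbr : ∀ X : Finset V, degIn G X v = 0 → ∀ a ∈ X, ¬ G.Adj v a := by
    intro X hX a ha h
    have := degIn_pos_iff.2 ⟨a, ha, h⟩
    omega
  have bip : ∀ X Y : Finset V, X ⊆ S → X.card = m → Y.card = m → v ∉ X →
      (∀ u ∈ S, u = v ∨ (u ∈ X ∧ u ∉ Y) ∨ (u ∉ X ∧ u ∈ Y)) → (∀ a ∈ X, ∀ b ∈ Y, G.Adj a b) →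
      (∀ a ∈ X, ∀ b ∈ X, ¬ G.Adj a b) → (∀ a ∈ Y, ∀ b ∈ Y, ¬ G.Adj a b) →
      v ∉ Y → degIn G X v = 0 → degIn G Y v = m → IsBalancedBipartiteOn G S := by
    intro X Y hXS hXc hYc hvX hc hXY hXX hYY hvY hX0 hY0
    refine ⟨insert v X, Finset.insert_subset hv hXS, ?_, ?_⟩
    · rw [Finset.card_insert_of_notMem hvX, hXc, hS]; omega
    have hvYall := degIn_eq_card_iff.1 (hY0.trans hYc.symm)
    have hvX0 := noNbr X hX0
    intro u hu w hw
    rw [Finset.mem_insert, Finset.mem_insert]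
    rcases hc u hu with rfl | ⟨h1, h2⟩ | ⟨h1, h2⟩
    · rcases hc w hw with rfl | ⟨h3, h4⟩ | ⟨h3, h4⟩
      · simp
      · simp [h3, hvX0 w h3]
      · have : w ≠ u := by rintro rfl; exact hvY h4
        simp [h3, this, hvYall w h4]
    · rcases hc w hw with rfl | ⟨h3, h4⟩ | ⟨h3, h4⟩
      · have : ¬ G.Adj u w := fun h => hvX0 u h1 h.symm
        simp [h1, this]
      · simp [h1, h3, hXX u h1 w h3]
      · have : w ≠ v := by rintro rfl; exact hvY h4
        simp [h1, h3, this, hXY u h1 w h4]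
    · have huv : u ≠ v := by rintro rfl; exact hvY h2
      rcases hc w hw with rfl | ⟨h3, h4⟩ | ⟨h3, h4⟩
      · simp [h1, huv, (hvYall u h2).symm]
      · simp [h1, h3, huv, (hXY w h3 u h2).symm]
      · have : w ≠ v := by rintro rfl; exact hvY h4
        simp [h1, h3, huv, this, hYY u h2 w h4]
  rcases Nat.eq_zero_or_pos (degIn G A v) with hA0 | hA0
  · exact Or.inr (bip A B hAS hAc' hBc hvA hcase hAB hAA hBB hvB hA0 (by omega))
  rcases Nat.eq_zero_or_pos (degIn G B v) with hB0 | hB0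
  · refine Or.inr (bip B A hBS hBc hAc' hvB ?_ (fun a ha b hb => (hAB b hb a ha).symm) hBB hAA
      hvA hB0 (by omega))
    intro u hu
    have := hcase u hu
    tauto
  left
  obtain ⟨a, ha, hva⟩ := degIn_pos_iff.1 hA0
  obtain ⟨b, hb, hvb⟩ := degIn_pos_iff.1 hB0
  intro l h3 hl
  obtain ⟨j, hj | hj⟩ := Nat.even_or_odd' l
  · obtain ⟨P, hP, hlP⟩ := exists_isPathList_of_bipartite hdisj hAB ha hb (j := j) (by omega)
      (by omega) (by omega)
    have hP' := hP.mono (T := S) fun x hx => Finset.union_subset hAS hBS (hP.mem x hx)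
    have := hP'.cycleIn (hAB a ha b hb).symm (by omega)
    rwa [hlP, ← hj] at this
  · obtain ⟨P, hP, hlP⟩ := exists_isPathList_of_bipartite hdisj hAB ha hb (j := j) (by omega)
      (by omega) (by omega)
    have hP' := hP.mono (T := S) fun x hx => Finset.union_subset hAS hBS (hP.mem x hx)
    have := ((isPathList_singleton hv).append hP' hva (by
      intro x hx hx'
      rw [List.mem_singleton] at hx
      subst hx
      rcases Finset.mem_union.1 (hP.mem x hx') with h | h
      exacts [hvA h, hvB h])).cycleIn hvb.symm (by simp [hlP]; omega)
    rwa [List.length_append, hlP, List.length_singleton, Nat.add_comm, ← hj] at this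

/-- The clique of order `m + 1` supplies all lengths but `m + 2`. That length arises when `v` has
two neighbours in this clique, or when its only neighbour there is not the cut vertex. Otherwise `v`
is adjacent to `z` and to all of the smaller clique, and enlarges it. -/
theorem insert_twoCliques [DecidableEq V] {m : ℕ} {v : V} (hm : 2 ≤ m) (hS : S.card = 2 * m + 1)
    (hv : v ∈ S) (hd : degIn G S v = m) (h : IsTwoCliquesOn G (S.erase v)) :
    (∀ l, 3 ≤ l → l ≤ m + 2 → CycleIn G S l) ∨ IsTwoCliquesOn G S := by
  have hHc : (S.erase v).card = 2 * m := by rw [Finset.card_erase_of_mem hv, hS]; omega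
  obtain ⟨A, hA, z, hz, hAc, hBc, hsep, hAcomp, hBcomp⟩ := h.exists_blocks
  rw [hHc] at hAc hBc
  have hAc' : A.card = m + 1 := by omega
  have hAS : A ⊆ S := hA.trans (Finset.erase_subset _ _)
  have hvA : v ∉ A := fun h => by simpa using hA h
  set B := S.erase v \ A with hB
  have hzB : z ∉ B := by simp [hB, hz]
  have hBc' : B.card = m - 1 := by
    rw [Finset.card_insert_of_notMem hzB] at hBc; omega
  have hvB : v ∉ B := by simp [hB]
  have hBS : B ⊆ S := Finset.sdiff_subset.trans (Finset.erase_subset _ _)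
  have hsum : degIn G S v = degIn G A v + degIn G B v := by
    rw [← degIn_erase_self, ← Finset.union_sdiff_of_subset hA, ← hB,
      degIn_union Finset.disjoint_sdiff]
  have hlong : CycleIn G S (m + 2) → ∀ l, 3 ≤ l → l ≤ m + 2 → CycleIn G S l := by
    intro h l h3 hl
    by_cases hl' : l = m + 2
    · rwa [hl']
    · exact (cycleIn_of_complete hAcomp h3 (by omega)).mono hAS
  have hext : ∀ P x y, IsPathList G A P x y → G.Adj v x →
      IsPathList G S ([v] ++ P) v y := by
    intro P x y hP hvx
    refine (isPathList_singleton hv).append (hP.mono fun w hw => hAS (hP.mem w hw)) hvx ?_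
    intro w hw hw'
    rw [List.mem_singleton] at hw
    subst hw
    exact hvA (hP.mem w hw')
  by_cases h2 : 2 ≤ degIn G A v
  · left
    obtain ⟨x, hx, y, hy, hxy, hvx, hvy⟩ := exists_two_nbrs h2
    obtain ⟨P, hP, hl⟩ := exists_isPathList_of_complete hAcomp hx hy hxy (j := m + 1) (by omega)
      (by omega)
    have := (hext P x y hP hvx).cycleIn hvy.symm (by simp [hl]; omega)
    rw [List.length_append, hl, List.length_singleton, show 1 + (m + 1) = m + 2 by omega] at this
    exact hlong this
  have hBle := degIn_le_card (G := G) (S := B) v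
  have hBall := degIn_eq_card_iff.1 (show degIn G B v = B.card by omega)
  obtain ⟨u, hu, hvu⟩ := degIn_pos_iff.1 (show 0 < degIn G A v by omega)
  have huniq : ∀ w ∈ A, G.Adj v w → w = u := by
    intro w hw hvw
    by_contra hne
    exact h2 (two_le_degIn hw hu hne hvw hvu)
  by_cases huz : u = z
  · subst huz
    right
    refine isTwoCliquesOn_of_blocks hAS hu ?_ hAcomp ?_ (Or.inl (by omega))
    · intro a ha hau w hw haw
      by_cases hwv : w = v
      · subst hwv
        exact absurd (huniq a ha haw.symm) hau
      · exact hsep a ha hau w (by simp [hw, hwv]) haw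
    · have hmem : ∀ w ∈ insert u (S \ A), w = v ∨ w ∈ insert u B := by
        intro w hw
        simp only [hB, Finset.mem_insert, Finset.mem_sdiff, Finset.mem_erase] at hw ⊢
        tauto
      have hvall : ∀ w ∈ insert u B, G.Adj v w := by
        intro w hw
        rcases Finset.mem_insert.1 hw with rfl | hw
        exacts [hvu, hBall w hw]
      intro x hx y hy hxy
      rcases hmem x hx with rfl | hx <;> rcases hmem y hy with rfl | hy
      exacts [absurd rfl hxy, hvall y hy, (hvall x hx).symm, hBcomp x hx y hy hxy]
  · left
    obtain ⟨b, hb⟩ := Finset.card_pos.1 (show 0 < B.card by omega)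
    -- One vertex of the large clique is left out, since both `v` and `b` are added to reach length
    -- `m + 2`.
    obtain ⟨P, hP, hl⟩ := exists_isPathList_of_complete hAcomp hu hz huz (j := m) (by omega)
      (by omega)
    have hbz : G.Adj z b := hBcomp z (by simp) b (by simp [hb]) (fun h => hzB (h ▸ hb))
    have hbA : b ∉ A := by
      rw [hB, Finset.mem_sdiff] at hb
      exact hb.2
    have := ((hext P u z hP hvu).append (isPathList_singleton (hBS hb)) hbz (by
      intro x hx hx'
      rw [List.mem_singleton] at hx'
      subst hx'
      rcases List.mem_append.1 hx with hx | hx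
      · rw [List.mem_singleton] at hx
        exact hvB (hx ▸ hb)
      · exact hbA (hP.mem x hx))).cycleIn (hBall b hb).symm (by simp [hl]; omega)
    rw [List.length_append, List.length_append, hl, List.length_singleton, List.length_singleton,
      show 1 + m + 1 = m + 2 by omega] at this
    exact hlong this

theorem insert_book [DecidableEq V] {v : V} (hv : v ∈ S) (hd : 3 ≤ degIn G S v)
    (h : IsBookOn G (S.erase v)) : ∀ l, 3 ≤ l → l ≤ 5 → CycleIn G S l := by
  obtain ⟨hc, a, ha, b, hb, hab, hadj⟩ := h
  have hsub := Finset.erase_subset v S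
  have hb' : b ∈ (S.erase v).erase a := by simp only [Finset.mem_erase] at hb ⊢; tauto
  set J := ((S.erase v).erase a).erase b with hJ
  have hJc : J.card = 4 := by
    rw [hJ, Finset.card_erase_of_mem hb', Finset.card_erase_of_mem ha, hc]
  have hJm : ∀ j ∈ J, j ∈ S ∧ j ≠ v ∧ j ≠ a ∧ j ≠ b ∧ G.Adj j a ∧ G.Adj j b := by
    intro j hj
    simp only [hJ, Finset.mem_erase] at hj
    have hjE : j ∈ S.erase v := by simp [hj]
    refine ⟨hj.2.2.2, hj.2.2.1, hj.2.1, hj.1, ?_, ?_⟩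
    · rw [hadj j hjE a ha hj.2.1]; tauto
    · rw [hadj j hjE b hb hj.1]; tauto
  have hab' : G.Adj a b := by rw [hadj a ha b hb hab]; tauto
  have haS := hsub ha
  have hbS := hsub hb
  have hva : v ≠ a := fun h => by simp [h] at ha
  have hvb : v ≠ b := fun h => by simp [h] at hb
  obtain ⟨j, hj, j', hj', hjj⟩ := Finset.one_lt_card.1 (show 1 < J.card by omega)
  obtain ⟨q1, q2, q3, q4, q5, q6⟩ := hJm j hj
  obtain ⟨r1, r2, r3, r4, r5, r6⟩ := hJm j' hj'
  intro l h3 hl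
  obtain rfl | rfl | rfl : l = 3 ∨ l = 4 ∨ l = 5 := by omega
  · exact ⟨[a, b, j], ⟨by simp [hab, q3.symm, q4.symm], by simp [hab', q6.symm],
      by simp [haS, hbS, q1], by simpa using q5, by simp⟩, rfl⟩
  · exact ⟨[a, j, b, j'], ⟨by simp [hab, q3.symm, r3.symm, q4, hjj, r4.symm],
      by simp [q5.symm, q6, r6.symm], by simp [haS, hbS, q1, r1], by simpa using r5, by simp⟩, rfl⟩
  · by_cases h2 : 2 ≤ degIn G J v
    · obtain ⟨x, hx, y, hy, hxy, hvx, hvy⟩ := exists_two_nbrs h2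
      obtain ⟨s1, s2, s3, s4, s5, s6⟩ := hJm x hx
      obtain ⟨t1, t2, t3, t4, t5, t6⟩ := hJm y hy
      refine cycleIn_five (a := v) (b := x) (c := a) (d := b) (e := y) ?_ ?_ hvx s5 hab' t6.symm
        hvy.symm
      · simp [hv, s1, t1, haS, hbS]
      · simp [s2.symm, hva, hvb, t2.symm, s3, s4, hxy, hab, t3.symm, t4.symm]
    · have hSE : S.erase v = insert a (insert b J) := by
        rw [hJ, Finset.insert_erase hb', Finset.insert_erase ha]
      have hbJ : b ∉ J := by simp [hJ]
      have haJ : a ∉ insert b J := by simp [hJ, hab]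
      rw [← degIn_erase_self, hSE, degIn_insert haJ, degIn_insert hbJ] at hd
      have hva' : G.Adj v a := by
        by_contra hn
        rw [if_neg hn] at hd
        split_ifs at hd <;> omega
      obtain ⟨x, hx, hvx⟩ := degIn_pos_iff.1 (show 0 < degIn G J v by split_ifs at hd <;> omega)
      obtain ⟨y, hy, hyx⟩ := Finset.exists_mem_ne (show 1 < J.card by omega) x
      obtain ⟨s1, s2, s3, s4, s5, s6⟩ := hJm x hx
      obtain ⟨t1, t2, t3, t4, t5, t6⟩ := hJm y hy
      refine cycleIn_five (a := v) (b := x) (c := b) (d := y) (e := a) ?_ ?_ hvx s6 t6.symm t5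
        hva'.symm
      · simp [hv, s1, t1, haS, hbS]
      · simp [s2.symm, hva, hvb, t2.symm, s3, s4, hyx.symm, hab.symm, t3, t4.symm]

theorem odd_order_cycles [Finite V] {m : ℕ} (hm : 1 ≤ m) (hS : S.card = 2 * m + 1)
    (hge : 2 * (m ^ 2 + m) ≤ degSum G S) :
    (∀ l, 3 ≤ l → l ≤ m + 2 → CycleIn G S l) ∨
      IsBalancedBipartiteOn G S ∨ IsTwoCliquesOn G S := by
  classical
  by_cases hlow : ∃ v ∈ S, degIn G S v ≤ m
  · obtain ⟨v, hv, hd⟩ := hlow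
    have hHc : (S.erase v).card = 2 * m := by rw [Finset.card_erase_of_mem hv, hS]; omega
    have hdeg := degSum_eq_erase (G := G) hv
    have hsq : (2 * m) ^ 2 / 4 = m ^ 2 := by
      rw [show (2 * m) ^ 2 = m ^ 2 * 4 by ring, Nat.mul_div_cancel _ (by norm_num)]
    by_cases hm1 : m = 1
    · subst hm1
      have hb := isBalancedBipartiteOn_of_card_two (G := G) hHc (by omega)
      have := hb.degSum_eq
      rw [hHc, hsq] at this
      rcases insert_bipartite le_rfl hS hv (by omega) hb with h | h
      exacts [Or.inl h, Or.inr (Or.inl h)]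
    rcases even_order_cycles (G := G) (S := S.erase v) (by omega) hHc (by omega) with h | h | h | h
    · exact Or.inl fun l h3 hl => (h l h3 hl).mono (Finset.erase_subset _ _)
    · have := h.degSum_eq
      rw [hHc, hsq] at this
      rcases insert_bipartite hm hS hv (by omega) h with h | h
      exacts [Or.inl h, Or.inr (Or.inl h)]
    · have := h.degSum_eq
      rw [hHc, hsq] at this
      rcases insert_twoCliques (by omega) hS hv (by omega) h with h | h
      exacts [Or.inl h, Or.inr (Or.inr h)]
    · have := h.degSum_eq
      obtain rfl : m = 3 := by have := h.1; omega
      exact Or.inl (insert_book hv (by omega) h)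
  · push Not at hlow
    left
    -- With minimum degree `m + 1`, an end block would have at least `m + 2` and fewer than `m + 2`
    -- vertices.
    have hex : ∃ l, m + 2 ≤ l ∧ CycleIn G S l := by
      by_contra hcon
      push Not at hcon
      obtain ⟨A, -, z, -, h1, h2, -⟩ := exists_end_block (δ := m + 1) (r := m + 2)
        (Finset.card_pos.1 (by omega)) (by omega) (by omega) hlow hcon
      omega
    have hsum := Finset.card_nsmul_le_sum S (degIn G S) (m + 1) hlow
    rw [hS, smul_eq_mul] at hsum
    obtain ⟨C, hC, hCl, hmax⟩ := exists_longest_cycle hex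
    have hlt : S.card ^ 2 < 2 * degSum G S := by
      rw [hS]
      unfold degSum
      nlinarith
    rcases hC.cycleIn_of_longest hmax (by omega) hlt.le with h | ⟨-, h⟩
    · exact fun l h3 hl => h l h3 (by omega)
    · omega

/-- The main theorem for the graph spanned by a finite set of vertices. -/
theorem cycles_or_exceptional [Finite V] (hge : 2 * (S.card ^ 2 / 4) ≤ degSum G S) :
    (∀ l, 3 ≤ l → l ≤ S.card / 2 + 2 → CycleIn G S l) ∨
      IsBalancedBipartiteOn G S ∨ IsTwoCliquesOn G S ∨ IsBookOn G S := by
  obtain ⟨m, hm | hm⟩ := Nat.even_or_odd' S.card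
  · rw [hm, show (2 * m) ^ 2 = m ^ 2 * 4 by ring, Nat.mul_div_cancel _ (by norm_num)] at hge
    rw [show S.card / 2 = m by omega]
    by_cases h0 : m = 0
    · exact Or.inl fun l h3 hl => by omega
    by_cases h1 : m = 1
    · subst h1
      exact Or.inr (Or.inl (isBalancedBipartiteOn_of_card_two hm hge))
    · exact even_order_cycles (by omega) hm hge
  · rw [hm, show (2 * m + 1) ^ 2 = 1 + 4 * (m ^ 2 + m) by ring,
      Nat.add_mul_div_left _ _ (by norm_num)] at hge
    rw [show S.card / 2 = m by omega]
    by_cases h0 : m = 0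
    · exact Or.inl fun l h3 hl => by omega
    rcases odd_order_cycles (G := G) (by omega) hm (by omega) with h | h | h
    exacts [Or.inl h, Or.inr (Or.inl h), Or.inr (Or.inr (Or.inl h))]

end AllOrders

/-! ### List cycles and Mathlib walks -/

section Walks

variable {V : Type*} {G : SimpleGraph V}

theorem CycleIn.hasCycleOfLength {S : Finset V} {l : ℕ} (h : CycleIn G S l) :
    HasCycleOfLength G l := by
  obtain ⟨P, hP, rfl⟩ := h
  have h3 := hP.three_le
  have hne : P ≠ [] := List.ne_nil_of_length_pos (by omega)
  have hadj : G.Adj (P.getLast hne) (P.head hne) :=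
    hP.close _ (List.getLast_mem_getLast? hne) _ (List.head_mem_head? hne)
  set p := SimpleGraph.Walk.ofSupport P hne hP.chain with hp
  have hlen : p.length = P.length - 1 := by simp [hp]
  have hpath : p.IsPath := by
    rw [SimpleGraph.Walk.isPath_def, hp, SimpleGraph.Walk.support_ofSupport]
    exact hP.nodup
  refine ⟨_, SimpleGraph.Walk.cons hadj p, ?_, by simp [hlen]; omega⟩
  rw [SimpleGraph.Walk.cons_isCycle_iff]
  refine ⟨hpath, fun hmem => ?_⟩
  rw [Sym2.eq_swap] at hmem
  have := hpath.length_eq_one_of_mem_edges hmem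
  omega

theorem HasCycleOfLength.cycleIn [Fintype V] {l : ℕ} (h : HasCycleOfLength G l) :
    CycleIn G Finset.univ l := by
  obtain ⟨v, p, hp, rfl⟩ := h
  have h3 := hp.three_le_length
  cases p with
  | nil => simp at h3
  | cons hadj q =>
    rw [SimpleGraph.Walk.cons_isCycle_iff] at hp
    refine ⟨q.support, ⟨hp.1.support_nodup, q.isChain_adj_support, fun _ _ => Finset.mem_univ _,
      ?_, ?_⟩, by simp⟩
    · intro b hb a ha
      rw [List.getLast?_eq_some_getLast q.support_ne_nil, SimpleGraph.Walk.getLast_support,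
        Option.mem_some_iff] at hb
      rw [List.head?_eq_some_head q.support_ne_nil, SimpleGraph.Walk.head_support,
        Option.mem_some_iff] at ha
      exact hb ▸ ha ▸ hadj
    · simpa using h3

end Walks

/-! ### The cycle length absent from each exceptional graph -/

section MissingLengths

variable {V : Type*} {G : SimpleGraph V} {S : Finset V}

theorem IsBalancedBipartiteOn.not_cycleIn_three (h : IsBalancedBipartiteOn G S) :
    ¬ CycleIn G S 3 := by
  obtain ⟨A, -, -, hadj⟩ := h
  rintro ⟨P, hP, hl⟩
  obtain ⟨x, y, z, rfl⟩ := List.length_eq_three.1 hl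
  have hmem := hP.mem
  have hchain := hP.chain
  have hclose := hP.close
  simp only [List.mem_cons, List.not_mem_nil, or_false, forall_eq_or_imp, forall_eq] at hmem
  simp only [List.isChain_cons_cons, List.isChain_singleton, and_true] at hchain
  have hzx : G.Adj z x := hclose z (by simp) x (by simp)
  have h1 := (hadj x hmem.1 y hmem.2.1).1 hchain.1
  have h2 := (hadj y hmem.2.1 z hmem.2.2).1 hchain.2
  have h3 := (hadj z hmem.2.2 x hmem.1).1 hzx
  tauto

/-- Two vertices meet every edge, but a 5-cycle has no vertex cover of size two. -/
theorem IsBookOn.not_cycleIn_five (h : IsBookOn G S) : ¬ CycleIn G S 5 := by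
  obtain ⟨-, a, -, b, -, -, hadj⟩ := h
  rintro ⟨P, hP, hl⟩
  have hcover : ∀ u ∈ P, ∀ v ∈ P, G.Adj u v → u = a ∨ u = b ∨ v = a ∨ v = b :=
    fun u hu v hv huv => (hadj u (hP.mem u hu) v (hP.mem v hv) huv.ne).1 huv
  match P, hl with
  | [v, w, x, y, z], _ =>
    have hnodup := hP.nodup
    have hchain := hP.chain
    simp only [List.isChain_cons_cons, List.isChain_singleton, and_true] at hchain
    have h1 := hcover v (by simp) w (by simp) hchain.1
    have h2 := hcover w (by simp) x (by simp) hchain.2.1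
    have h3 := hcover x (by simp) y (by simp) hchain.2.2.1
    have h4 := hcover y (by simp) z (by simp) hchain.2.2.2
    have h5 := hcover z (by simp) v (by simp) (hP.close z (by simp) v (by simp))
    simp only [List.nodup_cons, List.mem_cons, List.not_mem_nil, not_or] at hnodup
    grind

theorem List.IsChain.forall_mem_iff {α : Type*} {R : α → α → Prop} {p : α → Prop} {x : α}
    {l : List α} (h : (x :: l).IsChain R)
    (hR : ∀ u ∈ x :: l, ∀ v ∈ x :: l, R u v → (p u ↔ p v)) : ∀ y ∈ x :: l, (p y ↔ p x) := by
  induction l generalizing x with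
  | nil => simp
  | cons w l ih =>
    rw [List.isChain_cons_cons] at h
    intro y hy
    rcases List.mem_cons.1 hy with rfl | hy
    · rfl
    · rw [ih h.2 (fun u hu v hv => hR u (List.mem_cons_of_mem _ hu) v (List.mem_cons_of_mem _ hv))
        y hy]
      exact (hR x (by simp) w (by simp) h.1).symm

/-- A cycle stays on one side of a cut vertex. -/
theorem IsCycleList.subset_side {A : Finset V} {z : V} {P : List V}
    (hP : IsCycleList G S P)
    (hsep : ∀ u ∈ S, ∀ v ∈ S, u ≠ z → v ≠ z → G.Adj u v → (u ∈ A ↔ v ∈ A)) :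
    (∀ x ∈ P, x ≠ z → x ∈ A) ∨ (∀ x ∈ P, x ≠ z → x ∉ A) := by
  have key : ∀ x Q, IsCycleList G S (x :: Q) → z ∉ Q →
      (∀ y ∈ x :: Q, y ≠ z → y ∈ A) ∨ (∀ y ∈ x :: Q, y ≠ z → y ∉ A) := by
    intro x Q hQ hz
    have h3 := hQ.three_le
    rcases Q with _ | ⟨w, Q⟩
    · simp at h3
    have hch := List.isChain_cons_cons.1 hQ.chain
    have hne : ∀ u ∈ w :: Q, u ≠ z := fun u hu h => hz (h ▸ hu)
    have hside := hch.2.forall_mem_iff (p := (· ∈ A)) fun u hu v hv =>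
      hsep u (hQ.mem u (by simp_all)) v (hQ.mem v (by simp_all)) (hne u hu) (hne v hv)
    have hall : ∀ y ∈ x :: w :: Q, y ≠ z → (y ∈ A ↔ w ∈ A) := by
      intro y hy hyz
      rcases List.mem_cons.1 hy with rfl | hy
      · exact hsep y (hQ.mem y (by simp)) w (hQ.mem w (by simp)) hyz (hne w (by simp)) hch.1
      · exact hside y hy
    by_cases hw : w ∈ A
    · exact Or.inl fun y hy hyz => (hall y hy hyz).2 hw
    · exact Or.inr fun y hy hyz h => hw ((hall y hy hyz).1 h)
  by_cases hz : z ∈ P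
  -- A rotation starting at the cut vertex leaves a path that avoids it, and such a path cannot
  -- change sides.
  · obtain ⟨i, hi, rfl⟩ := List.getElem_of_mem hz
    have hrot := hP.rotate i
    have hmem : ∀ x, x ∈ P.rotate i ↔ x ∈ P := fun x => List.mem_rotate
    obtain ⟨Q, hQ⟩ : ∃ Q, P.rotate i = P[i] :: Q :=
      ⟨P.drop (i + 1) ++ P.take i, by
        rw [List.rotate_eq_drop_append_take hi.le, List.drop_eq_getElem_cons hi]; rfl⟩
    rw [hQ] at hrot hmem
    simpa only [hmem] using key _ Q hrot (List.nodup_cons.1 hrot.nodup).1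
  · rcases P with _ | ⟨x, Q⟩
    · simp
    · exact key x Q hP fun h => hz (List.mem_cons_of_mem _ h)

/-- A cycle stays inside one clique together with the cut vertex, hence has at most `S.card / 2 + 1`
vertices. -/
theorem IsTwoCliquesOn.not_cycleIn (h : IsTwoCliquesOn G S) :
    ¬ CycleIn G S (S.card / 2 + 2) := by
  classical
  obtain ⟨z, hz, A, hAS, hzA, hAc, hadj⟩ := h
  rintro ⟨P, hP, hl⟩
  have hside := hP.subset_side (A := A) (z := z) fun u hu v hv huz hvz huv => by
    have := (hadj u hu v hv huv.ne).1 huv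
    tauto
  rw [← List.toFinset_card_of_nodup hP.nodup] at hl
  have hle : ∀ T : Finset V, (∀ x ∈ P, x ≠ z → x ∈ T) → P.toFinset.card ≤ T.card + 1 :=
    fun T hT => (Finset.card_le_card fun x hx => by
      rw [List.mem_toFinset] at hx
      rw [Finset.mem_insert]
      exact or_iff_not_imp_left.2 (hT x hx)).trans (Finset.card_insert_le z T)
  rcases hside with h | h
  · have := hle A h
    omega
  · have := hle ((S \ A).erase z) fun x hx hxz => by
      simp [hxz, hP.mem x hx, h x hx hxz]
    have hc := Finset.card_erase_of_mem (s := S \ A) (a := z) (by simp [hz, hzA])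
    have := Finset.card_sdiff_of_subset hAS
    omega

end MissingLengths

/-! ### Internal descriptions of the exceptions versus isomorphism -/

section Isomorphisms

variable {V W κ : Type*} [Fintype V] [Fintype W] [DecidableEq κ]

/-- In each exceptional graph, adjacency of distinct vertices depends only on the parts containing
them. A bijection that preserves parts is therefore an isomorphism, and it exists once the part
sizes agree. -/
theorem exists_equiv_of_card_fibers (f : V → κ) (g : W → κ)
    (h : ∀ k, (Finset.univ.filter (f · = k)).card = (Finset.univ.filter (g · = k)).card) :
    ∃ e : V ≃ W, ∀ v, g (e v) = f v := by
  have e : ∀ k, {v // f v = k} ≃ {w // g w = k} := fun k =>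
    Fintype.equivOfCardEq (by rw [Fintype.card_subtype, Fintype.card_subtype, h k])
  refine ⟨(Equiv.sigmaFiberEquiv f).symm.trans
    ((Equiv.sigmaCongrRight e).trans (Equiv.sigmaFiberEquiv g)), fun v => ?_⟩
  exact (e (f v) ⟨v, rfl⟩).2

theorem Equiv.card_filter_comp (e : V ≃ W) (p : W → Prop) [DecidablePred p] :
    (Finset.univ.filter fun v => p (e v)).card = (Finset.univ.filter p).card :=
  Finset.card_equiv e (by simp)

variable {G : SimpleGraph V}

theorem card_filter_isLeft (a b : ℕ) (k : Bool) :
    (Finset.univ.filter fun w : Fin a ⊕ Fin b => w.isLeft = k).card = bif k then a else b := by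
  rw [Finset.card_filter, Fintype.sum_sum_type]
  cases k <;> simp

theorem isBalancedBipartiteOn_univ_iff :
    IsBalancedBipartiteOn G Finset.univ ↔
      Nonempty (G ≃g balancedBipartite (Fintype.card V)) := by
  classical
  generalize hn : Fintype.card V = n
  have hH : ∀ w w', (balancedBipartite n).Adj w w' ↔ ¬ (w.isLeft = true ↔ w'.isLeft = true) := by
    rintro (x | x) (y | y) <;> simp
  constructor
  · rintro ⟨A, -, hA, hadj⟩
    rw [Finset.card_univ, hn] at hA
    obtain ⟨e, he⟩ := exists_equiv_of_card_fibers (fun v => decide (v ∈ A))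
      (Sum.isLeft : Fin ((n + 1) / 2) ⊕ Fin (n / 2) → Bool) (fun k => by
        have hAc := Finset.card_compl A
        rw [card_filter_isLeft]
        cases k
        · trans Aᶜ.card
          · congr 1; ext; simp
          · simp only [cond_false]; omega
        · simpa using hA)
    refine ⟨⟨e, fun {u v} => ?_⟩⟩
    rw [hadj u (by simp) v (by simp), hH, he, he, decide_eq_true_iff, decide_eq_true_iff]
  · rintro ⟨e⟩
    refine ⟨Finset.univ.filter fun v => (e v).isLeft = true, Finset.subset_univ _, ?_, ?_⟩
    · rw [Finset.card_univ, hn]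
      exact (e.toEquiv.card_filter_comp (fun w => w.isLeft = true)).trans
        (card_filter_isLeft _ _ true)
    · intro u _ v _
      rw [← e.map_adj_iff, hH]
      simp

/-- The part of `K_1 ∨ (K_a ∪ K_b)` that contains a vertex. -/
def cliqueLabel {a b : ℕ} : Fin 1 ⊕ (Fin a ⊕ Fin b) → Option Bool :=
  Sum.elim (fun _ => none) (some ∘ Sum.isLeft)

theorem card_filter_cliqueLabel (a b : ℕ) (k : Option Bool) :
    (Finset.univ.filter fun w : Fin 1 ⊕ (Fin a ⊕ Fin b) => cliqueLabel w = k).card =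
      k.elim 1 fun i => bif i then a else b := by
  rw [Finset.card_filter, Fintype.sum_sum_type, Fintype.sum_sum_type]
  rcases k with _ | _ | _ <;> simp [cliqueLabel]

theorem twoCliquesAtVertex_adj_iff {n : ℕ} {w w' : Fin 1 ⊕ (Fin (n / 2) ⊕ Fin ((n - 1) / 2))}
    (h : w ≠ w') : (twoCliquesAtVertex n).Adj w w' ↔
      cliqueLabel w = none ∨ cliqueLabel w' = none ∨
        (cliqueLabel w = some true ↔ cliqueLabel w' = some true) := by
  rcases w with x | x | x <;> rcases w' with y | y | y <;>
    simp_all [cliqueLabel, graphJoin]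

theorem isTwoCliquesOn_univ_iff (hpos : 0 < Fintype.card V) :
    IsTwoCliquesOn G Finset.univ ↔
      Nonempty (G ≃g twoCliquesAtVertex (Fintype.card V)) := by
  classical
  generalize hn : Fintype.card V = n at hpos
  constructor
  · rintro ⟨z, -, A, -, hzA, hA, hadj⟩
    rw [Finset.card_univ, hn] at hA
    obtain ⟨f, hf⟩ : ∃ f : V → Option Bool,
      f = fun v => if v = z then none else some (decide (v ∈ A)) := ⟨_, rfl⟩
    have hnone : ∀ v, f v = none ↔ v = z := fun v => by
      by_cases hv : v = z <;> simp [hf, hv]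
    have htrue : ∀ v, f v = some true ↔ v ∈ A := fun v => by
      by_cases hv : v = z <;> simp [hf, hv, hzA]
    obtain ⟨e, he⟩ := exists_equiv_of_card_fibers f
      (cliqueLabel : Fin 1 ⊕ (Fin (n / 2) ⊕ Fin ((n - 1) / 2)) → Option Bool) (fun k => by
        rw [card_filter_cliqueLabel]
        rcases k with _ | _ | _
        · simp only [hnone, Option.elim_none]
          exact Finset.card_eq_one.2 ⟨z, by ext; simp⟩
        · trans (insert z A)ᶜ.card
          · congr 1
            ext v
            by_cases hv : v = z <;> simp [hf, hv]
          · rw [Finset.card_compl, Finset.card_insert_of_notMem hzA]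
            simp only [Option.elim_some, cond_false]
            omega
        · simpa [htrue] using hA)
    refine ⟨⟨e, fun {u v} => ?_⟩⟩
    by_cases huv : u = v
    · simp [huv]
    rw [hadj u (by simp) v (by simp) huv, twoCliquesAtVertex_adj_iff (e.injective.ne huv),
      he, he, hnone, hnone, htrue, htrue]
  · rintro ⟨e⟩
    have hnone : ∀ v, cliqueLabel (e v) = none ↔ v = e.symm (Sum.inl 0) := fun v => by
      rw [show v = e.symm (Sum.inl 0) ↔ e v = Sum.inl 0 from Equiv.eq_symm_apply e.toEquiv]
      rcases e v with x | x
      · simp [cliqueLabel, Subsingleton.elim x 0]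
      · simp [cliqueLabel]
    refine ⟨e.symm (Sum.inl 0), Finset.mem_univ _,
      Finset.univ.filter fun v => cliqueLabel (e v) = some true, Finset.subset_univ _,
      by rw [Finset.mem_filter, (hnone _).2 rfl]; simp, ?_, ?_⟩
    · rw [Finset.card_univ, hn]
      exact (e.toEquiv.card_filter_comp (fun w => cliqueLabel w = some true)).trans
        (card_filter_cliqueLabel _ _ _)
    · intro u _ v _ huv
      rw [← e.map_adj_iff, twoCliquesAtVertex_adj_iff (e.injective.ne huv), hnone, hnone]
      simp

theorem K2JoinFourK1_adj_iff {w w' : Fin 2 ⊕ Fin 4} (h : w ≠ w') :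
    K2JoinFourK1.Adj w w' ↔ w.isLeft = true ∨ w'.isLeft = true := by
  rcases w with x | x <;> rcases w' with y | y <;> simp_all [graphJoin]

theorem isBookOn_univ_iff :
    IsBookOn G Finset.univ ↔ Nonempty (G ≃g K2JoinFourK1) := by
  classical
  constructor
  · rintro ⟨h6, a, -, b, -, hab, hadj⟩
    obtain ⟨e, he⟩ := exists_equiv_of_card_fibers (fun v => decide (v = a ∨ v = b))
      (Sum.isLeft : Fin 2 ⊕ Fin 4 → Bool) (fun k => by
        have hAc := Finset.card_compl ({a, b} : Finset V)
        have h2 := Finset.card_pair hab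
        rw [Finset.card_univ] at h6
        rw [card_filter_isLeft]
        cases k
        · trans ({a, b}ᶜ : Finset V).card
          · congr 1; ext; simp
          · rw [hAc, h6, h2]; rfl
        · trans ({a, b} : Finset V).card
          · congr 1; ext; simp
          · exact h2)
    refine ⟨⟨e, fun {u v} => ?_⟩⟩
    by_cases huv : u = v
    · simp [huv]
    rw [hadj u (by simp) v (by simp) huv, K2JoinFourK1_adj_iff (e.injective.ne huv), he, he,
      decide_eq_true_iff, decide_eq_true_iff, or_assoc]
  · rintro ⟨e⟩
    refine ⟨by rw [Finset.card_univ, Fintype.card_congr e.toEquiv]; rfl,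
      e.symm (Sum.inl 0), Finset.mem_univ _, e.symm (Sum.inl 1), Finset.mem_univ _, by simp, ?_⟩
    intro u _ v _ huv
    have hleft : ∀ v, (e v).isLeft = true ↔ v = e.symm (Sum.inl 0) ∨ v = e.symm (Sum.inl 1) := by
      intro v
      have heq : ∀ x, v = e.symm x ↔ e v = x := fun x => Equiv.eq_symm_apply e.toEquiv
      rw [heq, heq]
      rcases e v with x | x
      · fin_cases x <;> simp
      · simp
    rw [← e.map_adj_iff, K2JoinFourK1_adj_iff (e.injective.ne huv), hleft, hleft, or_assoc]

end Isomorphisms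

/-! ### The main theorem -/

theorem isExceptional_iff {V : Type*} [Fintype V] {G : SimpleGraph V} {n : ℕ}
    (hn : Fintype.card V = n) (hpos : 0 < n) :
    IsExceptional n G ↔ IsBalancedBipartiteOn G Finset.univ ∨ IsTwoCliquesOn G Finset.univ ∨
      IsBookOn G Finset.univ := by
  subst hn
  rw [IsExceptional, isBalancedBipartiteOn_univ_iff, isTwoCliquesOn_univ_iff hpos,
    isBookOn_univ_iff]

theorem theorem1p9 {V : Type*} [Fintype V] [DecidableEq V] (G : SimpleGraph V)
    [DecidableRel G.Adj] (n : ℕ) (hn : Fintype.card V = n) :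
    (n ^ 2 / 4 ≤ G.edgeFinset.card → ¬ IsExceptional n G →
      ∀ l : ℕ, 3 ≤ l → l ≤ n / 2 + 2 → HasCycleOfLength G l) ∧
    (2 ≤ n → IsExceptional n G →
      n ^ 2 / 4 ≤ G.edgeFinset.card ∧
        ∃ l : ℕ, 3 ≤ l ∧ l ≤ n / 2 + 2 ∧ ¬ HasCycleOfLength G l) := by
  have hsum : degSum G Finset.univ = 2 * G.edgeFinset.card := degSum_univ
  have hcard : (Finset.univ : Finset V).card = n := hn
  constructor
  · intro hE hex l h3 hl
    -- For `n = 0` the interval of lengths is empty.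
    have hpos : 0 < n := by
      rcases Nat.eq_zero_or_pos n with rfl | h
      · omega
      · exact h
    rw [isExceptional_iff hn hpos] at hex
    have hge : 2 * ((Finset.univ : Finset V).card ^ 2 / 4) ≤ degSum G Finset.univ := by
      rw [hcard, hsum]
      omega
    exact ((cycles_or_exceptional hge).resolve_right hex l h3 (by rwa [hcard])).hasCycleOfLength
  · intro h2 hex
    rcases (isExceptional_iff hn (by omega)).1 hex with h | h | h
    · have hE := h.degSum_eq
      rw [hsum, hcard] at hE
      exact ⟨by omega, 3, le_rfl, by omega, fun hc => h.not_cycleIn_three hc.cycleIn⟩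
    · have hE := h.degSum_eq
      have hno := h.not_cycleIn
      rw [hcard] at hno
      rw [hsum, hcard] at hE
      exact ⟨by omega, n / 2 + 2, by omega, le_rfl, fun hc => hno hc.cycleIn⟩
    · have hE := h.degSum_eq
      have h6 := h.1
      rw [hcard] at h6
      subst h6
      exact ⟨by omega, 5, by norm_num, by norm_num, fun hc => h.not_cycleIn_five hc.cycleIn⟩
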